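/- **Configurations.** A *flow configuration* $\Phi$ consists of four pairwise disjoint finite sets $\Phi_{\rm open},\Phi_{\rm tan},\Phi_{\rm trans},\Phi_{\rm single}$ (of open, tangent, transverse and single cells), for each $g\in\{\mathfrak f,\mathfrak b\}$ a map $C\mapsto C^{g}$ sending $\Phi_{\rm trans}$ to $\Phi_{\rm open}$ and $\Phi_{\rm single}$ to $\Phi_{\rm open}\cup\Phi_{\rm tan}$, maps $\min,\max:\Phi_{\rm open}\cup\Phi_{\rm tan}\cup\Phi_{\rm trans}\to\Phi_{\rm single}\cup\{\infty\}$, and a number $N\in\mathbb N$. A *Dulac flow configuration* is a pair $\Psi=(\Phi,\nu)$ with $\nu\in\mathbb N$. Write $\Phi_1:=\Phi_{\rm trans}\cup\{E_C: C\in\Phi_{\rm open}\}$, where the $E_C$ are formal symbols. "Cell" below means an element of $\Phi_{\rm open}\cup\Phi_{\rm tan}\cup\Phi_{\rm trans}$. Throughout, $g\in\{\mathfrak f,\mathfrak b\}$ is arbitrary and $h$ is the other element of $\{\mathfrak f,\mathfrak b\}$. **Language $\mathcal L(\Psi)$.** Unary predicates $C$ and binary predicates $<_C$ ($C$ a cell),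 unary predicates $E_C$ ($C\in\Phi_{\rm open}$); constants $s$, $c$ ($c\in\Phi_{\rm single}$), $e_C$ ($C\in\Phi_{\rm tan}$), $r^g_C,s^g_C$ ($C\in\Phi_{\rm trans}$); unary function symbols $\mathfrak f,\mathfrak b$; and, for $C\in\Phi_1$, binary predicates $R_C$, $S^g_{m,C}$, $B^g_{m,C}$ ($m\in\mathbb N$) and constants $\gamma^1_C,\dots,\gamma^\nu_C$. When $\min(C)$ or $\max(C)$ is $\infty$, it is denoted by the constant $s$. For $C=E_D\in\Phi_1$ we put $\min(C):=\min(D)$, $\max(C):=\max(D)$, and $<_C$ is the restriction of $<_D$ to $\bar C$, where for $C\in\Phi_1\cup\Phi_{\rm tan}$, $\bar C:=C\cup\{\min(C),\max(C)\}$. For $C\in\Phi_1$, relations $x<_Cy$ in (D1)–(D6) and in $\mathrm{fix}^{\rm bd}_C$ are restricted to $x,y\in\bar C$. "Dense ordering" means dense linear ordering without endpoints; the empty set is allowed. $a\le_C b$ means $a<_C b$ or $a=b$. For $C\in\Phi_{\rm open}$ let $\phi_C^{\mathfrak f}(x,y)$ say: $x\in C\setminus E_C$, $y\in E_C$, $x<_Cy$,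 and there is no $z\in E_C$ with $x<_Cz<_Cy$; let $\phi_C^{\mathfrak b}(x,y)$ be the same with $<_C$ reversed. For $y\in E_C$ let $C_y:=\{x:\phi_C^{\mathfrak f}(x,y)\vee\phi_C^{\mathfrak b}(x,y)\vee x=y\}$. **Theory $T(\Psi)$.** The universal closures of the following. (F1) The elements $s$ and $c$ ($c\in\Phi_{\rm single}$) are pairwise distinct; the universe is the disjoint union of the set of these elements and of the cells $C$. (F2) For each cell $C$, $<_C$ is a dense ordering of $C$; $\min(C)<_Cx<_C\max(C)$ for $x\in C$; and $x<_Cy$ implies that $x,y\in C$, or $x=\min(C)$ and $y\in C$, or $x\in C$ and $y=\max(C)$. (F3) $e_C\in C$ for $C\in\Phi_{\rm tan}$. (F4) For $C\in\Phi_{\rm open}$, $E_C\subseteq C$ and $<_C$ is a dense ordering of $E_C$. (F5) $g(s)=s$; $g(x)\ne x$ for $x\neq s$. For $c\in\Phi_{\rm single}$: $g(c)\ne s\to h(g(c))=c$. If $g(x)\in C\in\Phi_{\rm open}$ then $g(x)\in E_C$; if $g(x)\in C\in\Phi_{\rm tan}$ then $g(x)=e_C$. For $x\in C\in\Phi_{\rm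 tan}$: $\mathfrak f(x)=\mathfrak f(e_C)$ if $e_C\le_Cx$ and $\mathfrak f(x)=e_C$ if $x<_Ce_C$; $\mathfrak b(x)=\mathfrak b(e_C)$ if $x\le_C e_C$ and $\mathfrak b(x)=e_C$ if $e_C<_Cx$. (F6) For $C\in\Phi_{\rm open}$, $x,y\in E_C$: $g(x)=g(y)$ implies $g(x)=s$ or $x=y$. (F7) For $c\in\Phi_{\rm single}$: $g(c)=e_{c^g}$ if $c^g\in\Phi_{\rm tan}$, and $g(c)\in E_{c^g}$ if $c^g\in\Phi_{\rm open}$. (F8) For $C\in\Phi_{\rm trans}$: $g$ restricts to an order isomorphism of $(C,<_C)$ onto an order-convex subset of $(E_{C^g},<_{C^g})$, and $h(g(x))=x$ for $x\in C$. (F9) For $C\in\Phi_{\rm open}$, $x\in E_C$: $g(x)=s$, or $g(x)\in D$ for some $D\in\Phi_{\rm trans}$ with $D^h=C$, or $g(x)=d$ for some $d\in\Phi_{\rm single}$ with $d^h=C$. (F10) For $C\in\Phi_{\rm open}$: if $x\in C\setminus E_C$ then exactly one of $\exists y\,\phi_C^{\mathfrak f}(x,y)$, $\exists y\,\phi_C^{\mathfrak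 b}(x,y)$ holds; for $y\in E_C$ there are infinitely many $x$ with $\phi_C^{g}(x,y)$ (a scheme of axioms). (F11) For $C\in\Phi_{\rm open}$, $y\in E_C$: $<_C$ is a dense ordering of $C_y$. (F12) For $C\in\Phi_{\rm open}$, $x\in C\setminus E_C$: $\phi_C^g(x,z)$ implies $g(x)=z$, and $\phi_C^h(x,z)$ implies $g(x)=g(z)$. (F13) For $C\in\Phi_{\rm trans}$, with $D:=C^g$: $r^g_C,s^g_C\in E_D\cup\{\min(D),\max(D)\}$; $r^g_C\le_Ds^g_C$ or ($r^g_C=\min(D)$ and $s^g_C=\max(D)$); and for $x\in E_D$: $h(x)\in C\leftrightarrow r^g_C<_Dx<_Ds^g_C$. (F14) For $C\in\Phi_1$ and $m,n\in\mathbb N$ with $n\ge1$: $x\in C$, $g^m(x)\in C$ and $g^n(x)=x$ imply $g^m(x)=x$. (F15) For $m\ge1$: $g^m(x)=x\to g^N(x)=x$. For $C\in\Phi_1$ let $\mathrm{fix}_C(x)$ say: $x\in C$ and $\mathfrak f^N(x)=x$; let $\mathrm{fix}^{\rm bd}_C(x)$ say: $\mathrm{fix}_C(x)$ and for all $y,z\in\bar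 C$ with $y<_Cx<_Cz$ there is $w\in C$ with $y<_Cw<_Cz$ and not $\mathrm{fix}_C(w)$. To $G\in\{R_C,S^g_{m,C},B^g_{m,C}\}$ associate the property $P_G(z)$, respectively: $\mathrm{fix}_C(z)$; $z,g^m(z)\in C$ and $g^m(z)<_Cz$; $z,g^m(z)\in C$ and $z<_Cg^m(z)$. (D1) $G(x,y)$ implies $x,y\in\bar C$, and that $x\le_Cy$ or ($x=\min(C)$ and $y=\max(C)$). (D2), (D3) $G(x,y)$ holds if and only if there is $z\in C$ with $x<_Cz<_Cy$ and $P_G(z)$, or $x=y$ and $P_G(x)$. (D4) For $C\in\Phi_1$, $m\ge1$ and $G\in\{R_C,S^g_{m,C},B^g_{m,C}\}$: if $G(x,y)$ holds and every $z\in C$ with $x<_Cz<_Cy$ satisfies $g^m(z)\in C$ and not $\mathrm{fix}^{\rm bd}_C(z)$, then $G(z,z)$ for every $z\in C$ with $x<_Cz<_Cy$. (D5) For $C\in\Phi_1$: $\gamma^j_C\in\bar C$, and $\gamma^j_C\in C$ implies $\mathrm{fix}_C(\gamma^j_C)$, for $1\le j\le\nu$; $\gamma_C^j\le_C\gamma_C^{j+1}$,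 and $\gamma_C^j=\gamma_C^{j+1}$ implies $\gamma_C^j=\max(C)$, for $1\le j<\nu$. (D6) For $C\in\Phi_1$: $\mathrm{fix}^{\rm bd}_C(x)$ if and only if $x\in C$ and $x=\gamma_C^j$ for some $1\le j\le\nu$. **Statement.** Let $\Psi$ be a Dulac flow configuration and $M\models T(\Psi)$; "definable" means definable in $M$ with parameters from $M$. 1. For $C\in\Phi_1\cup\Phi_{\rm tan}$, every definable subset of $C$ is a finite union of points and of open intervals $\{z\in C: a<_Cz<_Cb\}$ with $a,b\in\bar C$. 2. For $C\in\Phi_{\rm open}$ and $x\in E_C$, every definable subset of $C_x$ is a finite union of points and of open $<_C$-intervals $(a,b)\cap C_x$ with $a\in C_x\cup\{\mathfrak b(x)\}$ and $b\in C_x\cup\{\mathfrak f(x)\}$. Here $\mathfrak b(x),\mathfrak f(x)\notin C_x$ serve as formal left and right endpoints of $C_x$: the condition $a<_Cz$ (resp. $z<_Cb$) on $z\in C_x$ is void for $a=\mathfrak b(x)$ (resp. $b=\mathfrak f(x)$). -/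

import Mathlib

open FirstOrder FirstOrder.Language

universe u v

/-- The two directions along the flow: forward and backward. -/
inductive Dir : Type
  | fwd
  | bwd

/-- The opposite direction. -/
def Dir.opp : Dir → Dir
  | .fwd => .bwd
  | .bwd => .fwd

/-- A flow configuration, up to the functions `min` and `max`, which are added in `FlowConfig`:
four finite sets (as separate types they are disjoint) of open, tangent, transverse and single
cells; `transNext g C` is the open cell attached to the transverse cell `C` in direction `g`, and
`singleNext g c` is the open or tangent cell attached to the single cell `c` in direction `g`. -/
structure FlowPattern : Type (u + 1) where
  Opn : Type u
  Tan : Type u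
  Trans : Type u
  Single : Type u
  finOpn : Finite Opn
  finTan : Finite Tan
  finTrans : Finite Trans
  finSingle : Finite Single
  transNext : Dir → Trans → Opn
  singleNext : Dir → Single → Opn ⊕ Tan

attribute [instance] FlowPattern.finOpn FlowPattern.finTan FlowPattern.finTrans
  FlowPattern.finSingle

/-- The cells of positive dimension: open, tangent and transverse ones. -/
inductive FlowPattern.Cell (Φ : FlowPattern.{u}) : Type u
  | opn (C : Φ.Opn)
  | tan (C : Φ.Tan)
  | trans (C : Φ.Trans)

/-- The index set of the transverse cells together with the sets `E_C`, `C` open. -/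
inductive FlowPattern.Cell₁ (Φ : FlowPattern.{u}) : Type u
  | trans (C : Φ.Trans)
  | sec (C : Φ.Opn)

/-- The cell in which a transverse cell, resp. a set `E_C`, lies. -/
def FlowPattern.Cell₁.cell {Φ : FlowPattern.{u}} : Φ.Cell₁ → Φ.Cell
  | .trans C => .trans C
  | .sec C => .opn C

instance (Φ : FlowPattern.{u}) : Finite Φ.Cell :=
  Finite.of_surjective
    (fun a : Φ.Opn ⊕ Φ.Tan ⊕ Φ.Trans =>
      Sum.elim FlowPattern.Cell.opn (Sum.elim FlowPattern.Cell.tan FlowPattern.Cell.trans) a)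
    (by
      rintro (C | C | C)
      · exact ⟨Sum.inl C, rfl⟩
      · exact ⟨Sum.inr (Sum.inl C), rfl⟩
      · exact ⟨Sum.inr (Sum.inr C), rfl⟩)

/-- A flow configuration; in the values of `min` and `max`, `none` stands for `∞`. -/
structure FlowConfig : Type (u + 1) extends FlowPattern.{u} where
  min : toFlowPattern.Cell → Option Single
  max : toFlowPattern.Cell → Option Single
  N : ℕ

/-- A Dulac flow configuration: a flow configuration together with a natural number `ν`. -/
structure DulacConfig : Type (u + 1) extends FlowConfig.{u} where
  ν : ℕ

namespace DulacConfig

/-- The function and constant symbols of the language: the constants `s`, `c` (`c` single), `e_C`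
(`C` tangent), `r^g_C`, `s^g_C` (`C` transverse), `γ_C^j`, and the unary progression maps. -/
inductive Func (Ψ : DulacConfig.{u}) : ℕ → Type u
  | infty : Func Ψ 0
  | single (c : Ψ.Single) : Func Ψ 0
  | e (C : Ψ.Tan) : Func Ψ 0
  | lower (g : Dir) (C : Ψ.Trans) : Func Ψ 0
  | upper (g : Dir) (C : Ψ.Trans) : Func Ψ 0
  | gamma (C : Ψ.Cell₁) (j : Fin Ψ.ν) : Func Ψ 0
  | prog (g : Dir) : Func Ψ 1

/-- The relation symbols: `C` and `<_C` for every cell `C`, `E_C` for open `C`, and `R_C`,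
`S^g_{m,C}`, `B^g_{m,C}` for transverse `C` and for the sets `E_C`. -/
inductive Rel (Ψ : DulacConfig.{u}) : ℕ → Type u
  | cell (C : Ψ.Cell) : Rel Ψ 1
  | sec (C : Ψ.Opn) : Rel Ψ 1
  | lt (C : Ψ.Cell) : Rel Ψ 2
  | R (C : Ψ.Cell₁) : Rel Ψ 2
  | S (g : Dir) (m : ℕ) (C : Ψ.Cell₁) : Rel Ψ 2
  | B (g : Dir) (m : ℕ) (C : Ψ.Cell₁) : Rel Ψ 2

/-- The first-order language of a Dulac flow configuration. -/
def lang (Ψ : DulacConfig.{u}) : FirstOrder.Language.{u, u} where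
  Functions := Func Ψ
  Relations := Rel Ψ

/-- Named variables. -/
abbrev Var : Type := Fin 8

variable (Ψ : DulacConfig.{u})

/-- Terms and formulas in the named variables. -/
abbrev Tm : Type u := Ψ.lang.Term Var

abbrev Fm : Type u := Ψ.lang.Formula Var

variable {Ψ}

/-! ### Terms -/

/-- The `i`-th variable. -/
abbrev vr (i : Var) : Ψ.Tm := Term.var i

/-- The constant with a given symbol. -/
def cst (c : Func Ψ 0) : Ψ.Tm := Constants.term (L := Ψ.lang) c

/-- The term `g(t)` for one of the progression maps `g`. -/
def pr (g : Dir) (t : Ψ.Tm) : Ψ.Tm := Functions.apply₁ (L := Ψ.lang) (Func.prog g) t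

/-- The term `g^m(t)`. -/
def prIter (g : Dir) (m : ℕ) (t : Ψ.Tm) : Ψ.Tm := (pr g)^[m] t

/-- The constant symbol that stands for an element of `Φ_single ∪ {∞}`. -/
def endFunc : Option Ψ.Single → Func Ψ 0
  | none => .infty
  | some c => .single c

/-- The terms `min(C)` and `max(C)`. -/
def minT (C : Ψ.Cell) : Ψ.Tm := cst (endFunc (Ψ.min C))

def maxT (C : Ψ.Cell) : Ψ.Tm := cst (endFunc (Ψ.max C))

/-! ### Basic formulas -/

def inCell (C : Ψ.Cell) (t : Ψ.Tm) : Ψ.Fm := Relations.formula₁ (L := Ψ.lang) (Rel.cell C) t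

def inSec (C : Ψ.Opn) (t : Ψ.Tm) : Ψ.Fm := Relations.formula₁ (L := Ψ.lang) (Rel.sec C) t

def ltF (C : Ψ.Cell) (t₁ t₂ : Ψ.Tm) : Ψ.Fm :=
  Relations.formula₂ (L := Ψ.lang) (Rel.lt C) t₁ t₂

def eqF (t₁ t₂ : Ψ.Tm) : Ψ.Fm := Term.equal t₁ t₂

def leF (C : Ψ.Cell) (t₁ t₂ : Ψ.Tm) : Ψ.Fm := ltF C t₁ t₂ ⊔ eqF t₁ t₂

def isR (C : Ψ.Cell₁) (t₁ t₂ : Ψ.Tm) : Ψ.Fm :=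
  Relations.formula₂ (L := Ψ.lang) (Rel.R C) t₁ t₂

def isS (g : Dir) (m : ℕ) (C : Ψ.Cell₁) (t₁ t₂ : Ψ.Tm) : Ψ.Fm :=
  Relations.formula₂ (L := Ψ.lang) (Rel.S g m C) t₁ t₂

def isB (g : Dir) (m : ℕ) (C : Ψ.Cell₁) (t₁ t₂ : Ψ.Tm) : Ψ.Fm :=
  Relations.formula₂ (L := Ψ.lang) (Rel.B g m C) t₁ t₂

/-- `∀ v_i φ` and `∃ v_i φ`. -/
noncomputable def allv (i : Var) (φ : Ψ.Fm) : Ψ.Fm :=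
  Formula.iAlls Unit (φ.relabel fun j : Var => if j = i then Sum.inr () else Sum.inl j)

noncomputable def exv (i : Var) (φ : Ψ.Fm) : Ψ.Fm :=
  Formula.iExs Unit (φ.relabel fun j : Var => if j = i then Sum.inr () else Sum.inl j)

/-- The scheme `∃^∞ v_i φ`, one formula for every `n`: there are `n` distinct elements with `φ`. -/
noncomputable def exAtLeast (n : ℕ) (i : Var) (φ : Ψ.Fm) : Ψ.Fm :=
  Formula.iExs (Fin n)
    ((Formula.iInf fun p : Fin n => Formula.iInf fun q : Fin n =>
        if p = q then ⊤ else ∼(Term.equal (Term.var (Sum.inr p)) (Term.var (Sum.inr q)))) ⊓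
      Formula.iInf fun p : Fin n =>
        φ.relabel fun j : Var => if j = i then Sum.inr p else Sum.inl j)

/-- The universal closure of a formula. -/
noncomputable def univClosure (φ : Ψ.Fm) : Ψ.lang.Sentence :=
  Formula.iAlls Var (φ.relabel (Sum.inr : Var → Empty ⊕ Var))

/-- `<_C` is a dense linear ordering without endpoints of the set of all `t` with `P t`. -/
noncomputable def denseOrder (C : Ψ.Cell) (P : Ψ.Tm → Ψ.Fm) : Ψ.Fm :=
  allv 3 (P (vr 3) ⟹ ∼(ltF C (vr 3) (vr 3))) ⊓
  allv 3 (allv 4 (allv 5 (P (vr 3) ⊓ P (vr 4) ⊓ P (vr 5) ⊓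
    ltF C (vr 3) (vr 4) ⊓ ltF C (vr 4) (vr 5) ⟹ ltF C (vr 3) (vr 5)))) ⊓
  allv 3 (allv 4 (P (vr 3) ⊓ P (vr 4) ⟹
    ltF C (vr 3) (vr 4) ⊔ eqF (vr 3) (vr 4) ⊔ ltF C (vr 4) (vr 3))) ⊓
  allv 3 (allv 4 (P (vr 3) ⊓ P (vr 4) ⊓ ltF C (vr 3) (vr 4) ⟹
    exv 5 (P (vr 5) ⊓ ltF C (vr 3) (vr 5) ⊓ ltF C (vr 5) (vr 4)))) ⊓
  allv 3 (P (vr 3) ⟹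
    exv 4 (P (vr 4) ⊓ ltF C (vr 4) (vr 3)) ⊓ exv 4 (P (vr 4) ⊓ ltF C (vr 3) (vr 4)))

/-! ### The axioms of a flow configuration -/

/-- For `g = fwd`, `C` open: `t₁ ∈ C ∖ E_C`, and `t₂` is the successor of `t₁` in `E_C`;
for `g = bwd`, `t₂` is the predecessor of `t₁` in `E_C`. -/
noncomputable def nextTo (C : Ψ.Opn) : Dir → Ψ.Tm → Ψ.Tm → Ψ.Fm
  | .fwd, t₁, t₂ => inCell (.opn C) t₁ ⊓ ∼(inSec C t₁) ⊓ inSec C t₂ ⊓ ltF (.opn C) t₁ t₂ ⊓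
      ∼(exv 7 (inSec C (vr 7) ⊓ ltF (.opn C) t₁ (vr 7) ⊓ ltF (.opn C) (vr 7) t₂))
  | .bwd, t₁, t₂ => inCell (.opn C) t₁ ⊓ ∼(inSec C t₁) ⊓ inSec C t₂ ⊓ ltF (.opn C) t₂ t₁ ⊓
      ∼(exv 7 (inSec C (vr 7) ⊓ ltF (.opn C) t₂ (vr 7) ⊓ ltF (.opn C) (vr 7) t₁))

/-- `t₁` lies in the fiber `C_{t₂}`. -/
noncomputable def inFiber (C : Ψ.Opn) (t₁ t₂ : Ψ.Tm) : Ψ.Fm :=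
  nextTo C .bwd t₁ t₂ ⊔ nextTo C .fwd t₁ t₂ ⊔ eqF t₁ t₂

/-- On a tangent cell with ordering `<_C`: `t₁ ≤ t₂` along the direction `g`. -/
def dirLe (C : Ψ.Cell) : Dir → Ψ.Tm → Ψ.Tm → Ψ.Fm
  | .fwd, t₁, t₂ => leF C t₁ t₂
  | .bwd, t₁, t₂ => leF C t₂ t₁

def dirLt (C : Ψ.Cell) : Dir → Ψ.Tm → Ψ.Tm → Ψ.Fm
  | .fwd, t₁, t₂ => ltF C t₁ t₂
  | .bwd, t₁, t₂ => ltF C t₂ t₁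

/-- The attached cell of a single cell has the value of `g` at this cell as its base point. -/
def singleVal (g : Dir) (c : Ψ.Single) : Ψ.Opn ⊕ Ψ.Tan → Ψ.Fm
  | .inl C => inSec C (pr g (cst (.single c)))
  | .inr C => eqF (pr g (cst (.single c))) (cst (.e C))

/-- The axioms for the flow configuration; the theory has their universal closures. The variables
`x, y, z, w` are `vr 0, vr 1, vr 2, vr 6`. -/
inductive FlowAxiom : Ψ.Fm → Prop
  -- The universe is partitioned into `{s}`, the single points and the cells.
  | single_ne (c d : Ψ.Single) (h : c ≠ d) :
      FlowAxiom (∼(eqF (cst (.single c)) (cst (.single d))))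
  | single_not_cell (c : Ψ.Single) (C : Ψ.Cell) :
      FlowAxiom (∼(inCell C (cst (.single c))))
  | single_ne_infty (c : Ψ.Single) :
      FlowAxiom (∼(eqF (cst (.single c)) (cst .infty)))
  | infty_not_cell (C : Ψ.Cell) : FlowAxiom (∼(inCell C (cst .infty)))
  | cover : FlowAxiom
      (eqF (vr 0) (cst .infty) ⊔ (Formula.iSup fun c : Ψ.Single => eqF (vr 0) (cst (.single c))) ⊔
        Formula.iSup fun C : Ψ.Cell => inCell C (vr 0))
  | disjoint (C D : Ψ.Cell) (h : C ≠ D) : FlowAxiom (inCell C (vr 0) ⟹ ∼(inCell D (vr 0)))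
  -- The ordering of a cell, with the formal endpoints `min(C)` and `max(C)`.
  | order (C : Ψ.Cell) : FlowAxiom (denseOrder C (inCell C))
  | order_ends (C : Ψ.Cell) : FlowAxiom
      (inCell C (vr 0) ⟹ ltF C (vr 0) (maxT C) ⊓ ltF C (minT C) (vr 0))
  | order_domain (C : Ψ.Cell) : FlowAxiom
      (ltF C (vr 0) (vr 1) ⟹
        (inCell C (vr 0) ⊓ inCell C (vr 1)) ⊔ (eqF (vr 0) (minT C) ⊓ inCell C (vr 1)) ⊔
          (inCell C (vr 0) ⊓ eqF (vr 1) (maxT C)))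
  -- Base points.
  | base_tan (C : Ψ.Tan) : FlowAxiom (inCell (.tan C) (cst (.e C)))
  | base_sec (C : Ψ.Opn) : FlowAxiom (inSec C (vr 0) ⟹ inCell (.opn C) (vr 0))
  | sec_order (C : Ψ.Opn) : FlowAxiom (denseOrder (.opn C) (inSec C))
  -- The progression maps.
  | prog_infty (g : Dir) : FlowAxiom (eqF (pr g (cst .infty)) (cst .infty))
  | prog_ne (g : Dir) : FlowAxiom (∼(eqF (vr 0) (cst .infty)) ⟹ ∼(eqF (pr g (vr 0)) (vr 0)))
  | prog_single_inv (g : Dir) (c : Ψ.Single) : FlowAxiom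
      (∼(eqF (pr g (cst (.single c))) (cst .infty)) ⟹
        eqF (pr g.opp (pr g (cst (.single c)))) (cst (.single c)))
  | prog_opn (g : Dir) (C : Ψ.Opn) : FlowAxiom
      (inCell (.opn C) (pr g (vr 0)) ⟹ inSec C (pr g (vr 0)))
  | prog_tan (g : Dir) (C : Ψ.Tan) : FlowAxiom
      (inCell (.tan C) (pr g (vr 0)) ⟹ eqF (pr g (vr 0)) (cst (.e C)))
  | tan_after (g : Dir) (C : Ψ.Tan) : FlowAxiom
      (inCell (.tan C) (vr 0) ⊓ dirLe (.tan C) g (cst (.e C)) (vr 0) ⟹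
        eqF (pr g (vr 0)) (pr g (cst (.e C))))
  | tan_before (g : Dir) (C : Ψ.Tan) : FlowAxiom
      (inCell (.tan C) (vr 0) ⊓ dirLt (.tan C) g (vr 0) (cst (.e C)) ⟹
        eqF (pr g (vr 0)) (cst (.e C)))
  | sec_inj (g : Dir) (C : Ψ.Opn) : FlowAxiom
      (inSec C (vr 0) ⊓ inSec C (vr 1) ⊓ eqF (pr g (vr 0)) (pr g (vr 1)) ⟹
        eqF (pr g (vr 0)) (cst .infty) ⊔ eqF (vr 0) (vr 1))
  | single_next (g : Dir) (c : Ψ.Single) : FlowAxiom (singleVal g c (Ψ.singleNext g c))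
  -- `g` maps a transverse cell isomorphically onto an interval of `E_{C^g}`, and the opposite map
  -- is its inverse.
  | trans_maps (g : Dir) (C : Ψ.Trans) : FlowAxiom
      (inCell (.trans C) (vr 0) ⟹ inSec (Ψ.transNext g C) (pr g (vr 0)))
  | trans_mono (g : Dir) (C : Ψ.Trans) : FlowAxiom
      (inCell (.trans C) (vr 0) ⊓ inCell (.trans C) (vr 1) ⟹
        (ltF (.trans C) (vr 0) (vr 1)).iff
          (ltF (.opn (Ψ.transNext g C)) (pr g (vr 0)) (pr g (vr 1))))
  | trans_convex (g : Dir) (C : Ψ.Trans) : FlowAxiom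
      (inCell (.trans C) (vr 0) ⊓ inCell (.trans C) (vr 1) ⊓ inSec (Ψ.transNext g C) (vr 2) ⊓
        ltF (.opn (Ψ.transNext g C)) (pr g (vr 0)) (vr 2) ⊓
        ltF (.opn (Ψ.transNext g C)) (vr 2) (pr g (vr 1)) ⟹
        exv 6 (inCell (.trans C) (vr 6) ⊓ eqF (pr g (vr 6)) (vr 2)))
  | trans_inv (g : Dir) (C : Ψ.Trans) : FlowAxiom
      (inCell (.trans C) (vr 0) ⟹ eqF (pr g.opp (pr g (vr 0))) (vr 0))
  | sec_next (g : Dir) (C : Ψ.Opn) : FlowAxiom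
      (inSec C (vr 0) ⟹ eqF (pr g (vr 0)) (cst .infty) ⊔
        (Formula.iSup fun D : {D : Ψ.Trans // Ψ.transNext g.opp D = C} =>
          inCell (.trans D.1) (pr g (vr 0))) ⊔
        (Formula.iSup fun d : {d : Ψ.Single // Ψ.singleNext g.opp d = Sum.inl C} =>
          eqF (pr g (vr 0)) (cst (.single d.1))))
  -- The fibers of an open cell.
  | adj_exists (C : Ψ.Opn) : FlowAxiom
      (inCell (.opn C) (vr 0) ⊓ ∼(inSec C (vr 0)) ⟹
        exv 1 (nextTo C .fwd (vr 0) (vr 1) ⊔ nextTo C .bwd (vr 0) (vr 1)))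
  | adj_excl (C : Ψ.Opn) (g : Dir) : FlowAxiom
      (exv 1 (nextTo C g (vr 0) (vr 1)) ⟹ ∼(exv 1 (nextTo C g.opp (vr 0) (vr 1))))
  | adj_infinite (C : Ψ.Opn) (g : Dir) (n : ℕ) : FlowAxiom
      (inSec C (vr 1) ⟹ exAtLeast n 0 (nextTo C g (vr 0) (vr 1)))
  | fiber_order (C : Ψ.Opn) : FlowAxiom
      (inSec C (vr 1) ⟹ denseOrder (.opn C) fun t => inFiber C t (vr 1))
  | fiber_prog_to (C : Ψ.Opn) (g : Dir) : FlowAxiom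
      (inCell (.opn C) (vr 0) ⊓ ∼(inSec C (vr 0)) ⊓ exv 1 (nextTo C g (vr 0) (vr 1)) ⟹
        allv 2 (nextTo C g (vr 0) (vr 2) ⟹ eqF (pr g (vr 0)) (vr 2)))
  | fiber_prog_from (C : Ψ.Opn) (g : Dir) : FlowAxiom
      (inCell (.opn C) (vr 0) ⊓ ∼(inSec C (vr 0)) ⊓ exv 1 (nextTo C g.opp (vr 0) (vr 1)) ⟹
        allv 2 (nextTo C g.opp (vr 0) (vr 2) ⟹ eqF (pr g (vr 0)) (pr g (vr 2))))
  -- The endpoints of the interval onto which a transverse cell is mapped.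
  | lower_mem (g : Dir) (C : Ψ.Trans) : FlowAxiom
      (inSec (Ψ.transNext g C) (cst (.lower g C)) ⊔
        eqF (cst (.lower g C)) (minT (.opn (Ψ.transNext g C))) ⊔
        eqF (cst (.lower g C)) (maxT (.opn (Ψ.transNext g C))))
  | upper_mem (g : Dir) (C : Ψ.Trans) : FlowAxiom
      (inSec (Ψ.transNext g C) (cst (.upper g C)) ⊔
        eqF (cst (.upper g C)) (minT (.opn (Ψ.transNext g C))) ⊔
        eqF (cst (.upper g C)) (maxT (.opn (Ψ.transNext g C))))
  | lower_le_upper (g : Dir) (C : Ψ.Trans) : FlowAxiom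
      (leF (.opn (Ψ.transNext g C)) (cst (.lower g C)) (cst (.upper g C)) ⊔
        (eqF (cst (.lower g C)) (minT (.opn (Ψ.transNext g C))) ⊓
          eqF (cst (.upper g C)) (maxT (.opn (Ψ.transNext g C)))))
  | lower_upper (g : Dir) (C : Ψ.Trans) : FlowAxiom
      (inSec (Ψ.transNext g C) (vr 0) ⟹
        (inCell (.trans C) (pr g.opp (vr 0))).iff
          (ltF (.opn (Ψ.transNext g C)) (cst (.lower g C)) (vr 0) ⊓
            ltF (.opn (Ψ.transNext g C)) (vr 0) (cst (.upper g C))))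
  -- Cycles meet transverse cells and sections at most once, and are closed after `N` steps.
  | cycle_sec (g : Dir) (m n : ℕ) (hn : 0 < n) (C : Ψ.Opn) : FlowAxiom
      (inSec C (vr 0) ⊓ inSec C (prIter g m (vr 0)) ⊓ eqF (prIter g n (vr 0)) (vr 0) ⟹
        eqF (prIter g m (vr 0)) (vr 0))
  | cycle_trans (g : Dir) (m n : ℕ) (hn : 0 < n) (D : Ψ.Trans) : FlowAxiom
      (inCell (.trans D) (vr 0) ⊓ inCell (.trans D) (prIter g m (vr 0)) ⊓
        eqF (prIter g n (vr 0)) (vr 0) ⟹ eqF (prIter g m (vr 0)) (vr 0))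
  | cycle_bound (g : Dir) (m : ℕ) (hm : 0 < m) : FlowAxiom
      (eqF (prIter g m (vr 0)) (vr 0) ⟹ eqF (prIter g Ψ.N (vr 0)) (vr 0))

/-! ### The additional axioms of a Dulac flow configuration -/

/-- `t ∈ C`, for `C` a transverse cell or a set `E_D`. -/
def inOne : Ψ.Cell₁ → Ψ.Tm → Ψ.Fm
  | .trans C, t => inCell (.trans C) t
  | .sec C, t => inSec C t

/-- `t ∈ C ∪ {min(C), max(C)}`. -/
def inBar (C : Ψ.Cell₁) (t : Ψ.Tm) : Ψ.Fm :=
  inOne C t ⊔ eqF t (minT C.cell) ⊔ eqF t (maxT C.cell)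

/-- The ordering `<_C` on `C ∪ {min(C), max(C)}`. -/
def ltOne (C : Ψ.Cell₁) (t₁ t₂ : Ψ.Tm) : Ψ.Fm :=
  inBar C t₁ ⊓ inBar C t₂ ⊓ ltF C.cell t₁ t₂

/-- `t₂ ∈ C` and `t₁ <_C t₂ <_C t₃`. -/
def btw (C : Ψ.Cell₁) (t₁ t₂ t₃ : Ψ.Tm) : Ψ.Fm :=
  inOne C t₂ ⊓ ltOne C t₁ t₂ ⊓ ltOne C t₂ t₃

/-- `t ∈ C` and the forward progression map satisfies `f^N(t) = t`. -/
def isFix (C : Ψ.Cell₁) (t : Ψ.Tm) : Ψ.Fm := inOne C t ⊓ eqF (prIter .fwd Ψ.N t) t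

/-- `t` is a boundary point of the set of points in `C` with `f^N(t) = t`, and belongs to it. -/
noncomputable def isFixBd (C : Ψ.Cell₁) (t : Ψ.Tm) : Ψ.Fm :=
  isFix C t ⊓ allv 3 (allv 4 (ltOne C (vr 3) t ⊓ ltOne C t (vr 4) ⟹
    exv 5 (btw C (vr 3) (vr 5) (vr 4) ⊓ ∼(isFix C (vr 5)))))

/-- `t, g^m(t) ∈ C` and `g^m(t) <_C t`, resp. `t <_C g^m(t)`. -/
def isSmaller (g : Dir) (m : ℕ) (C : Ψ.Cell₁) (t : Ψ.Tm) : Ψ.Fm :=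
  inOne C t ⊓ inOne C (prIter g m t) ⊓ ltOne C (prIter g m t) t

def isBigger (g : Dir) (m : ℕ) (C : Ψ.Cell₁) (t : Ψ.Tm) : Ψ.Fm :=
  inOne C t ⊓ inOne C (prIter g m t) ⊓ ltOne C t (prIter g m t)

/-- The binary relation symbols that a Dulac flow configuration adds. -/
inductive NewRel (Ψ : DulacConfig.{u}) : Type u
  | R (C : Ψ.Cell₁)
  | S (g : Dir) (m : ℕ) (C : Ψ.Cell₁)
  | B (g : Dir) (m : ℕ) (C : Ψ.Cell₁)

def NewRel.dom : NewRel Ψ → Ψ.Cell₁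
  | .R C => C
  | .S _ _ C => C
  | .B _ _ C => C

def NewRel.holds : NewRel Ψ → Ψ.Tm → Ψ.Tm → Ψ.Fm
  | .R C => isR C
  | .S g m C => isS g m C
  | .B g m C => isB g m C

/-- The property of points that the new relation describes. -/
def NewRel.prop : NewRel Ψ → Ψ.Tm → Ψ.Fm
  | .R C => isFix C
  | .S g m C => isSmaller g m C
  | .B g m C => isBigger g m C

/-- If `G(x, y)` holds, `g^m(z) ∈ C` for all `z ∈ C` between `x` and `y`, and none of these `z` is a
boundary point, then `G(z, z)` for all these `z`. -/
noncomputable def uniform (G : NewRel Ψ) (g : Dir) (m : ℕ) : Ψ.Fm :=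
  G.holds (vr 0) (vr 1) ⊓
    allv 2 (btw G.dom (vr 0) (vr 2) (vr 1) ⟹ inOne G.dom (prIter g m (vr 2))) ⊓
    ∼(exv 2 (btw G.dom (vr 0) (vr 2) (vr 1) ⊓ isFixBd G.dom (vr 2))) ⟹
  allv 2 (btw G.dom (vr 0) (vr 2) (vr 1) ⟹ G.holds (vr 2) (vr 2))

/-- The axioms that are added for a Dulac flow configuration. -/
inductive DulacAxiom : Ψ.Fm → Prop
  | rel_dom (G : NewRel Ψ) : DulacAxiom
      (G.holds (vr 0) (vr 1) ⟹ inBar G.dom (vr 0) ⊓ inBar G.dom (vr 1))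
  | rel_le (G : NewRel Ψ) : DulacAxiom
      (G.holds (vr 0) (vr 1) ⟹ ltOne G.dom (vr 0) (vr 1) ⊔ eqF (vr 0) (vr 1) ⊔
        (eqF (vr 0) (minT G.dom.cell) ⊓ eqF (vr 1) (maxT G.dom.cell)))
  | rel_def (G : NewRel Ψ) : DulacAxiom
      ((G.holds (vr 0) (vr 1)).iff
        (exv 2 (btw G.dom (vr 0) (vr 2) (vr 1) ⊓ G.prop (vr 2)) ⊔
          (eqF (vr 0) (vr 1) ⊓ G.prop (vr 0))))
  | uniform_R (C : Ψ.Cell₁) (g : Dir) (m : ℕ) (hm : 0 < m) : DulacAxiom (uniform (.R C) g m)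
  | uniform_S (C : Ψ.Cell₁) (g : Dir) (m : ℕ) (hm : 0 < m) : DulacAxiom (uniform (.S g m C) g m)
  | uniform_B (C : Ψ.Cell₁) (g : Dir) (m : ℕ) (hm : 0 < m) : DulacAxiom (uniform (.B g m C) g m)
  | gamma_mem (C : Ψ.Cell₁) (j : Fin Ψ.ν) : DulacAxiom
      (inBar C (cst (.gamma C j)) ⊓
        (inOne C (cst (.gamma C j)) ⟹ isFix C (cst (.gamma C j))))
  | gamma_le (C : Ψ.Cell₁) (j k : Fin Ψ.ν) (hjk : (k : ℕ) = j + 1) : DulacAxiom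
      ((ltOne C (cst (.gamma C j)) (cst (.gamma C k)) ⊔
          eqF (cst (.gamma C j)) (cst (.gamma C k))) ⊓
        (eqF (cst (.gamma C j)) (cst (.gamma C k)) ⟹ eqF (cst (.gamma C j)) (maxT C.cell)))
  | gamma_fixBd (C : Ψ.Cell₁) : DulacAxiom
      ((isFixBd C (vr 0)).iff
        (Formula.iSup fun j : Fin Ψ.ν =>
          eqF (vr 0) (cst (.gamma C j)) ⊓ inOne C (cst (.gamma C j))))

/-- The theory `T(Ψ)` of a Dulac flow configuration. -/
def theory (Ψ : DulacConfig.{u}) : Ψ.lang.Theory :=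
  {σ | ∃ φ : Ψ.Fm, (FlowAxiom φ ∨ DulacAxiom φ) ∧ σ = univClosure φ}

/-! ### Subsets of structures -/

variable (Ψ) (M : Type v) [Ψ.lang.Structure M]

/-- The interpretations of the symbols of the language. -/
def Cst (c : Func Ψ 0) : M := Structure.funMap (L := Ψ.lang) c ![]

def Pr (g : Dir) (x : M) : M := Structure.funMap (L := Ψ.lang) (Func.prog g) ![x]

def CellSet (C : Ψ.Cell) : Set M := {x | Structure.RelMap (L := Ψ.lang) (Rel.cell C) ![x]}

def SecSet (C : Ψ.Opn) : Set M := {x | Structure.RelMap (L := Ψ.lang) (Rel.sec C) ![x]}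

def Lt (C : Ψ.Cell) (x y : M) : Prop := Structure.RelMap (L := Ψ.lang) (Rel.lt C) ![x, y]

/-- The cells in `Φ_1` and the tangent cells, as cells of dimension one. -/
inductive LineCell : Type u
  | one (C : Ψ.Cell₁)
  | tan (C : Ψ.Tan)

/-- The cell whose ordering is used on a cell of dimension one. -/
def LineCell.cell {Ψ : DulacConfig.{u}} : Ψ.LineCell → Ψ.Cell
  | .one C => C.cell
  | .tan C => .tan C

/-- The underlying set of a cell of dimension one. -/
def LineSet : Ψ.LineCell → Set M
  | .one (.trans C) => Ψ.CellSet M (.trans C)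
  | .one (.sec C) => Ψ.SecSet M C
  | .tan C => Ψ.CellSet M (.tan C)

/-- `C ∪ {min(C), max(C)}`. -/
def LineBar (C : Ψ.LineCell) : Set M :=
  Ψ.LineSet M C ∪ {Ψ.Cst M (endFunc (Ψ.min C.cell)), Ψ.Cst M (endFunc (Ψ.max C.cell))}

/-- The open interval `(a, b)` of `C` with respect to `<_C`. -/
def LineIoo (C : Ψ.LineCell) (a b : M) : Set M :=
  {z | z ∈ Ψ.LineSet M C ∧ Ψ.Lt M C.cell a z ∧ Ψ.Lt M C.cell z b}

/-- The fiber `C_x` of an open cell `C` over `x ∈ E_C`. -/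
def FiberSet (C : Ψ.Opn) (x : M) : Set M :=
  {y | y ∈ Ψ.CellSet M (.opn C) ∧ (y = x ∨ Ψ.Pr M .fwd y = x ∨ Ψ.Pr M .bwd y = x)}

/-- The open interval `(a, b)` of `C_x` with respect to `<_C`, where `b(x)` and `f(x)`, which do not
lie in `C_x`, serve as the left and right endpoints of `C_x`. -/
def FiberIoo (C : Ψ.Opn) (x a b : M) : Set M :=
  {z | z ∈ Ψ.FiberSet M C x ∧ (a = Ψ.Pr M .bwd x ∨ Ψ.Lt M (.opn C) a z) ∧
    (b = Ψ.Pr M .fwd x ∨ Ψ.Lt M (.opn C) z b)}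

/-- `X` is a finite union of points and of intervals `Ioo a b` with `a ∈ A` and `b ∈ B`. -/
def IsFiniteUnion {M : Type v} (Ioo : M → M → Set M) (A B X : Set M) : Prop :=
  ∃ (P : Finset M) (I : Finset (M × M)), (∀ p ∈ I, p.1 ∈ A ∧ p.2 ∈ B) ∧
    X = (P : Set M) ∪ ⋃ p ∈ I, Ioo p.1 p.2

end DulacConfig

/-!
Definable sets of a model are described by a back-and-forth argument.

*Two systems of lines.* The model retracts onto a base: a point `x` of an open cell `C` goes to the
point `y` of `E_C` with `x ∈ C_y`, a point of a tangent cell `C` goes to `e_C`, and all other points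
stay where they are. The base is partitioned into lines, namely the sets `E_C`, the transverse cells
and single points. Each of these lines, and each fiber of the retraction, is densely ordered or
consists of one point; the order of a cell is lexicographic, and a progression map is determined by
its values on the base (`IsModel.lt_iff`, `IsModel.prog_eq`). On the lines of the base the
progression maps are injective partial maps; cutting the lines at the finitely many constants that
delimit their domains makes them increasing with convex image (`LineSystem.PiecewiseMono`,
`IsModel.exists_mono_step`).

*Iterates.* Composites of piecewise monotone maps are piecewise monotone. What remains to be
controlled is the order between a point and its image when both lie on the same line, and this is
where the Dulac axioms are needed. As the two maps are inverse to each other on the lines, a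
composite is a restriction of a power `g^m`. By the uniformity axioms, the sign of `g^m(x) - x` is
constant on every interval on which `g^m` is defined and which avoids the finitely many boundary
points of the set of fixed points (`IsModel.exists_sign`).

*Back and forth.* Two tuples are similar for `n` steps if the same composites of at most `n` steps
are defined on their roots, with values in the same position relative to the roots, and if they are
ordered in the same way within the fibers (`FlowSystem.Sim`). The position of `h(c)` relative to `z`
can be read off from the cuts of `c` and `z` and the position of `c` relative to the preimage of `z`
(`LineSystem.PiecewiseMono.compare`). Therefore similarity for `2n` steps, over enough parameters,
extends to one more point with similarity for `n` steps: it suffices to fill a cut in a dense order,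
once in the base and once in a fiber (`FlowSystem.Sim.exists_cons`). It follows that a definable
relation cannot separate tuples that are similar for sufficiently many steps over sufficiently many
parameters, provided that the basic relations and functions cannot (`FlowSystem.tame_realize`); and
those of a model cannot.

*Conclusion.* A definable subset of a line of the base or of a fiber is thus a union of cuts over a
finite set, and such a union consists of finitely many points and intervals
(`LineSystem.isFiniteUnion`).
-/

/-! ### Systems of lines -/

/-- A set partitioned by a labelling into lines, with a relation `lt` that orders every line and
relates no points of different lines. A line is a dense order without endpoints, or a single
point. -/
structure LineSystem (X Λ : Type*) where
  lt : X → X → Prop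
  lab : X → Λ
  irrefl : ∀ x, ¬ lt x x
  trans : ∀ {x y z}, lt x y → lt y z → lt x z
  lab_eq : ∀ {x y}, lt x y → lab x = lab y
  tri : ∀ {x y}, lab x = lab y → lt x y ∨ x = y ∨ lt y x
  dense : ∀ {x y}, lt x y → ∃ z, lt x z ∧ lt z y
  ends : ∀ x, (∀ y, lab y = lab x → y = x) ∨ ((∃ z, lt z x) ∧ ∃ z, lt x z)

namespace LineSystem

variable {X Λ : Type*}

/-- The system of lines with all orderings reversed. -/
def flip (S : LineSystem X Λ) : LineSystem X Λ where
  lt x y := S.lt y x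
  lab := S.lab
  irrefl := S.irrefl
  trans h h' := S.trans h' h
  lab_eq h := (S.lab_eq h).symm
  tri h := by
    rcases S.tri h with h | h | h
    exacts [Or.inr (Or.inr h), Or.inr (Or.inl h), Or.inl h]
  dense h := by
    obtain ⟨z, h₁, h₂⟩ := S.dense h
    exact ⟨z, h₂, h₁⟩
  ends x := (S.ends x).imp_right And.symm

variable (S : LineSystem X Λ)

lemma asymm {x y : X} (h : S.lt x y) : ¬ S.lt y x := fun h' => S.irrefl _ (S.trans h h')

lemma ne_of_lt {x y : X} (h : S.lt x y) : x ≠ y := fun e => S.irrefl y (e ▸ h)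

lemma exists_max {A : Finset X} {l : Λ} (hA : ∀ a ∈ A, S.lab a = l) (hne : A.Nonempty) :
    ∃ m ∈ A, ∀ a ∈ A, a = m ∨ S.lt a m := by
  classical
  induction hne using Finset.Nonempty.cons_induction with
  | singleton a => exact ⟨a, by simp, by simp⟩
  | cons a s ha hs ih =>
    obtain ⟨m, hm, hmax⟩ := ih fun x hx => hA x (by simp [hx])
    have hl : S.lab a = S.lab m := by rw [hA a (by simp), hA m (by simp [hm])]
    rcases S.tri hl with h | h | h
    · refine ⟨m, by simp [hm], fun x hx => ?_⟩
      rcases Finset.mem_cons.1 hx with rfl | hx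
      exacts [Or.inr h, hmax x hx]
    · refine ⟨m, by simp [hm], fun x hx => ?_⟩
      rcases Finset.mem_cons.1 hx with rfl | hx
      exacts [Or.inl h, hmax x hx]
    · refine ⟨a, by simp, fun x hx => ?_⟩
      rcases Finset.mem_cons.1 hx with rfl | hx
      · exact Or.inl rfl
      · rcases hmax x hx with rfl | h'
        exacts [Or.inr h, Or.inr (S.trans h' h)]

lemma exists_between_finsets {e : X} (he : (∃ z, S.lt z e) ∧ ∃ z, S.lt e z)
    (A B : Finset X) (hA : ∀ a ∈ A, S.lab a = S.lab e) (hB : ∀ b ∈ B, S.lab b = S.lab e)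
    (hAB : ∀ a ∈ A, ∀ b ∈ B, S.lt a b) :
    ∃ d, S.lab d = S.lab e ∧ (∀ a ∈ A, S.lt a d) ∧ ∀ b ∈ B, S.lt d b := by
  have hends : ∀ m, S.lab m = S.lab e → (∃ z, S.lt z m) ∧ ∃ z, S.lt m z := by
    intro m hm
    rcases S.ends m with h | h
    · obtain rfl := h e hm.symm
      exact he
    · exact h
  rcases A.eq_empty_or_nonempty with rfl | hAne
  · rcases B.eq_empty_or_nonempty with rfl | hBne
    · exact ⟨e, rfl, by simp, by simp⟩
    · obtain ⟨m, hm, hmin⟩ := S.flip.exists_max hB hBne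
      obtain ⟨z, hz⟩ := (hends m (hB m hm)).1
      refine ⟨z, (S.lab_eq hz).trans (hB m hm), by simp, fun b hb => ?_⟩
      rcases hmin b hb with rfl | h
      exacts [hz, S.trans hz h]
  · obtain ⟨k, hk, hmax⟩ := S.exists_max hA hAne
    rcases B.eq_empty_or_nonempty with rfl | hBne
    · obtain ⟨z, hz⟩ := (hends k (hA k hk)).2
      refine ⟨z, (S.lab_eq hz).symm.trans (hA k hk), fun a ha => ?_, by simp⟩
      rcases hmax a ha with rfl | h
      exacts [hz, S.trans h hz]
    · obtain ⟨m, hm, hmin⟩ := S.flip.exists_max hB hBne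
      obtain ⟨z, hz, hz'⟩ := S.dense (hAB k hk m hm)
      refine ⟨z, (S.lab_eq hz').trans (hB m hm), fun a ha => ?_, fun b hb => ?_⟩
      · rcases hmax a ha with rfl | h
        exacts [hz, S.trans h hz]
      · rcases hmin b hb with rfl | h
        exacts [hz', S.trans hz' h]

/-- Back-and-forth for dense orders: a finite order-preserving correspondence between two lines
extends to one more point `c`. The target line is the one of `e`. -/
lemma exists_corresponding {κ : Type*} [Finite κ] (p p' : κ → X) (c e : X)
    (hp : ∀ k, S.lab (p k) = S.lab c) (hp' : ∀ k, S.lab (p' k) = S.lab e)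
    (hlt : ∀ k l, S.lt (p k) (p l) ↔ S.lt (p' k) (p' l))
    (hend : (∀ y, S.lab y = S.lab e → y = e) → ∀ y, S.lab y = S.lab c → y = c) :
    ∃ d, S.lab d = S.lab e ∧
      ∀ k, (S.lt c (p k) ↔ S.lt d (p' k)) ∧ (S.lt (p k) c ↔ S.lt (p' k) d) := by
  classical
  have := Fintype.ofFinite κ
  rcases S.ends e with h | h
  · refine ⟨e, rfl, fun k => ?_⟩
    rw [hend h _ (hp k), h _ (hp' k)]
    simp [S.irrefl]
  by_cases hc : ∃ k, p k = c
  · obtain ⟨k, rfl⟩ := hc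
    exact ⟨p' k, hp' k, fun l => ⟨hlt k l, hlt l k⟩⟩
  obtain ⟨d, hd, h₁, h₂⟩ := S.exists_between_finsets h
    ((Finset.univ.filter fun k => S.lt (p k) c).image p')
    ((Finset.univ.filter fun k => S.lt c (p k)).image p')
    (by simp only [Finset.mem_image]; rintro _ ⟨k, -, rfl⟩; exact hp' k)
    (by simp only [Finset.mem_image]; rintro _ ⟨k, -, rfl⟩; exact hp' k)
    (by
      simp only [Finset.mem_image, Finset.mem_filter, Finset.mem_univ, true_and]
      rintro _ ⟨k, hk, rfl⟩ _ ⟨l, hl, rfl⟩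
      exact (hlt k l).1 (S.trans hk hl))
  simp only [Finset.mem_image, Finset.mem_filter, Finset.mem_univ, true_and,
    forall_exists_index, and_imp, forall_apply_eq_imp_iff₂] at h₁ h₂
  refine ⟨d, hd, fun k => ?_⟩
  rcases S.tri (hp k) with h | h | h
  · have := h₁ k h
    simp [h, this, S.asymm h, S.asymm this]
  · exact absurd ⟨k, h⟩ hc
  · have := h₂ k h
    simp [h, this, S.asymm h, S.asymm this]

/-! ### Cuts over finite sets and piecewise monotone partial maps -/

/-- The points `x` and `y` lie on the same line and in the same cut over `Q`. If one of them belongs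
to `Q`, then they are equal. -/
def SameCut (Q : Finset X) (x y : X) : Prop :=
  S.lab x = S.lab y ∧ ∀ q ∈ Q, (S.lt q x ↔ S.lt q y) ∧ (S.lt x q ↔ S.lt y q)

variable {S}

lemma SameCut.symm {Q : Finset X} {x y : X} (h : S.SameCut Q x y) : S.SameCut Q y x :=
  ⟨h.1.symm, fun q hq => ⟨(h.2 q hq).1.symm, (h.2 q hq).2.symm⟩⟩

lemma SameCut.trans {Q : Finset X} {x y z : X} (h : S.SameCut Q x y) (h' : S.SameCut Q y z) :
    S.SameCut Q x z :=
  ⟨h.1.trans h'.1, fun q hq => ⟨(h.2 q hq).1.trans (h'.2 q hq).1,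
    (h.2 q hq).2.trans (h'.2 q hq).2⟩⟩

lemma SameCut.mono {Q Q' : Finset X} (hQ : Q ⊆ Q') {x y : X} (h : S.SameCut Q' x y) :
    S.SameCut Q x y :=
  ⟨h.1, fun q hq => h.2 q (hQ hq)⟩

lemma SameCut.flip {Q : Finset X} {x y : X} (h : S.SameCut Q x y) : S.flip.SameCut Q x y :=
  ⟨h.1, fun q hq => (h.2 q hq).symm⟩

lemma SameCut.eq_of_mem {Q : Finset X} {x y : X} (h : S.SameCut Q x y) (hx : x ∈ Q) : x = y := by
  rcases S.tri h.1 with h' | h' | h'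
  · exact absurd ((h.2 x hx).1.2 h') (S.irrefl x)
  · exact h'
  · exact absurd ((h.2 x hx).2.2 h') (S.irrefl x)

lemma SameCut.of_between {Q : Finset X} {x y z : X} (h : S.SameCut Q x z) (hxy : S.lt x y)
    (hyz : S.lt y z) : S.SameCut Q x y := by
  refine ⟨S.lab_eq hxy, fun q hq => ⟨⟨fun h' => S.trans h' hxy, fun h' => ?_⟩, fun h' => ?_,
    fun h' => S.trans hxy h'⟩⟩
  · exact (h.2 q hq).1.2 (S.trans h' hyz)
  · exact S.trans hyz ((h.2 q hq).2.1 h')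

/-- A window around two points of the same cut on which the cut does not change. -/
lemma SameCut.exists_window {Q : Finset X} {x y : X}
    (h : S.SameCut Q x y) (hx : x ∉ Q) (hend : (∃ z, S.lt z x) ∧ ∃ z, S.lt x z) :
    ∃ a b, (S.lt a x ∧ S.lt a y) ∧ (S.lt x b ∧ S.lt y b) ∧
      ∀ z, S.lt a z → S.lt z b → S.SameCut Q x z := by
  classical
  obtain ⟨a, -, ha, ha'⟩ := S.exists_between_finsets hend (Q.filter fun q => S.lt q x) {x, y}
    (fun q hq => S.lab_eq (Finset.mem_filter.1 hq).2)
    (by simp [h.1])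
    (by
      intro q hq z hz
      obtain ⟨hq, hqx⟩ := Finset.mem_filter.1 hq
      rcases Finset.mem_insert.1 hz with rfl | hz
      · exact hqx
      · rw [Finset.mem_singleton.1 hz]
        exact (h.2 q hq).1.1 hqx)
  obtain ⟨b, -, hb, hb'⟩ := S.exists_between_finsets hend {x, y} (Q.filter fun q => S.lt x q)
    (by simp [h.1]) (fun q hq => (S.lab_eq (Finset.mem_filter.1 hq).2).symm)
    (by
      intro z hz q hq
      obtain ⟨hq, hqx⟩ := Finset.mem_filter.1 hq
      rcases Finset.mem_insert.1 hz with rfl | hz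
      · exact hqx
      · rw [Finset.mem_singleton.1 hz]
        exact (h.2 q hq).2.1 hqx)
  refine ⟨a, b, ⟨ha' x (by simp), ha' y (by simp)⟩, ⟨hb x (by simp), hb y (by simp)⟩,
    fun z haz hzb => ?_⟩
  have hzx : S.lab z = S.lab x :=
    (S.lab_eq haz).symm.trans (S.lab_eq (ha' x (by simp)))
  have hlo : ∀ q ∈ Q, S.lt q x → S.lt q z := fun q hq hqx =>
    S.trans (ha q (Finset.mem_filter.2 ⟨hq, hqx⟩)) haz
  have hhi : ∀ q ∈ Q, S.lt x q → S.lt z q := fun q hq hqx =>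
    S.trans hzb (hb' q (Finset.mem_filter.2 ⟨hq, hqx⟩))
  refine ⟨hzx.symm, fun q hq => ⟨⟨hlo q hq, fun hqz => ?_⟩, hhi q hq, fun hzq => ?_⟩⟩
  · rcases S.tri ((S.lab_eq hqz).trans hzx) with h' | h' | h'
    · exact h'
    · exact absurd (h' ▸ hq) hx
    · exact absurd (hhi q hq h') (S.asymm hqz)
  · rcases S.tri ((S.lab_eq hzq).symm.trans hzx) with h' | h' | h'
    · exact absurd (hlo q hq h') (S.asymm hzq)
    · exact absurd (h' ▸ hq) hx
    · exact h'

variable (S)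

/-- On every class of `SameCut Q`, the partial map `h` is defined everywhere or nowhere, and in the
first case it is increasing, has values on one line, and its image is convex. -/
structure PiecewiseMono (h : X ≃. X) (Q : Finset X) : Prop where
  dom : ∀ {x y x'}, S.SameCut Q x y → x' ∈ h x → ∃ y' ∈ h y, S.lab x' = S.lab y'
  mono : ∀ {x y x' y'}, S.SameCut Q x y → x' ∈ h x → y' ∈ h y → S.lt x y → S.lt x' y'
  convex : ∀ {x y x' y' z}, S.SameCut Q x y → x' ∈ h x → y' ∈ h y → S.lt x' z → S.lt z y' →
    ∃ u, z ∈ h u ∧ S.lt x u ∧ S.lt u y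

/-- On every class of `SameCut Q`, the partial map `h` either fixes all points, or increases all
points, or decreases all points (in so far as it maps them to their own line). -/
def UniformSign (h : X ≃. X) (Q : Finset X) : Prop :=
  ∀ {x y x' y'}, S.SameCut Q x y → x' ∈ h x → y' ∈ h y →
    (S.lt x' x ↔ S.lt y' y) ∧ (S.lt x x' ↔ S.lt y y')

variable {S}

lemma PiecewiseMono.flip {h : X ≃. X} {Q : Finset X} (hh : S.PiecewiseMono h Q) :
    S.flip.PiecewiseMono h Q where
  dom hxy := hh.dom hxy.flip
  mono hxy hx hy := hh.mono hxy.flip.symm hy hx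
  convex hxy hx hy h₁ h₂ := by
    obtain ⟨u, hu, h₃, h₄⟩ := hh.convex hxy.flip.symm hy hx h₂ h₁
    exact ⟨u, hu, h₄, h₃⟩

lemma PiecewiseMono.superset {h : X ≃. X} {Q Q' : Finset X} (hh : S.PiecewiseMono h Q)
    (hQ : Q ⊆ Q') : S.PiecewiseMono h Q' where
  dom hxy := hh.dom (hxy.mono hQ)
  mono hxy := hh.mono (hxy.mono hQ)
  convex hxy := hh.convex (hxy.mono hQ)

lemma UniformSign.superset {h : X ≃. X} {Q Q' : Finset X} (hh : S.UniformSign h Q)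
    (hQ : Q ⊆ Q') : S.UniformSign h Q' := fun hxy => hh (hxy.mono hQ)

lemma piecewiseMono_refl : S.PiecewiseMono (PEquiv.refl X) ∅ where
  dom {x y x'} hxy hx := by
    simp only [PEquiv.refl_apply, Option.mem_def, Option.some.injEq] at hx
    exact ⟨y, by simp, hx ▸ hxy.1⟩
  mono {x y x' y'} hxy hx hy h := by
    simp only [PEquiv.refl_apply, Option.mem_def, Option.some.injEq] at hx hy
    rwa [← hx, ← hy]
  convex {x y x' y' z} hxy hx hy h h' := by
    simp only [PEquiv.refl_apply, Option.mem_def, Option.some.injEq] at hx hy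
    subst hx hy
    exact ⟨z, by simp, h, h'⟩

/-- The finite set for a composite consists of the one for the first map and the preimages of the
points for the second one. -/
lemma PiecewiseMono.exists_trans {h k : X ≃. X} {Q R : Finset X} (hh : S.PiecewiseMono h Q)
    (hk : S.PiecewiseMono k R) : ∃ Q', S.PiecewiseMono (h.trans k) Q' := by
  classical
  have key : ∀ {x y x' y'}, S.SameCut (Q ∪ R.biUnion fun q => (h.symm q).toFinset) x y →
      x' ∈ h x → y' ∈ h y → S.SameCut R x' y' := by
    have aux : ∀ {x y x' y'}, S.SameCut (Q ∪ R.biUnion fun q => (h.symm q).toFinset) x y →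
        x' ∈ h x → y' ∈ h y → ∀ q ∈ R, ¬ (S.lt x' q ∧ ¬ S.lt y' q) ∧
          ¬ (S.lt q y' ∧ ¬ S.lt q x') := by
      intro x y x' y' hxy hx hy q hq
      have hQ := hxy.mono Finset.subset_union_left
      have hl : S.lab x' = S.lab y' := by
        obtain ⟨y'', hy'', hl⟩ := hh.dom hQ hx
        rwa [Option.mem_unique hy hy'']
      have hmem : ∀ u, q ∈ h u → S.lab u = S.lab x → (S.lt u x ↔ S.lt u y) ∧
          (S.lt x u ↔ S.lt y u) ∧ (u = x ↔ u = y) := by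
        intro u hu hlu
        have hm : u ∈ Q ∪ R.biUnion fun q => (h.symm q).toFinset := by
          simp only [Finset.mem_union, Finset.mem_biUnion, Option.mem_toFinset]
          exact Or.inr ⟨q, hq, (h.mem_iff_mem).2 hu⟩
        refine ⟨(hxy.2 u hm).1, (hxy.2 u hm).2, fun e => ?_, fun e => ?_⟩
        · subst e; exact hxy.eq_of_mem hm
        · subst e; exact (hxy.symm.eq_of_mem hm)
      constructor
      · rintro ⟨h₁, h₂⟩
        rcases S.tri (hl.symm.trans (S.lab_eq h₁)) with h₃ | h₃ | h₃
        · exact h₂ h₃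
        · subst h₃
          have := ((hmem y hy hxy.1.symm).2.2).2 rfl
          subst this
          exact S.ne_of_lt h₁ (Option.mem_unique hx hy)
        · obtain ⟨u, hu, h₄, h₅⟩ := hh.convex hQ hx hy h₁ h₃
          exact S.asymm h₅ ((hmem u hu (S.lab_eq h₄).symm).2.1.1 h₄)
      · rintro ⟨h₁, h₂⟩
        rcases S.tri (hl.trans (S.lab_eq h₁).symm) with h₃ | h₃ | h₃
        · obtain ⟨u, hu, h₄, h₅⟩ := hh.convex hQ hx hy h₃ h₁
          exact S.asymm h₅ ((hmem u hu (S.lab_eq h₄).symm).2.1.1 h₄)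
        · subst h₃
          have := ((hmem x hx rfl).2.2).1 rfl
          subst this
          exact S.ne_of_lt h₁ (Option.mem_unique hx hy)
        · exact h₂ h₃
    intro x y x' y' hxy hx hy
    refine ⟨?_, fun q hq => ⟨⟨fun h₁ => ?_, fun h₁ => ?_⟩, fun h₁ => ?_, fun h₁ => ?_⟩⟩
    · obtain ⟨y'', hy'', hl⟩ := hh.dom (hxy.mono Finset.subset_union_left) hx
      rwa [Option.mem_unique hy hy'']
    · exact by_contra fun h₂ => (aux hxy.symm hy hx q hq).2 ⟨h₁, h₂⟩
    · exact by_contra fun h₂ => (aux hxy hx hy q hq).2 ⟨h₁, h₂⟩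
    · exact by_contra fun h₂ => (aux hxy hx hy q hq).1 ⟨h₁, h₂⟩
    · exact by_contra fun h₂ => (aux hxy.symm hy hx q hq).1 ⟨h₁, h₂⟩
  refine ⟨Q ∪ R.biUnion fun q => (h.symm q).toFinset, ?_, ?_, ?_⟩
  · intro x y x' hxy hx
    obtain ⟨b, hb, hx'⟩ := (PEquiv.mem_trans h k x x').1 hx
    obtain ⟨c, hc, -⟩ := hh.dom (hxy.mono Finset.subset_union_left) hb
    obtain ⟨y', hy', hl⟩ := hk.dom (key hxy hb hc) hx'
    exact ⟨y', (PEquiv.mem_trans h k y y').2 ⟨c, hc, hy'⟩, hl⟩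
  · intro x y x' y' hxy hx hy hlt
    obtain ⟨b, hb, hx'⟩ := (PEquiv.mem_trans h k x x').1 hx
    obtain ⟨c, hc, hy'⟩ := (PEquiv.mem_trans h k y y').1 hy
    exact hk.mono (key hxy hb hc) hx' hy' (hh.mono (hxy.mono Finset.subset_union_left) hb hc hlt)
  · intro x y x' y' z hxy hx hy h₁ h₂
    obtain ⟨b, hb, hx'⟩ := (PEquiv.mem_trans h k x x').1 hx
    obtain ⟨c, hc, hy'⟩ := (PEquiv.mem_trans h k y y').1 hy
    obtain ⟨u, hu, h₃, h₄⟩ := hk.convex (key hxy hb hc) hx' hy' h₁ h₂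
    obtain ⟨w, hw, h₅, h₆⟩ := hh.convex (hxy.mono Finset.subset_union_left) hb hc h₃ h₄
    exact ⟨w, (PEquiv.mem_trans h k w z).2 ⟨u, hw, hu⟩, h₅, h₆⟩

/-- One implication of `PiecewiseMono.compare`; the others follow by symmetry. -/
lemma PiecewiseMono.lt_of_lt {h : X ≃. X} {Q : Finset X} (hh : S.PiecewiseMono h Q)
    (hs : S.PiecewiseMono h.symm Q) {c d z z' x x' : X} (hcd : S.SameCut Q c d)
    (hzz : S.SameCut Q z z') (hx : x ∈ h c) (hx' : x' ∈ h d)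
    (hcut : ∀ e e', z ∈ h e → z' ∈ h e' → (S.lt c e ↔ S.lt d e') ∧ (S.lt e c ↔ S.lt e' d))
    (hlt : S.lt x z) : S.lt x' z' := by
  have hxx : S.lab x = S.lab x' := by
    obtain ⟨y, hy, hl⟩ := hh.dom hcd hx
    rwa [Option.mem_unique hx' hy]
  have hl : S.lab x' = S.lab z' := by rw [← hxx, S.lab_eq hlt, hzz.1]
  have hl' : S.lab x' = S.lab z := by rw [← hxx, S.lab_eq hlt]
  have sy : ∀ {a b : X}, b ∈ h a → a ∈ h.symm b := fun hab => h.mem_iff_mem.2 hab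
  rcases S.tri hl with h₀ | h₀ | h₀
  · exact h₀
  · -- `z' = x'` lies in the range of `h`, hence `z` does, and the preimage of `z` is `c`
    subst h₀
    obtain ⟨e, he, hle⟩ := hs.dom hzz.symm (sy hx')
    have h₁ := hcut e d (h.mem_iff_mem.1 he) hx'
    rcases S.tri (hle.symm.trans hcd.1.symm) with h₂ | h₂ | h₂
    · exact absurd (h₁.2.1 h₂) (S.irrefl d)
    · subst h₂
      exact absurd (Option.mem_unique hx (h.mem_iff_mem.1 he)) (S.ne_of_lt hlt)
    · exact absurd (h₁.1.1 h₂) (S.irrefl d)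
  -- In all remaining cases the cut of `z` either meets the range of `h`, and then lies in it so that
  -- orders can be compared in the domain, or misses it and cannot separate `x` from `x'`.
  exfalso
  by_cases hr : ∃ e, z ∈ h e
  · obtain ⟨e, he⟩ := hr
    obtain ⟨e', he', -⟩ := hs.dom hzz (sy he)
    have he'' := h.mem_iff_mem.1 he'
    have h₁ := hcut e e' he he''
    rcases S.tri hl' with h₂ | h₂ | h₂
    · have hzx : S.SameCut Q z' x' := hzz.symm.of_between h₀ h₂
      have h₃ : S.lt e' d := hs.mono hzx he' (sy hx') h₀
      have h₄ : S.lt d e := hs.mono (hzx.symm.trans hzz.symm) (sy hx') (sy he) h₂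
      have h₅ := h₁.2.2 h₃
      have h₆ : S.lt x' x := hh.mono hcd.symm hx' hx (S.trans h₄ h₅)
      have h₇ : S.SameCut Q x' x :=
        (hzx.symm.trans hzz.symm).of_between h₆ hlt
      have h₈ : S.lt c e := hs.mono (h₇.symm.trans (hzx.symm.trans hzz.symm)) (sy hx) (sy he) hlt
      exact S.asymm h₅ h₈
    · subst h₂
      have hed : e = d := Option.mem_unique (sy he) (sy hx')
      subst hed
      have h₃ : S.lt e' e := hs.mono hzz.symm he' (sy he) h₀
      have h₄ := h₁.2.2 h₃
      exact S.asymm hlt (hh.mono hcd.symm he hx h₄)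
    · obtain ⟨u, hu, h₃, h₄⟩ := hh.convex hcd hx hx' hlt h₂
      obtain rfl : e = u := Option.mem_unique (sy he) (sy hu)
      obtain ⟨w, hw, h₅, h₆⟩ := hs.convex hzz (sy he) he' h₄ (h₁.1.1 h₃)
      obtain rfl : x' = w := Option.mem_unique hx' (h.mem_iff_mem.1 hw)
      exact S.asymm h₀ h₆
  · rcases S.tri hl' with h₂ | h₂ | h₂
    · obtain ⟨e, he, -⟩ := hs.dom ((hzz.symm.of_between h₀ h₂).symm.trans hzz.symm) (sy hx')
      exact hr ⟨e, h.mem_iff_mem.1 he⟩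
    · exact hr ⟨d, h₂ ▸ hx'⟩
    · obtain ⟨u, hu, -⟩ := hh.convex hcd hx hx' hlt h₂
      exact hr ⟨u, hu⟩

/-- The position of `h c` with respect to `z` is determined by the cuts of `c` and `z` and by the
position of `c` with respect to the preimage of `z`. -/
lemma PiecewiseMono.compare {h : X ≃. X} {Q : Finset X} (hh : S.PiecewiseMono h Q)
    (hs : S.PiecewiseMono h.symm Q) {c d z z' x x' : X} (hcd : S.SameCut Q c d)
    (hzz : S.SameCut Q z z') (hx : x ∈ h c) (hx' : x' ∈ h d)
    (hcut : ∀ e e', z ∈ h e → z' ∈ h e' → (S.lt c e ↔ S.lt d e') ∧ (S.lt e c ↔ S.lt e' d)) :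
    (S.lt x z ↔ S.lt x' z') ∧ (S.lt z x ↔ S.lt z' x') := by
  have hcut' : ∀ e' e, z' ∈ h e' → z ∈ h e →
      (S.lt d e' ↔ S.lt c e) ∧ (S.lt e' d ↔ S.lt e c) := fun e' e h₁ h₂ =>
    ⟨(hcut e e' h₂ h₁).1.symm, (hcut e e' h₂ h₁).2.symm⟩
  exact ⟨⟨hh.lt_of_lt hs hcd hzz hx hx' hcut,
      hh.lt_of_lt hs hcd.symm hzz.symm hx' hx hcut'⟩,
    hh.flip.lt_of_lt hs.flip hcd.flip hzz.flip hx hx' fun e e' h₁ h₂ => (hcut e e' h₁ h₂).symm,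
    hh.flip.lt_of_lt hs.flip hcd.symm.flip hzz.symm.flip hx' hx fun e e' h₁ h₂ =>
      (hcut' e e' h₁ h₂).symm⟩

end LineSystem

/-! ### Flow systems -/

instance : Finite Dir :=
  Finite.of_injective (fun g : Dir => g = .fwd) (by rintro (_ | _) (_ | _) h <;> simp_all)

/-- The composite of the partial maps given by a list of directions, the first one applied first. -/
def composite {X : Type*} (step : Dir → X ≃. X) (w : List Dir) : X ≃. X :=
  w.foldr (fun g h => (step g).trans h) (PEquiv.refl X)

lemma LineSystem.exists_mono_composite {X Λ : Type*} (S : LineSystem X Λ) {step : Dir → X ≃. X}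
    (h : ∀ g, ∃ Q, S.PiecewiseMono (step g) Q) (w : List Dir) :
    ∃ Q, S.PiecewiseMono (composite step w) Q := by
  induction w with
  | nil => exact ⟨∅, LineSystem.piecewiseMono_refl⟩
  | cons g w ih =>
    obtain ⟨Q, hQ⟩ := h g
    obtain ⟨R, hR⟩ := ih
    exact hQ.exists_trans hR

/-- The combinatorial content of a model: a set `X` with a retraction `fib.lab` onto a base, whose
fibers are the lines of the system `fib`, a system of lines `base` on the base, and partial maps
`step g`, inverse to each other, that are piecewise monotone with finitely many pieces and whose
composites have only finitely many changes between moving forward, backward and not at all.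

The base consists of the points that the retraction fixes. A line of `base` lies inside or outside
the base; in the first case the fibers over it are all dense or all single points, in the second
case it is a single point. -/
structure FlowSystem (X Λ : Type*) where
  base : LineSystem X Λ
  fib : LineSystem X X
  root_root : ∀ x, fib.lab (fib.lab x) = fib.lab x
  root_congr : ∀ {x y}, base.lab x = base.lab y → fib.lab x = x → fib.lab y = y
  single_congr : ∀ {x y}, base.lab x = base.lab y → fib.lab x = x →
    (∀ z, fib.lab z = x → z = x) → ∀ z, fib.lab z = y → z = y
  lab_of_root_ne : ∀ {x}, fib.lab x ≠ x → ∀ y, base.lab y = base.lab x → y = x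
  step : Dir → X ≃. X
  step_opp : ∀ g, step g.opp = (step g).symm
  exists_mono : ∀ g, ∃ Q, base.PiecewiseMono (step g) Q
  exists_sign : ∀ w : List Dir, ∃ Q, base.UniformSign (composite step w) Q

namespace FlowSystem

variable {X Λ : Type*} (S : FlowSystem X Λ)

/-- The point of the base over which `x` lies. -/
abbrev root (x : X) : X := S.fib.lab x

lemma root_idem (x : X) : S.root (S.root x) = S.root x := S.root_root x

/-- The composite of the steps in a list. -/
abbrev word (w : List Dir) : X ≃. X := composite S.step w

lemma word_cons (g : Dir) (w : List Dir) : S.word (g :: w) = (S.step g).trans (S.word w) := rfl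

lemma word_append (w w' : List Dir) : S.word (w ++ w') = (S.word w).trans (S.word w') := by
  induction w with
  | nil => exact (PEquiv.refl_trans _).symm
  | cons g w ih => rw [List.cons_append, word_cons, word_cons, ih, PEquiv.trans_assoc]

lemma word_symm (w : List Dir) : S.word ((w.map Dir.opp).reverse) = (S.word w).symm := by
  induction w with
  | nil => rfl
  | cons g w ih =>
    rw [List.map_cons, List.reverse_cons, word_append, ih, word_cons, word_cons,
      PEquiv.symm_trans_rev, S.step_opp]
    congr 1
    exact PEquiv.trans_refl _

lemma mem_word_nil (x y : X) : y ∈ S.word [] x ↔ x = y := by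
  change y ∈ PEquiv.refl X x ↔ _
  simp

/-- `Q` contains the finitely many points at which composites of length at most `n` change their
behaviour. -/
def Breaks (n : ℕ) (Q : Finset X) : Prop :=
  ∀ w : List Dir, w.length ≤ n → S.base.PiecewiseMono (S.word w) Q ∧
    S.base.PiecewiseMono (S.word w).symm Q ∧ S.base.UniformSign (S.word w) Q

/-- One finite set serves all composites of bounded length. -/
lemma exists_breaks (n : ℕ) (Q : Finset X) : ∃ Q', Q ⊆ Q' ∧ S.Breaks n Q' := by
  classical
  have hfin := List.finite_length_le Dir n
  choose A hA using S.base.exists_mono_composite S.exists_mono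
  choose B hB using S.exists_sign
  refine ⟨Q ∪ hfin.toFinset.biUnion fun w => A w ∪ A (w.map Dir.opp).reverse ∪ B w,
    Finset.subset_union_left, fun w hw => ?_⟩
  have hsub : A w ∪ A (w.map Dir.opp).reverse ∪ B w ⊆
      Q ∪ hfin.toFinset.biUnion fun w => A w ∪ A (w.map Dir.opp).reverse ∪ B w :=
    (Finset.subset_biUnion_of_mem (fun w => A w ∪ A (w.map Dir.opp).reverse ∪ B w)
      (hfin.mem_toFinset.2 hw)).trans Finset.subset_union_right
  refine ⟨(hA w).superset (Finset.Subset.trans (fun x hx => by simp [hx]) hsub), ?_,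
    LineSystem.UniformSign.superset (hB w) (Finset.Subset.trans (fun x hx => by simp [hx]) hsub)⟩
  rw [← word_symm]
  exact (hA _).superset (Finset.Subset.trans (fun x hx => by simp only [Finset.mem_union, hx,
    or_true, true_or]) hsub)

/-! ### Similar tuples -/

variable {ι κ : Type*}

/-- A tuple together with the roots of its entries. -/
def withRoots (a : ι → X) : ι ⊕ ι → X := Sum.elim a fun i => S.root (a i)

lemma root_withRoots (a : ι → X) (s : ι ⊕ ι) :
    S.root (S.withRoots a s) = S.root (a (Sum.elim id id s)) := by
  rcases s with s | s
  · rfl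
  · exact S.root_root _

/-- The part of `Sim` on the base, in one direction: a point that is reached from `a` in at most `n`
steps has a counterpart reached from `b` by the same steps, on the same line and in the same
position with respect to the roots. -/
def SimBase (n : ℕ) (a b : ι → X) : Prop :=
  ∀ w : List Dir, w.length ≤ n → ∀ i, ∀ y ∈ S.word w (S.root (a i)),
    ∃ y' ∈ S.word w (S.root (b i)), S.base.lab y = S.base.lab y' ∧
      ∀ j, (S.base.lt y (S.root (a j)) ↔ S.base.lt y' (S.root (b j))) ∧
        (S.base.lt (S.root (a j)) y ↔ S.base.lt (S.root (b j)) y')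

/-- The tuples `a` and `b` cannot be distinguished by the orderings and at most `n` steps. Two points
reached from them need not be compared with each other: instead of `h(c)` and `k(d)` one compares
`d` with the image of `c` under `h` followed by the inverse of `k`. -/
structure Sim (n : ℕ) (a b : ι → X) : Prop where
  left : S.SimBase n a b
  right : S.SimBase n b a
  fib : ∀ s t, S.fib.lt (S.withRoots a s) (S.withRoots a t) ↔
    S.fib.lt (S.withRoots b s) (S.withRoots b t)

variable {S} {n : ℕ} {a b : ι → X}

lemma Sim.symm (h : S.Sim n a b) : S.Sim n b a :=
  ⟨h.right, h.left, fun s t => (h.fib s t).symm⟩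

lemma Sim.comp (h : S.Sim n a b) (e : κ → ι) : S.Sim n (a ∘ e) (b ∘ e) where
  left w hw i y hy := by
    obtain ⟨y', hy', hl, hj⟩ := h.left w hw (e i) y hy
    exact ⟨y', hy', hl, fun j => hj (e j)⟩
  right w hw i y hy := by
    obtain ⟨y', hy', hl, hj⟩ := h.right w hw (e i) y hy
    exact ⟨y', hy', hl, fun j => hj (e j)⟩
  fib s t := by
    have := h.fib (Sum.map e e s) (Sum.map e e t)
    rcases s with s | s <;> rcases t with t | t <;> exact this

lemma Sim.mono (h : S.Sim n a b) {m : ℕ} (hm : m ≤ n) : S.Sim m a b :=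
  ⟨fun w hw => h.left w (hw.trans hm), fun w hw => h.right w (hw.trans hm), h.fib⟩

lemma Sim.step (h : S.Sim n a b) {w : List Dir} (hw : w.length ≤ n) {i : ι} {y y' : X}
    (hy : y ∈ S.word w (S.root (a i))) (hy' : y' ∈ S.word w (S.root (b i))) :
    S.base.lab y = S.base.lab y' ∧
      ∀ j, (S.base.lt y (S.root (a j)) ↔ S.base.lt y' (S.root (b j))) ∧
        (S.base.lt (S.root (a j)) y ↔ S.base.lt (S.root (b j)) y') := by
  obtain ⟨z, hz, hl⟩ := h.left w hw i y hy
  rwa [Option.mem_unique hy' hz]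

lemma Sim.lab_root (h : S.Sim n a b) (i : ι) :
    S.base.lab (S.root (a i)) = S.base.lab (S.root (b i)) :=
  (h.step (w := []) (Nat.zero_le n) ((S.mem_word_nil _ _).2 rfl) ((S.mem_word_nil _ _).2 rfl)).1

lemma Sim.lt_root (h : S.Sim n a b) (i j : ι) :
    S.base.lt (S.root (a i)) (S.root (a j)) ↔ S.base.lt (S.root (b i)) (S.root (b j)) :=
  ((h.step (w := []) (Nat.zero_le n) ((S.mem_word_nil _ _).2 rfl)
    ((S.mem_word_nil _ _).2 rfl)).2 j).1

lemma Sim.eq_of_step (h : S.Sim n a b) {w : List Dir} (hw : w.length ≤ n) {i j : ι} {y y' : X}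
    (hy : y ∈ S.word w (S.root (a i))) (hy' : y' ∈ S.word w (S.root (b i)))
    (he : y = S.root (a j)) : y' = S.root (b j) := by
  obtain ⟨hl, hj⟩ := h.step hw hy hy'
  subst he
  rcases S.base.tri (hl.symm.trans (h.lab_root j)) with h' | h' | h'
  · exact absurd ((hj j).1.2 h') (S.base.irrefl _)
  · exact h'
  · exact absurd ((hj j).2.2 h') (S.base.irrefl _)

lemma Sim.root_eq (h : S.Sim n a b) {i j : ι} (he : S.root (a i) = S.root (a j)) :
    S.root (b i) = S.root (b j) :=
  h.eq_of_step (w := []) (Nat.zero_le n) ((S.mem_word_nil _ _).2 rfl)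
    ((S.mem_word_nil _ _).2 rfl) he

lemma Sim.withRoots_eq (h : S.Sim n a b) {s t : ι ⊕ ι} (he : S.withRoots a s = S.withRoots a t) :
    S.withRoots b s = S.withRoots b t := by
  have h₁ := congrArg S.root he
  rw [S.root_withRoots, S.root_withRoots] at h₁
  have h₂ := h.root_eq h₁
  rw [← S.root_withRoots, ← S.root_withRoots] at h₂
  rcases S.fib.tri h₂ with h₃ | h₃ | h₃
  · exact absurd ((h.fib s t).2 h₃) (by rw [he]; exact S.fib.irrefl _)
  · exact h₃
  · exact absurd ((h.fib t s).2 h₃) (by rw [he]; exact S.fib.irrefl _)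

lemma Sim.eq (h : S.Sim n a b) {i j : ι} (he : a i = a j) : b i = b j :=
  h.withRoots_eq (s := Sum.inl i) (t := Sum.inl j) he

lemma Sim.eq_root (h : S.Sim n a b) {i j : ι} (he : a i = S.root (a j)) : b i = S.root (b j) :=
  h.withRoots_eq (s := Sum.inl i) (t := Sum.inr j) he

variable (S) in
/-- Every point of `Q` in the base is the root of an entry of both tuples, at the same place. -/
def Covers (Q : Finset X) (a b : ι → X) : Prop :=
  ∀ q ∈ Q, S.root q = q → ∃ k, S.root (a k) = q ∧ S.root (b k) = q

variable (S) in
lemma not_lt_of_root_ne {q : X} (hq : S.root q ≠ q) (y : X) :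
    ¬ S.base.lt q y ∧ ¬ S.base.lt y q := by
  constructor <;> intro h
  · exact S.base.ne_of_lt h (S.lab_of_root_ne hq y (S.base.lab_eq h).symm).symm
  · exact S.base.ne_of_lt h (S.lab_of_root_ne hq y (S.base.lab_eq h))

/-- Points that are common to both tuples bound the same cuts. -/
lemma Sim.sameCut (h : S.Sim n a b) {Q : Finset X}
    (hQ : S.Covers Q a b) {w : List Dir} (hw : w.length ≤ n)
    {i : ι} {y y' : X} (hy : y ∈ S.word w (S.root (a i))) (hy' : y' ∈ S.word w (S.root (b i))) :
    S.base.SameCut Q y y' := by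
  obtain ⟨hl, hj⟩ := h.step hw hy hy'
  refine ⟨hl, fun q hq => ?_⟩
  by_cases hqr : S.root q = q
  swap
  · exact ⟨iff_of_false (S.not_lt_of_root_ne hqr _).1 (S.not_lt_of_root_ne hqr _).1,
      iff_of_false (S.not_lt_of_root_ne hqr _).2 (S.not_lt_of_root_ne hqr _).2⟩
  obtain ⟨k, h₁, h₂⟩ := hQ q hq hqr
  have := hj k
  rw [h₁, h₂] at this
  exact this.symm

variable (S)

/-- The tuple `a` with the point `c` added in front. -/
def adjoin {X : Type*} (c : X) (a : ι → X) : Option ι → X := fun o => o.elim c a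

/-- `d` has the same position over the points reached from `b` as `c` over those reached from `a`,
in the base and in the fiber. -/
structure SamePosition (n : ℕ) (a b : ι → X) (c d : X) : Prop where
  lab : S.base.lab (S.root c) = S.base.lab (S.root d)
  cut : ∀ w : List Dir, w.length ≤ n → ∀ i, ∀ y ∈ S.word w (S.root (a i)),
    ∀ y' ∈ S.word w (S.root (b i)), (S.base.lt (S.root c) y ↔ S.base.lt (S.root d) y') ∧
      (S.base.lt y (S.root c) ↔ S.base.lt y' (S.root d))
  fib : ∀ s, (S.fib.lt c (S.withRoots a s) ↔ S.fib.lt d (S.withRoots b s)) ∧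
    (S.fib.lt (S.withRoots a s) c ↔ S.fib.lt (S.withRoots b s) d)
  root : (S.fib.lt c (S.root c) ↔ S.fib.lt d (S.root d)) ∧
    (S.fib.lt (S.root c) c ↔ S.fib.lt (S.root d) d)

variable {S}

lemma SamePosition.symm {c d : X} (h : S.SamePosition n a b c d) : S.SamePosition n b a d c where
  lab := h.lab.symm
  cut w hw i y hy y' hy' := ⟨(h.cut w hw i y' hy' y hy).1.symm, (h.cut w hw i y' hy' y hy).2.symm⟩
  fib s := ⟨(h.fib s).1.symm, (h.fib s).2.symm⟩
  root := ⟨h.root.1.symm, h.root.2.symm⟩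

lemma SamePosition.sameCut {c d : X} (h : S.SamePosition n a b c d) {Q : Finset X}
    (hQ : S.Covers Q a b) :
    S.base.SameCut Q (S.root c) (S.root d) := by
  refine ⟨h.lab, fun q hq => ?_⟩
  by_cases hqr : S.root q = q
  swap
  · exact ⟨iff_of_false (S.not_lt_of_root_ne hqr _).1 (S.not_lt_of_root_ne hqr _).1,
      iff_of_false (S.not_lt_of_root_ne hqr _).2 (S.not_lt_of_root_ne hqr _).2⟩
  obtain ⟨k, h₁, h₂⟩ := hQ q hq hqr
  have := h.cut [] (Nat.zero_le n) k _ ((S.mem_word_nil _ _).2 rfl) _ ((S.mem_word_nil _ _).2 rfl)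
  rw [h₁, h₂] at this
  exact this.symm

lemma SimBase.cons (hs : S.Sim n a b) {Q : Finset X} (hB : S.Breaks n Q)
    (hQ : S.Covers Q a b) {c d : X}
    (h : S.SamePosition n a b c d) : S.SimBase n (adjoin c a) (adjoin d b) := by
  rintro w hw (_ | i) y hy
  · have hcd := h.sameCut hQ
    obtain ⟨h₁, h₂, h₃⟩ := hB w hw
    change y ∈ S.word w (S.root c) at hy
    obtain ⟨y', hy', hl⟩ := h₁.dom hcd hy
    refine ⟨y', hy', hl, ?_⟩
    rintro (_ | j)
    · exact h₃ hcd hy hy'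
    · refine h₁.compare h₂ hcd (hs.sameCut hQ (w := []) (Nat.zero_le n) (i := j)
        ((S.mem_word_nil _ _).2 rfl) ((S.mem_word_nil _ _).2 rfl)) hy hy' fun e e' he he' => ?_
      refine h.cut (w.map Dir.opp).reverse (by simpa using hw) j e ?_ e' ?_ <;>
      · rw [word_symm]
        exact (S.word w).mem_iff_mem.2 (by assumption)
  · obtain ⟨y', hy', hl, hj⟩ := hs.left w hw i y hy
    refine ⟨y', hy', hl, ?_⟩
    rintro (_ | j)
    · exact (h.cut w hw i y hy y' hy').symm
    · exact hj j

lemma Sim.cons (hs : S.Sim n a b) {Q : Finset X} (hB : S.Breaks n Q)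
    (hQ : S.Covers Q a b) {c d : X}
    (h : S.SamePosition n a b c d) : S.Sim n (adjoin c a) (adjoin d b) := by
  have hQ' : S.Covers Q b a := fun q hq hqr => by
    obtain ⟨k, h₁, h₂⟩ := hQ q hq hqr
    exact ⟨k, h₂, h₁⟩
  have hl := SimBase.cons hs hB hQ h
  have hr := SimBase.cons hs.symm hB hQ' h.symm
  refine ⟨hl, hr, ?_⟩
  -- a root comparison reduces to one inside the fiber of the new point
  have heq : ∀ j, S.root (a j) = S.root c ↔ S.root (b j) = S.root d := by
    have aux : ∀ {a b : ι → X} {c d : X}, S.Sim n a b → S.SamePosition n a b c d → ∀ j,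
        S.root (a j) = S.root c → S.root (b j) = S.root d := by
      intro a b c d hs h j he
      have := h.cut [] (Nat.zero_le n) j _ ((S.mem_word_nil _ _).2 rfl) _
        ((S.mem_word_nil _ _).2 rfl)
      rw [he] at this
      have hlab : S.base.lab (S.root (b j)) = S.base.lab (S.root d) := by
        rw [← hs.lab_root j, he, h.lab]
      rcases S.base.tri hlab with h' | h' | h'
      · exact absurd (this.2.2 h') (S.base.irrefl _)
      · exact h'
      · exact absurd (this.1.2 h') (S.base.irrefl _)
    exact fun j => ⟨aux hs h j, aux hs.symm h.symm j⟩
  have hroot : ∀ s, (S.fib.lt (S.root c) (S.withRoots a s) ↔ S.fib.lt (S.root d) (S.withRoots b s)) ∧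
      (S.fib.lt (S.withRoots a s) (S.root c) ↔ S.fib.lt (S.withRoots b s) (S.root d)) := by
    intro s
    by_cases he : S.root (a (Sum.elim id id s)) = S.root c
    · have he' := (heq _).1 he
      rw [← he, ← he']
      exact ⟨hs.fib (Sum.inr _) s, hs.fib s (Sum.inr _)⟩
    · have he' := (heq _).not.1 he
      have h₁ : ∀ (a : ι → X) c s, S.root (a (Sum.elim id id s)) ≠ S.root c →
          ¬ S.fib.lt (S.root c) (S.withRoots a s) ∧ ¬ S.fib.lt (S.withRoots a s) (S.root c) := by
        refine fun a c s hne => ⟨fun h => hne ?_, fun h => hne ?_⟩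
        · have := S.fib.lab_eq h
          rw [S.root_root] at this
          exact (this.trans (S.root_withRoots a s)).symm
        · have := S.fib.lab_eq h
          rw [S.root_root] at this
          exact (S.root_withRoots a s).symm.trans this
      have h₂ := h₁ a c s he
      have h₃ := h₁ b d s he'
      exact ⟨iff_of_false h₂.1 h₃.1, iff_of_false h₂.2 h₃.2⟩
  rintro ((_ | i) | (_ | i)) ((_ | j) | (_ | j))
  · exact iff_of_false (S.fib.irrefl c) (S.fib.irrefl d)
  · exact (h.fib (Sum.inl j)).1
  · exact h.root.1
  · exact (h.fib (Sum.inr j)).1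
  · exact (h.fib (Sum.inl i)).2
  · exact hs.fib (Sum.inl i) (Sum.inl j)
  · exact (hroot (Sum.inl i)).2
  · exact hs.fib (Sum.inl i) (Sum.inr j)
  · exact h.root.2
  · exact (hroot (Sum.inl j)).1
  · exact iff_of_false (S.fib.irrefl (S.root c)) (S.fib.irrefl (S.root d))
  · exact (hroot (Sum.inr j)).1
  · exact (h.fib (Sum.inr i)).2
  · exact hs.fib (Sum.inr i) (Sum.inl j)
  · exact (hroot (Sum.inr i)).2
  · exact hs.fib (Sum.inr i) (Sum.inr j)

/-- The back-and-forth step. The point `d` is found first in the base and then in the fiber; in both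
cases it has to fill a cut in a dense order. Comparing two points reached in `n` steps takes `2 * n`
steps. -/
lemma Sim.exists_cons [Finite ι] (hs : S.Sim (2 * n) a b) {Q : Finset X} (hB : S.Breaks n Q)
    (hQ : S.Covers Q a b) (c : X) :
    ∃ d, S.Sim n (adjoin c a) (adjoin d b) := by
  have hfin : Finite {w : List Dir // w.length ≤ n} := List.finite_length_le Dir n
  have hn : n ≤ 2 * n := by omega
  -- the points of the base that are reached in at most `n` steps
  let K : Type _ := {k : {w : List Dir // w.length ≤ n} × ι //
    ∃ y ∈ S.word k.1.1 (S.root (a k.2)), S.base.lab y = S.base.lab (S.root c)}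
  choose p hp hpl using fun k : K => k.2
  have hpp := fun k : K => hs.left k.1.1.1 (k.1.1.2.trans hn) k.1.2 (p k) (hp k)
  choose p' hp' hpl' hpj using hpp
  obtain ⟨d₀, hd₀, hcut⟩ := S.base.exists_corresponding p p' (S.root c) (S.root c) hpl
    (fun k => (hpl' k).symm.trans (hpl k))
    (by
      intro k l
      obtain ⟨h₁, h₂, -⟩ := hB k.1.1.1 k.1.1.2
      refine (h₁.compare h₂ (hs.sameCut hQ (w := []) (Nat.zero_le _)
        ((S.mem_word_nil _ _).2 rfl) ((S.mem_word_nil _ _).2 rfl))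
        (hs.sameCut hQ (l.1.1.2.trans hn) (hp l) (hp' l)) (hp k) (hp' k) fun e e' he he' => ?_).1
      have hw : (l.1.1.1 ++ (k.1.1.1.map Dir.opp).reverse).length ≤ 2 * n := by
        have h₃ := l.1.1.2
        have h₄ := k.1.1.2
        simp only [List.length_append, List.length_reverse, List.length_map]
        omega
      refine ((hs.step hw (i := l.1.2) (y := e) (y' := e') ?_ ?_).2 k.1.2).symm
      · rw [word_append, word_symm]
        exact (PEquiv.mem_trans _ _ _ _).2 ⟨_, hp l, (S.word _).mem_iff_mem.2 he⟩
      · rw [word_append, word_symm]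
        exact (PEquiv.mem_trans _ _ _ _).2 ⟨_, hp' l, (S.word _).mem_iff_mem.2 he'⟩)
    (fun h => h)
  have hrd : S.root d₀ = d₀ := S.root_congr hd₀.symm (S.root_root c)
  have hcut' : ∀ w : List Dir, w.length ≤ n → ∀ i, ∀ y ∈ S.word w (S.root (a i)),
      ∀ y' ∈ S.word w (S.root (b i)), (S.base.lt (S.root c) y ↔ S.base.lt d₀ y') ∧
        (S.base.lt y (S.root c) ↔ S.base.lt y' d₀) := by
    intro w hw i y hy y' hy'
    have hl := (hs.step (hw.trans hn) hy hy').1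
    by_cases hyl : S.base.lab y = S.base.lab (S.root c)
    · have := hcut ⟨⟨⟨w, hw⟩, i⟩, y, hy, hyl⟩
      rwa [Option.mem_unique (hp _) hy, Option.mem_unique (hp' _) hy'] at this
    · refine ⟨iff_of_false (fun h => hyl (S.base.lab_eq h).symm) (fun h => hyl ?_),
        iff_of_false (fun h => hyl (S.base.lab_eq h)) (fun h => hyl ?_)⟩
      · rw [hl, ← S.base.lab_eq h, hd₀]
      · rw [hl, S.base.lab_eq h, hd₀]
  have hpos₀ : S.SamePosition n a b (S.root c) d₀ := by
    -- a point of the base is the root of another entry, or not comparable to the fiber of it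
    have hroot : ∀ {a b : ι → X} {c d : X}, S.Sim (2 * n) a b → S.root c = c → S.root d = d →
        S.base.lab c = S.base.lab d → (∀ i, (S.base.lt c (S.root (a i)) ↔
          S.base.lt d (S.root (b i))) ∧ (S.base.lt (S.root (a i)) c ↔
          S.base.lt (S.root (b i)) d)) →
        ∀ s, (S.fib.lt c (S.withRoots a s) → S.fib.lt d (S.withRoots b s)) ∧
          (S.fib.lt (S.withRoots a s) c → S.fib.lt (S.withRoots b s) d) := by
      intro a b c d hs hc hd hcd hcut s
      have key : S.root (a (Sum.elim id id s)) = c → S.root (b (Sum.elim id id s)) = d := by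
        intro he
        have h₁ := hcut (Sum.elim id id s)
        rw [he] at h₁
        have hlab : S.base.lab (S.root (b (Sum.elim id id s))) = S.base.lab d := by
          rw [← hs.lab_root, he, hcd]
        rcases S.base.tri hlab with h' | h' | h'
        · exact absurd (h₁.2.2 h') (S.base.irrefl _)
        · exact h'
        · exact absurd (h₁.1.2 h') (S.base.irrefl _)
      constructor
      · intro h
        have h₁ : S.root (a (Sum.elim id id s)) = c := by
          rw [← S.root_withRoots, ← hc]; exact (S.fib.lab_eq h).symm
        have h₂ := key h₁
        rw [← h₂]
        rw [← h₁] at h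
        exact (hs.fib (Sum.inr _) s).1 h
      · intro h
        have h₁ : S.root (a (Sum.elim id id s)) = c := by
          rw [← S.root_withRoots, ← hc]; exact (S.fib.lab_eq h)
        have h₂ := key h₁
        rw [← h₂]
        rw [← h₁] at h
        exact (hs.fib s (Sum.inr _)).1 h
    have hc0 : ∀ i, (S.base.lt (S.root c) (S.root (a i)) ↔ S.base.lt d₀ (S.root (b i))) ∧
        (S.base.lt (S.root (a i)) (S.root c) ↔ S.base.lt (S.root (b i)) d₀) := fun i =>
      hcut' [] (Nat.zero_le n) i _ ((S.mem_word_nil _ _).2 rfl) _ ((S.mem_word_nil _ _).2 rfl)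
    refine ⟨?_, ?_, fun s => ?_, ?_⟩
    · rw [hrd, S.root_idem, hd₀]
    · rw [hrd, S.root_idem]; exact hcut'
    · have h₁ := hroot hs (S.root_root c) hrd hd₀.symm hc0 s
      have h₂ := hroot hs.symm hrd (S.root_root c) hd₀
        (fun i => ⟨(hc0 i).1.symm, (hc0 i).2.symm⟩) s
      exact ⟨⟨h₁.1, h₂.1⟩, h₁.2, h₂.2⟩
    · rw [hrd, S.root_idem]
      simp [S.fib.irrefl]
  have hs₀ := (hs.mono hn).cons hB hQ hpos₀
  -- now the position of `c` in its fiber is copied to the fiber of `d₀`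
  let F : Type _ := {s : Option ι ⊕ Option ι //
    S.root (S.withRoots (adjoin (S.root c) a) s) = S.root c}
  have hF : ∀ s : F, S.root (S.withRoots (adjoin d₀ b) s.1) = d₀ := by
    rintro ⟨s, hs'⟩
    rw [S.root_withRoots] at hs' ⊢
    have := hs₀.root_eq (i := Sum.elim id id s) (j := none) (hs'.trans (S.root_root c).symm)
    exact this.trans hrd
  obtain ⟨d, hd, hdcut⟩ := S.fib.exists_corresponding
    (fun s : F => S.withRoots (adjoin (S.root c) a) s.1)
    (fun s : F => S.withRoots (adjoin d₀ b) s.1) c d₀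
    (fun s => s.2) (fun s => (hF s).trans hrd.symm) (fun s t => hs₀.fib s.1 t.1)
    (by
      intro h y hy
      have h₁ := S.single_congr hd₀ hrd (fun z hz => h z (hz.trans hrd.symm))
      rw [h₁ y hy, h₁ c rfl, S.root_idem])
  have hdr : S.root d = d₀ := hd.trans hrd
  have hall : ∀ s, (S.fib.lt c (S.withRoots (adjoin (S.root c) a) s) ↔
      S.fib.lt d (S.withRoots (adjoin d₀ b) s)) ∧
      (S.fib.lt (S.withRoots (adjoin (S.root c) a) s) c ↔
      S.fib.lt (S.withRoots (adjoin d₀ b) s) d) := by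
    intro s
    by_cases hsF : S.root (S.withRoots (adjoin (S.root c) a) s) = S.root c
    · exact hdcut ⟨s, hsF⟩
    · have hsF' : S.root (S.withRoots (adjoin d₀ b) s) ≠ S.root d := by
        intro he
        apply hsF
        rw [S.root_withRoots] at he ⊢
        have := hs₀.symm.root_eq (i := Sum.elim id id s) (j := none) (he.trans hd)
        exact this.trans (S.root_root c)
      exact ⟨iff_of_false (fun h => hsF (S.fib.lab_eq h).symm)
          (fun h => hsF' (S.fib.lab_eq h).symm),
        iff_of_false (fun h => hsF (S.fib.lab_eq h)) (fun h => hsF' (S.fib.lab_eq h))⟩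
  refine ⟨d, (hs.mono hn).cons hB hQ ⟨?_, ?_, fun s => ?_, ?_⟩⟩
  · rw [hdr, hd₀]
  · rw [hdr]; exact hcut'
  · have := hall (Sum.map some some s)
    rcases s with s | s <;> exact this
  · rw [hdr]; exact hall (Sum.inl none)

end FlowSystem

/-! ### Tame sets and tame functions -/

namespace FlowSystem

variable {X Λ : Type*} (S : FlowSystem X Λ) {ι κ : Type*}

/-- Similarity over the set `Q` of parameters. -/
def SimOver (n : ℕ) (Q : Finset X) (a b : ι → X) : Prop :=
  S.Sim n (Sum.elim a (Subtype.val : Q → X)) (Sum.elim b (Subtype.val : Q → X))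

variable {S} {n : ℕ} {Q : Finset X} {a b : ι → X}

lemma SimOver.symm (h : S.SimOver n Q a b) : S.SimOver n Q b a := Sim.symm h

lemma SimOver.mono (h : S.SimOver n Q a b) {m : ℕ} (hm : m ≤ n) {R : Finset X} (hR : R ⊆ Q) :
    S.SimOver m R a b := by
  have := (Sim.mono h hm).comp (Sum.map id (fun q : R => (⟨q.1, hR q.2⟩ : Q)))
  rwa [Sum.elim_comp_map, Sum.elim_comp_map] at this

lemma SimOver.comp (h : S.SimOver n Q a b) (e : κ → ι) : S.SimOver n Q (a ∘ e) (b ∘ e) := by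
  have := Sim.comp h (Sum.map e (id : Q → Q))
  rwa [Sum.elim_comp_map, Sum.elim_comp_map] at this

lemma SimOver.eq (h : S.SimOver n Q a b) {i j : ι} (he : a i = a j) : b i = b j :=
  Sim.eq h (i := Sum.inl i) (j := Sum.inl j) he

lemma SimOver.eq_param (h : S.SimOver n Q a b) {i : ι} {q : X} (hq : q ∈ Q) (he : a i = q) :
    b i = q :=
  Sim.eq h (i := Sum.inl i) (j := Sum.inr ⟨q, hq⟩) he

lemma SimOver.root_eq_param (h : S.SimOver n Q a b) {i : ι} {q : X} (hq : q ∈ Q)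
    (he : S.root (a i) = q) : S.root (b i) = q :=
  (Sim.eq_root h.symm.symm (i := Sum.inr ⟨q, hq⟩) (j := Sum.inl i) he.symm).symm

/-- The parameters do not separate corresponding roots. -/
lemma SimOver.sameCut_root (h : S.SimOver n Q a b) (i : ι) :
    S.base.SameCut Q (S.root (a i)) (S.root (b i)) := by
  refine Sim.sameCut h (Q := Q) (fun q hq hr => ⟨Sum.inr ⟨q, hq⟩, hr, hr⟩) (w := [])
    (Nat.zero_le n) (i := Sum.inl i) ((S.mem_word_nil _ _).2 rfl) ((S.mem_word_nil _ _).2 rfl)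

/-- The back-and-forth step over parameters. -/
lemma exists_adjoin (S : FlowSystem X Λ) (n : ℕ) (Q : Finset X) : ∃ (m : ℕ) (R : Finset X),
    ∀ {ι : Type} [Finite ι] {a b : ι → X}, S.SimOver m R a b →
      ∀ c, ∃ d, S.SimOver n Q (adjoin c a) (adjoin d b) := by
  obtain ⟨R, hQR, hR⟩ := S.exists_breaks n Q
  refine ⟨2 * n, R, fun {ι} _ {a b} h c => ?_⟩
  obtain ⟨d, hd⟩ := Sim.exists_cons h hR (fun q hq hr => ⟨Sum.inr ⟨q, hq⟩, hr, hr⟩) c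
  refine ⟨d, SimOver.mono (Q := R) ?_ le_rfl hQR⟩
  have := hd.comp (Sum.elim (fun o : Option ι => o.elim none fun i => some (Sum.inl i))
    fun q : R => some (Sum.inr q))
  have key : ∀ (c : X) (a : ι → X), adjoin c (Sum.elim a (Subtype.val : R → X)) ∘
      (Sum.elim (fun o : Option ι => o.elim none fun i => some (Sum.inl i))
        fun q : R => some (Sum.inr q)) = Sum.elim (adjoin c a) Subtype.val := by
    intro c a
    ext ((_ | i) | q) <;> rfl
  rwa [key, key] at this

variable (S)

/-- A relation is tame if it cannot distinguish tuples that are similar, for a certain number of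
steps and over certain finitely many parameters. -/
def Tame (P : (ι → X) → Prop) : Prop :=
  ∃ (n : ℕ) (Q : Finset X), ∀ a b, S.SimOver n Q a b → P a → P b

/-- A function is tame if its graph is tame. -/
def TameFn (t : (ι → X) → X) : Prop :=
  S.Tame fun o : Option ι → X => o none = t (o ∘ some)

variable {S} {P P' : (ι → X) → Prop}

lemma Tame.not (h : S.Tame P) : S.Tame fun a => ¬ P a := by
  obtain ⟨n, Q, h⟩ := h
  exact ⟨n, Q, fun a b hab ha hb => ha (h b a hab.symm hb)⟩

lemma Tame.and (h : S.Tame P) (h' : S.Tame P') : S.Tame fun a => P a ∧ P' a := by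
  classical
  obtain ⟨n, Q, h⟩ := h
  obtain ⟨n', Q', h'⟩ := h'
  exact ⟨max n n', Q ∪ Q', fun a b hab ha =>
    ⟨h a b (hab.mono (le_max_left _ _) Finset.subset_union_left) ha.1,
      h' a b (hab.mono (le_max_right _ _) Finset.subset_union_right) ha.2⟩⟩

lemma Tame.congr (h : S.Tame P) (hP : ∀ a, P' a ↔ P a) : S.Tame P' := by
  rwa [show P' = P from funext fun a => propext (hP a)]

lemma Tame.or (h : S.Tame P) (h' : S.Tame P') : S.Tame fun a => P a ∨ P' a :=
  (h.not.and h'.not).not.congr fun a => by tauto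

lemma Tame.imp (h : S.Tame P) (h' : S.Tame P') : S.Tame fun a => P a → P' a :=
  (h.not.or h').congr fun a => by tauto

lemma tame_const (p : Prop) : S.Tame fun _ : ι → X => p := ⟨0, ∅, fun _ _ _ h => h⟩

lemma Tame.exists {ι : Type} [Finite ι] {P : (Option ι → X) → Prop} (h : S.Tame P) :
    S.Tame fun a : ι → X => ∃ c, P (adjoin c a) := by
  obtain ⟨n, Q, h⟩ := h
  obtain ⟨m, R, hR⟩ := S.exists_adjoin n Q
  refine ⟨m, R, fun a b hab ⟨c, hc⟩ => ?_⟩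
  obtain ⟨d, hd⟩ := hR hab c
  exact ⟨d, h _ _ hd hc⟩

lemma Tame.reindex {P : (κ → X) → Prop} (h : S.Tame P) (e : κ → ι) :
    S.Tame fun a : ι → X => P (a ∘ e) := by
  obtain ⟨n, Q, h⟩ := h
  exact ⟨n, Q, fun a b hab => h _ _ (hab.comp e)⟩

lemma tameFn_var (i : ι) : S.TameFn fun a : ι → X => a i :=
  ⟨0, ∅, fun _ _ hab h => hab.eq (i := none) (j := some i) h⟩

lemma tameFn_const (q : X) : S.TameFn fun _ : ι → X => q :=
  ⟨0, {q}, fun _ _ hab h => hab.eq_param (i := none) (Finset.mem_singleton_self q) h⟩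

lemma TameFn.reindex {t : (κ → X) → X} (h : S.TameFn t) (e : κ → ι) :
    S.TameFn fun a : ι → X => t (a ∘ e) :=
  (Tame.reindex h fun o : Option κ => o.map e).congr fun _ => Iff.rfl

/-- Adjoining the values of a tame function to similar tuples gives similar tuples. -/
lemma TameFn.exists_adjoin {ι : Type} [Finite ι] {t : (ι → X) → X} (h : S.TameFn t) (n : ℕ)
    (Q : Finset X) : ∃ (m : ℕ) (R : Finset X), ∀ a b, S.SimOver m R a b →
      S.SimOver n Q (adjoin (t a) a) (adjoin (t b) b) := by
  classical
  obtain ⟨k, A, hA⟩ := h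
  obtain ⟨m, R, hR⟩ := S.exists_adjoin (max n k) (Q ∪ A)
  refine ⟨m, R, fun a b hab => ?_⟩
  obtain ⟨d, hd⟩ := hR hab (t a)
  obtain rfl : d = t b :=
    hA _ _ (hd.mono (le_max_right _ _) Finset.subset_union_right) rfl
  exact hd.mono (le_max_left _ _) Finset.subset_union_left

/-- Finitely many tame functions can be adjoined at once. -/
lemma exists_adjoin_family {ι : Type} [Finite ι] {N : ℕ} {t : Fin N → (ι → X) → X}
    (ht : ∀ k, S.TameFn (t k)) (n : ℕ) (Q : Finset X) :
    ∃ (m : ℕ) (R : Finset X), ∀ a b, S.SimOver m R a b →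
      S.SimOver n Q (Sum.elim a fun k => t k a) (Sum.elim b fun k => t k b) := by
  induction N generalizing n Q with
  | zero =>
    refine ⟨n, Q, fun a b hab => ?_⟩
    have := hab.comp (fun s : ι ⊕ Fin 0 => s.elim id Fin.elim0)
    have key : ∀ a : ι → X, (a ∘ fun s : ι ⊕ Fin 0 => s.elim id Fin.elim0) =
        Sum.elim a fun k => t k a := by
      intro a
      ext (i | k)
      · rfl
      · exact k.elim0
    rwa [key, key] at this
  | succ N ih =>
    obtain ⟨k, A, hA⟩ := ((ht (Fin.last N)).reindex (Sum.inl : ι → ι ⊕ Fin N)).exists_adjoin n Q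
    obtain ⟨m, R, hR⟩ := ih (fun k => ht k.castSucc) k A
    refine ⟨m, R, fun a b hab => ?_⟩
    have := (hA _ _ (hR a b hab)).comp (Sum.elim (fun i => some (Sum.inl i))
      (Fin.lastCases none fun k => some (Sum.inr k)) : ι ⊕ Fin (N + 1) → Option (ι ⊕ Fin N))
    have key : ∀ a : ι → X, adjoin (t (Fin.last N) (Sum.elim a (fun k : Fin N =>
        t k.castSucc a) ∘ Sum.inl)) (Sum.elim a fun k : Fin N => t k.castSucc a) ∘
        (Sum.elim (fun i => some (Sum.inl i))
          (Fin.lastCases none fun k => some (Sum.inr k)) : ι ⊕ Fin (N + 1) → Option (ι ⊕ Fin N)) =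
        Sum.elim a fun k => t k a := by
      intro a
      ext (i | k)
      · rfl
      · refine Fin.lastCases ?_ (fun k => ?_) k
        · simp [adjoin]
        · simp [adjoin]
    rwa [key, key] at this

lemma Tame.subst {ι : Type} [Finite ι] {N : ℕ} {P : (Fin N → X) → Prop} (h : S.Tame P)
    {t : Fin N → (ι → X) → X} (ht : ∀ k, S.TameFn (t k)) :
    S.Tame fun a : ι → X => P fun k => t k a := by
  obtain ⟨n, Q, h⟩ := h
  obtain ⟨m, R, hR⟩ := exists_adjoin_family ht n Q
  exact ⟨m, R, fun a b hab => h _ _ ((hR a b hab).comp Sum.inr)⟩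

lemma TameFn.subst {ι : Type} [Finite ι] {N : ℕ} {f : (Fin N → X) → X} (h : S.TameFn f)
    {t : Fin N → (ι → X) → X} (ht : ∀ k, S.TameFn (t k)) :
    S.TameFn fun a : ι → X => f fun k => t k a := by
  obtain ⟨n, Q, h⟩ := h
  obtain ⟨m, R, hR⟩ := exists_adjoin_family (fun k => (ht k).reindex (some : ι → Option ι)) n Q
  refine ⟨m, R, fun a b hab => ?_⟩
  have := (hR a b hab).comp (fun o : Option (Fin N) => o.elim (Sum.inl none) Sum.inr)
  exact h _ _ this

lemma tame_eq {ι : Type} [Finite ι] {t t' : (ι → X) → X} (h : S.TameFn t) (h' : S.TameFn t') :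
    S.Tame fun a => t a = t' a := by
  have : S.Tame fun a : Fin 2 → X => a 0 = a 1 := ⟨0, ∅, fun _ _ hab h => hab.eq h⟩
  exact this.subst (t := ![t, t']) (Fin.forall_fin_two.2 ⟨h, h'⟩)

/-! ### Definable sets are tame -/

open FirstOrder FirstOrder.Language in
/-- If the basic functions and relations of a structure are tame, then all definable ones are. -/
theorem tame_realize {L : FirstOrder.Language} [L.Structure X] {α : Type} [Finite α]
    (hf : ∀ (N : ℕ) (f : L.Functions N), S.TameFn (Structure.funMap f : (Fin N → X) → X))
    (hr : ∀ (N : ℕ) (r : L.Relations N), S.Tame (Structure.RelMap r : (Fin N → X) → Prop))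
    {k : ℕ} (φ : L.BoundedFormula α k) :
    S.Tame fun a : α ⊕ Fin k → X => φ.Realize (a ∘ Sum.inl) (a ∘ Sum.inr) := by
  have ht : ∀ {k : ℕ} (t : L.Term (α ⊕ Fin k)),
      S.TameFn fun a : α ⊕ Fin k → X => t.realize a := by
    intro k t
    induction t with
    | var i => exact tameFn_var i
    | func f ts ih => exact (hf _ f).subst ih
  induction φ with
  | falsum => exact tame_const False
  | equal t t' =>
    refine (tame_eq (ht t) (ht t')).congr fun a => ?_
    simp [BoundedFormula.Realize]
  | rel r ts =>
    refine ((hr _ r).subst fun i => ht (ts i)).congr fun a => ?_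
    simp [BoundedFormula.Realize]
  | imp φ ψ h h' => exact h.imp h'
  | @all k φ h =>
    have h₁ := (h.reindex (Sum.elim (fun i => some (Sum.inl i))
      (Fin.lastCases none fun j => some (Sum.inr j)) :
        α ⊕ Fin (k + 1) → Option (α ⊕ Fin k))).not.exists.not
    refine h₁.congr fun a => ?_
    rw [not_exists]
    refine forall_congr' fun c => ?_
    rw [not_not]
    refine iff_of_eq ?_
    congr 1
    ext j
    refine Fin.lastCases ?_ (fun j => ?_) j
    · simp [adjoin]
    · simp [adjoin]

/-! ### Tame subsets of lines and of fibers -/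

variable (S) in
lemma sim_refl (n : ℕ) (a : ι → X) : S.Sim n a a :=
  ⟨fun _ _ _ y hy => ⟨y, hy, rfl, fun _ => ⟨Iff.rfl, Iff.rfl⟩⟩,
    fun _ _ _ y hy => ⟨y, hy, rfl, fun _ => ⟨Iff.rfl, Iff.rfl⟩⟩, fun _ _ => Iff.rfl⟩

lemma simOver_of_samePosition {n : ℕ} {Q : Finset X} (hQ : S.Breaks n Q) {c d : X}
    (h : S.SamePosition n (Subtype.val : Q → X) Subtype.val c d) : S.SimOver n Q ![c] ![d] := by
  have := ((S.sim_refl n (Subtype.val : Q → X)).cons hQ (fun q hq hr => ⟨⟨q, hq⟩, hr, hr⟩) h).comp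
    (Sum.elim (fun _ => none) some : Fin 1 ⊕ Q → Option Q)
  have key : ∀ c : X, adjoin c (Subtype.val : Q → X) ∘
      (Sum.elim (fun _ => none) some : Fin 1 ⊕ Q → Option Q) = Sum.elim ![c] Subtype.val := by
    intro c
    ext (i | q)
    · fin_cases i; rfl
    · rfl
  rwa [key, key] at this

/-- A tame subset of the base is, on every line, a union of cuts over a finite set. -/
lemma Tame.exists_sameCut_base {P : (Fin 1 → X) → Prop} (h : S.Tame P) :
    ∃ Q : Finset X, ∀ c d, S.root c = c → S.root d = d → S.base.SameCut Q c d →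
      P ![c] → P ![d] := by
  classical
  obtain ⟨n, Q, h⟩ := h
  obtain ⟨R, hQR, hR⟩ := S.exists_breaks n Q
  have hfin := List.finite_length_le Dir n
  -- all points that are reached from the parameters in at most `n` steps
  let Q' := R.biUnion fun q => hfin.toFinset.biUnion fun w => (S.word w (S.root q)).toFinset
  have hQ' : ∀ q ∈ R, ∀ w : List Dir, w.length ≤ n → ∀ y ∈ S.word w (S.root q), y ∈ Q' := by
    intro q hq w hw y hy
    simp only [Q', Finset.mem_biUnion, Option.mem_toFinset]
    exact ⟨q, hq, w, hfin.mem_toFinset.2 hw, hy⟩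
  have hQr : ∀ q ∈ R, S.root q ∈ Q' := fun q hq =>
    hQ' q hq [] (Nat.zero_le n) _ ((S.mem_word_nil _ _).2 rfl)
  refine ⟨Q', fun c d hc hd hcd hPc => ?_⟩
  by_cases hcQ : c ∈ Q'
  · rwa [← hcd.eq_of_mem hcQ]
  have hdQ : d ∉ Q' := fun hdQ => hcQ (hcd.symm.eq_of_mem hdQ ▸ hdQ)
  have hfib : ∀ c, S.root c = c → c ∉ Q' → ∀ s,
      ¬ S.fib.lt c (S.withRoots (Subtype.val : R → X) s) ∧
      ¬ S.fib.lt (S.withRoots (Subtype.val : R → X) s) c := by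
    intro c hc hcQ s
    have hne : S.root (S.withRoots (Subtype.val : R → X) s) ≠ c := by
      rw [root_withRoots]
      exact fun he => hcQ (he ▸ hQr _ (Subtype.prop _))
    exact ⟨fun hlt => hne ((S.fib.lab_eq hlt).symm.trans hc), fun hlt => hne
      ((S.fib.lab_eq hlt).trans hc)⟩
  refine h _ _ ((simOver_of_samePosition hR ⟨?_, ?_, fun s => ?_, ?_⟩).mono le_rfl hQR) hPc
  · rw [hc, hd]; exact hcd.1
  · intro w hw q y hy y' hy'
    obtain rfl := Option.mem_unique hy hy'
    rw [hc, hd]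
    exact (hcd.2 y (hQ' _ q.2 w hw y hy)).symm
  · exact ⟨iff_of_false (hfib c hc hcQ s).1 (hfib d hd hdQ s).1,
      iff_of_false (hfib c hc hcQ s).2 (hfib d hd hdQ s).2⟩
  · rw [hc, hd]
    simp [S.fib.irrefl]

/-- A tame subset of a fiber is a union of cuts over a finite set. -/
lemma Tame.exists_sameCut_fib {P : (Fin 1 → X) → Prop} (h : S.Tame P) (p : X) :
    ∃ Q : Finset X, ∀ c d, S.root c = p → S.fib.SameCut Q c d → P ![c] → P ![d] := by
  classical
  obtain ⟨n, Q, h⟩ := h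
  obtain ⟨R, hQR, hR⟩ := S.exists_breaks n Q
  refine ⟨insert p (R ∪ R.image S.root), fun c d hc hcd hPc => ?_⟩
  have hd : S.root d = p := hcd.1.symm.trans hc
  refine h _ _ ((simOver_of_samePosition hR ⟨?_, ?_, fun s => ?_, ?_⟩).mono le_rfl hQR) hPc
  · rw [hc, hd]
  · intro w hw q y hy y' hy'
    obtain rfl := Option.mem_unique hy hy'
    rw [hc, hd]
    exact ⟨Iff.rfl, Iff.rfl⟩
  · have hs : S.withRoots (Subtype.val : R → X) s ∈ insert p (R ∪ R.image S.root) := by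
      refine Finset.mem_insert_of_mem (Finset.mem_union.2 ?_)
      rcases s with s | s
      · exact Or.inl s.2
      · exact Or.inr (Finset.mem_image_of_mem _ s.2)
    exact (hcd.2 _ hs).symm
  · rw [hc, hd]
    exact (hcd.2 p (Finset.mem_insert_self _ _)).symm

end FlowSystem

/-- A subset of a line that is a union of cuts over a finite set is a finite union of points and of
intervals; `bot` and `top` are formal endpoints. -/
lemma LineSystem.isFiniteUnion {X Λ : Type*} (S : LineSystem X Λ) (l : Λ) (Q : Finset X)
    (Y : Set X) (hYl : ∀ y ∈ Y, S.lab y = l)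
    (hY : ∀ c d, S.SameCut Q c d → c ∈ Y → d ∈ Y) (Ioo : X → X → Set X) (bot top : X)
    (A B : Set X) (hA : ∀ x, S.lab x = l → x ∈ A) (hB : ∀ x, S.lab x = l → x ∈ B)
    (hbot : bot ∈ A) (htop : top ∈ B)
    (h₁ : ∀ a b, S.lab a = l → S.lab b = l → ∀ z, z ∈ Ioo a b ↔ S.lt a z ∧ S.lt z b)
    (h₂ : ∀ a, S.lab a = l → ∀ z, z ∈ Ioo a top ↔ S.lt a z)
    (h₃ : ∀ b, S.lab b = l → ∀ z, z ∈ Ioo bot b ↔ S.lt z b)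
    (h₄ : ∀ z, z ∈ Ioo bot top ↔ S.lab z = l) :
    DulacConfig.IsFiniteUnion Ioo A B Y := by
  classical
  set R := Q.filter fun q => S.lab q = l with hR
  have hRl : ∀ q ∈ R, S.lab q = l := fun q hq => (Finset.mem_filter.1 hq).2
  refine ⟨R.filter (· ∈ Y), ((insert bot R) ×ˢ (insert top R)).filter fun p => Ioo p.1 p.2 ⊆ Y,
    ?_, ?_⟩
  · rintro ⟨a, b⟩ hab
    simp only [Finset.mem_filter, Finset.mem_product, Finset.mem_insert] at hab
    obtain ⟨⟨ha, hb⟩, -⟩ := hab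
    refine ⟨?_, ?_⟩
    · rcases ha with rfl | ha
      exacts [hbot, hA _ (hRl _ ha)]
    · rcases hb with rfl | hb
      exacts [htop, hB _ (hRl _ hb)]
  · refine Set.Subset.antisymm (fun y hy => ?_) ?_
    swap
    · refine Set.union_subset (fun y hy => (Finset.mem_filter.1 hy).2) ?_
      simp only [Set.iUnion_subset_iff]
      exact fun p hp => (Finset.mem_filter.1 hp).2
    by_cases hyR : y ∈ R
    · exact Or.inl (Finset.mem_coe.2 (Finset.mem_filter.2 ⟨hyR, hy⟩))
    right
    -- the interval between the neighbours of `y` in `R`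
    have hyl := hYl y hy
    have hlow : ∃ a ∈ insert bot R, (∀ b ∈ insert top R, (b = top ∨ S.lt y b) → y ∈ Ioo a b) ∧
        ∀ b, (b = top ∨ S.lab b = l) → ∀ z ∈ Ioo a b, ∀ q ∈ R, S.lt q y → S.lt q z := by
      by_cases hne : (R.filter fun q => S.lt q y).Nonempty
      · obtain ⟨m, hm, hmax⟩ := S.exists_max
          (fun q hq => hRl q (Finset.mem_filter.1 hq).1) hne
        obtain ⟨hmR, hmy⟩ := Finset.mem_filter.1 hm
        have hml := hRl m hmR
        refine ⟨m, Finset.mem_insert_of_mem hmR, fun b hb hb' => ?_, fun b hb z hz q hq hqy => ?_⟩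
        · rcases hb' with rfl | hb'
          · exact (h₂ m hml y).2 hmy
          · exact (h₁ m b hml ((S.lab_eq hb').symm.trans hyl) y).2 ⟨hmy, hb'⟩
        · have hmz : S.lt m z := by
            rcases hb with rfl | hb
            exacts [(h₂ m hml z).1 hz, ((h₁ m b hml hb z).1 hz).1]
          rcases hmax q (Finset.mem_filter.2 ⟨hq, hqy⟩) with rfl | h
          exacts [hmz, S.trans h hmz]
      · refine ⟨bot, Finset.mem_insert_self _ _, fun b hb hb' => ?_, fun b hb z hz q hq hqy => ?_⟩
        · rcases hb' with rfl | hb'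
          · exact (h₄ y).2 hyl
          · exact (h₃ b ((S.lab_eq hb').symm.trans hyl) y).2 hb'
        · exact absurd ⟨q, Finset.mem_filter.2 ⟨hq, hqy⟩⟩ hne
    obtain ⟨a, haR, ha, ha'⟩ := hlow
    have hup : ∃ b ∈ insert top R, (b = top ∨ S.lt y b) ∧
        ∀ z ∈ Ioo a b, ∀ q ∈ R, S.lt y q → S.lt z q := by
      by_cases hne : (R.filter fun q => S.lt y q).Nonempty
      · obtain ⟨m, hm, hmin⟩ := S.flip.exists_max
          (fun q hq => hRl q (Finset.mem_filter.1 hq).1) hne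
        obtain ⟨hmR, hmy⟩ := Finset.mem_filter.1 hm
        have hml := hRl m hmR
        refine ⟨m, Finset.mem_insert_of_mem hmR, Or.inr hmy, fun z hz q hq hqy => ?_⟩
        have hzm : S.lt z m := by
          rcases Finset.mem_insert.1 haR with rfl | haR
          exacts [(h₃ m hml z).1 hz, ((h₁ a m (hRl a haR) hml z).1 hz).2]
        rcases hmin q (Finset.mem_filter.2 ⟨hq, hqy⟩) with rfl | h
        exacts [hzm, S.trans hzm h]
      · exact ⟨top, Finset.mem_insert_self _ _, Or.inl rfl, fun z hz q hq hqy =>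
          absurd ⟨q, Finset.mem_filter.2 ⟨hq, hqy⟩⟩ hne⟩
    obtain ⟨b, hbR, hb, hb'⟩ := hup
    have hbl : b = top ∨ S.lab b = l := (Finset.mem_insert.1 hbR).imp_right (hRl b)
    have hzl : ∀ z ∈ Ioo a b, S.lab z = l := by
      intro z hz
      rcases Finset.mem_insert.1 haR with rfl | haR
      · rcases hbl with rfl | hbl
        · exact (h₄ z).1 hz
        · exact (S.lab_eq ((h₃ b hbl z).1 hz)).trans hbl
      · have hal := hRl a haR
        rcases hbl with rfl | hbl
        · exact (S.lab_eq ((h₂ a hal z).1 hz)).symm.trans hal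
        · exact (S.lab_eq ((h₁ a b hal hbl z).1 hz).2).trans hbl
    simp only [Set.mem_iUnion]
    refine ⟨(a, b), Finset.mem_filter.2 ⟨Finset.mem_product.2 ⟨haR, hbR⟩, fun z hz => ?_⟩,
      ha b hbR hb⟩
    have hzl' := hzl z hz
    refine hY y z ⟨hyl.trans hzl'.symm, fun q hq => ?_⟩ hy
    by_cases hql : S.lab q = l
    · have hqR : q ∈ R := Finset.mem_filter.2 ⟨hq, hql⟩
      rcases S.tri (hql.trans hyl.symm) with h | h | h
      · have h' := ha' b hbl z hz q hqR h
        exact ⟨iff_of_true h h', iff_of_false (S.asymm h) (S.asymm h')⟩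
      · exact absurd (h ▸ hqR) hyR
      · have h' := hb' z hz q hqR h
        exact ⟨iff_of_false (S.asymm h) (S.asymm h'), iff_of_true h h'⟩
    · exact ⟨iff_of_false (fun h => hql ((S.lab_eq h).trans hyl))
          (fun h => hql ((S.lab_eq h).trans hzl')),
        iff_of_false (fun h => hql ((S.lab_eq h).symm.trans hyl))
          (fun h => hql ((S.lab_eq h).symm.trans hzl'))⟩

/-! ### The axioms, read in a model -/

namespace DulacConfig

variable {Ψ : DulacConfig.{u}} {M : Type v} [Ψ.lang.Structure M]

lemma realize_univClosure (φ : Ψ.Fm) : M ⊨ univClosure φ ↔ ∀ v : Var → M, φ.Realize v := by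
  simp [univClosure, Sentence.Realize, Formula.realize_iAlls, Formula.realize_relabel,
    Function.comp_def]

lemma realize_allv (i : Var) (φ : Ψ.Fm) (v : Var → M) :
    (allv i φ).Realize v ↔ ∀ m : M, φ.Realize (Function.update v i m) := by
  have key : ∀ w : Unit → M, (fun j : Var => Sum.elim v w
      (if j = i then Sum.inr () else Sum.inl j)) = Function.update v i (w ()) := by
    intro w
    ext j
    by_cases h : j = i
    · subst h; simp
    · simp [h]
  simp only [allv, Formula.realize_iAlls, Formula.realize_relabel, Function.comp_def, key]
  exact ⟨fun h m => h fun _ => m, fun h w => h _⟩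

lemma realize_exv (i : Var) (φ : Ψ.Fm) (v : Var → M) :
    (exv i φ).Realize v ↔ ∃ m : M, φ.Realize (Function.update v i m) := by
  have key : ∀ w : Unit → M, (fun j : Var => Sum.elim v w
      (if j = i then Sum.inr () else Sum.inl j)) = Function.update v i (w ()) := by
    intro w
    ext j
    by_cases h : j = i
    · subst h; simp
    · simp [h]
  simp only [exv, Formula.realize_iExs, Formula.realize_relabel, Function.comp_def, key]
  exact ⟨fun ⟨w, h⟩ => ⟨_, h⟩, fun ⟨m, h⟩ => ⟨fun _ => m, h⟩⟩

lemma realize_cst (c : Func Ψ 0) (v : Var → M) : (cst c).realize v = Ψ.Cst M c := by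
  exact (Term.realize_constants (L := Ψ.lang)).trans
    (congrArg (Structure.funMap (L := Ψ.lang) c) (Subsingleton.elim _ _))

lemma realize_pr (g : Dir) (t : Ψ.Tm) (v : Var → M) :
    (pr g t).realize v = Ψ.Pr M g (t.realize v) := by
  exact Term.realize_functions_apply₁ (L := Ψ.lang)

lemma realize_prIter (g : Dir) (m : ℕ) (t : Ψ.Tm) (v : Var → M) :
    (prIter g m t).realize v = (Ψ.Pr M g)^[m] (t.realize v) := by
  induction m with
  | zero => rfl
  | succ m ih =>
    rw [prIter, Function.iterate_succ_apply', Function.iterate_succ_apply', realize_pr,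
      ← prIter, ih]

lemma realize_inCell (C : Ψ.Cell) (t : Ψ.Tm) (v : Var → M) :
    (inCell C t).Realize v ↔ t.realize v ∈ Ψ.CellSet M C := by
  exact Formula.realize_rel₁ (L := Ψ.lang)

lemma realize_inSec (C : Ψ.Opn) (t : Ψ.Tm) (v : Var → M) :
    (inSec C t).Realize v ↔ t.realize v ∈ Ψ.SecSet M C := by
  exact Formula.realize_rel₁ (L := Ψ.lang)

lemma realize_ltF (C : Ψ.Cell) (t₁ t₂ : Ψ.Tm) (v : Var → M) :
    (ltF C t₁ t₂).Realize v ↔ Ψ.Lt M C (t₁.realize v) (t₂.realize v) := by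
  exact Formula.realize_rel₂ (L := Ψ.lang)

lemma realize_eqF (t₁ t₂ : Ψ.Tm) (v : Var → M) :
    (eqF t₁ t₂).Realize v ↔ t₁.realize v = t₂.realize v := by
  simp [eqF, Formula.realize_equal]

lemma realize_iff (φ ψ : Ψ.Fm) (v : Var → M) :
    Formula.Realize (φ.iff ψ) v ↔ (φ.Realize v ↔ ψ.Realize v) :=
  Formula.realize_iff

/-- The underlying set of a transverse cell or of a set `E_C`. -/
def OneSet (Ψ : DulacConfig.{u}) (M : Type v) [Ψ.lang.Structure M] : Ψ.Cell₁ → Set M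
  | .trans C => Ψ.CellSet M (.trans C)
  | .sec C => Ψ.SecSet M C

lemma realize_inOne (C : Ψ.Cell₁) (t : Ψ.Tm) (v : Var → M) :
    (inOne C t).Realize v ↔ t.realize v ∈ Ψ.OneSet M C := by
  cases C
  · exact realize_inCell _ _ _
  · exact realize_inSec _ _ _

/-- The element `min(C)`. -/
abbrev Min (Ψ : DulacConfig.{u}) (M : Type v) [Ψ.lang.Structure M] (C : Ψ.Cell) : M :=
  Ψ.Cst M (endFunc (Ψ.min C))

/-- The element `max(C)`. -/
abbrev Max (Ψ : DulacConfig.{u}) (M : Type v) [Ψ.lang.Structure M] (C : Ψ.Cell) : M :=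
  Ψ.Cst M (endFunc (Ψ.max C))

/-- The set `C ∪ {min(C), max(C)}`. -/
def OneBar (Ψ : DulacConfig.{u}) (M : Type v) [Ψ.lang.Structure M] (C : Ψ.Cell₁) : Set M :=
  {x | (x ∈ Ψ.OneSet M C ∨ x = Ψ.Min M C.cell) ∨ x = Ψ.Max M C.cell}

/-- The ordering of `C ∪ {min(C), max(C)}`. -/
def OneLt (Ψ : DulacConfig.{u}) (M : Type v) [Ψ.lang.Structure M] (C : Ψ.Cell₁) (x y : M) : Prop :=
  (x ∈ Ψ.OneBar M C ∧ y ∈ Ψ.OneBar M C) ∧ Ψ.Lt M C.cell x y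

lemma realize_inBar (C : Ψ.Cell₁) (t : Ψ.Tm) (v : Var → M) :
    (inBar C t).Realize v ↔ t.realize v ∈ Ψ.OneBar M C := by
  simp [inBar, OneBar, realize_inOne, realize_eqF, minT, maxT, realize_cst]

lemma realize_ltOne (C : Ψ.Cell₁) (t₁ t₂ : Ψ.Tm) (v : Var → M) :
    (ltOne C t₁ t₂).Realize v ↔ Ψ.OneLt M C (t₁.realize v) (t₂.realize v) := by
  simp only [ltOne, OneLt, Formula.realize_inf, realize_inBar, realize_ltF]

/-- `y ∈ C` lies between `x` and `z`. -/
def Btw (Ψ : DulacConfig.{u}) (M : Type v) [Ψ.lang.Structure M] (C : Ψ.Cell₁) (x y z : M) : Prop :=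
  (y ∈ Ψ.OneSet M C ∧ Ψ.OneLt M C x y) ∧ Ψ.OneLt M C y z

lemma realize_btw (C : Ψ.Cell₁) (t₁ t₂ t₃ : Ψ.Tm) (v : Var → M) :
    (btw C t₁ t₂ t₃).Realize v ↔
      Ψ.Btw M C (t₁.realize v) (t₂.realize v) (t₃.realize v) := by
  simp only [btw, Btw, Formula.realize_inf, realize_inOne, realize_ltOne]

/-- The interpretation of the new relation symbols. -/
def NewRel.Holds (M : Type v) [Ψ.lang.Structure M] : NewRel Ψ → M → M → Prop
  | .R C, x, y => Structure.RelMap (L := Ψ.lang) (Rel.R C) ![x, y]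
  | .S g m C, x, y => Structure.RelMap (L := Ψ.lang) (Rel.S g m C) ![x, y]
  | .B g m C, x, y => Structure.RelMap (L := Ψ.lang) (Rel.B g m C) ![x, y]

lemma realize_holds (G : NewRel Ψ) (t₁ t₂ : Ψ.Tm) (v : Var → M) :
    (G.holds t₁ t₂).Realize v ↔ G.Holds M (t₁.realize v) (t₂.realize v) := by
  cases G <;> exact Formula.realize_rel₂ (L := Ψ.lang)

/-- The property of points that belongs to a new relation symbol. -/
def NewRel.Property (M : Type v) [Ψ.lang.Structure M] : NewRel Ψ → M → Prop
  | .R C, x => x ∈ Ψ.OneSet M C ∧ (Ψ.Pr M .fwd)^[Ψ.N] x = x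
  | .S g m C, x => (x ∈ Ψ.OneSet M C ∧ (Ψ.Pr M g)^[m] x ∈ Ψ.OneSet M C) ∧
      Ψ.OneLt M C ((Ψ.Pr M g)^[m] x) x
  | .B g m C, x => (x ∈ Ψ.OneSet M C ∧ (Ψ.Pr M g)^[m] x ∈ Ψ.OneSet M C) ∧
      Ψ.OneLt M C x ((Ψ.Pr M g)^[m] x)

lemma realize_prop (G : NewRel Ψ) (t : Ψ.Tm) (v : Var → M) :
    (G.prop t).Realize v ↔ G.Property M (t.realize v) := by
  cases G <;> simp only [NewRel.prop, NewRel.Property, isFix, isSmaller, isBigger,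
    Formula.realize_inf, realize_inOne, realize_ltOne, realize_eqF, realize_prIter]

/-- `x` is a boundary point of the set of points of `C` that `f^N` fixes, and belongs to it. -/
def FixBd (Ψ : DulacConfig.{u}) (M : Type v) [Ψ.lang.Structure M] (C : Ψ.Cell₁) (x : M) : Prop :=
  (x ∈ Ψ.OneSet M C ∧ (Ψ.Pr M .fwd)^[Ψ.N] x = x) ∧ ∀ y z, Ψ.OneLt M C y x ∧ Ψ.OneLt M C x z →
    ∃ w, Ψ.Btw M C y w z ∧ ¬ (w ∈ Ψ.OneSet M C ∧ (Ψ.Pr M .fwd)^[Ψ.N] w = w)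

lemma realize_isFixBd (C : Ψ.Cell₁) (i : Var) (hi : i ≠ 3 ∧ i ≠ 4 ∧ i ≠ 5) (v : Var → M) :
    (isFixBd C (vr i)).Realize v ↔ Ψ.FixBd M C (v i) := by
  simp only [isFixBd, isFix, FixBd, Formula.realize_inf, Formula.realize_imp,
    Formula.realize_not, realize_allv, realize_exv, realize_inOne, realize_ltOne, realize_btw,
    realize_eqF, realize_prIter, Term.realize_var, Function.update_apply, hi, Fin.isValue,
    Fin.reduceEq, ↓reduceIte]

/-- On the set of all `x` with `P x`, the relation `lt` is a dense linear order without endpoints. -/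
structure IsDenseOrder (lt : M → M → Prop) (P : M → Prop) : Prop where
  irrefl : ∀ x, P x → ¬ lt x x
  trans : ∀ x y z, P x → P y → P z → lt x y → lt y z → lt x z
  tri : ∀ x y, P x → P y → lt x y ∨ x = y ∨ lt y x
  dense : ∀ x y, P x → P y → lt x y → ∃ z, P z ∧ lt x z ∧ lt z y
  ends : ∀ x, P x → (∃ y, P y ∧ lt y x) ∧ ∃ y, P y ∧ lt x y

lemma isDenseOrder_of_realize (C : Ψ.Cell) {P : Ψ.Tm → Ψ.Fm} {Q : M → Prop} {v : Var → M}
    (hP : ∀ i : Var, i ∈ ({3, 4, 5} : Finset Var) → ∀ w : Var → M,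
      (∀ j, j ∉ ({3, 4, 5} : Finset Var) → w j = v j) →
      ((P (vr i)).Realize w ↔ Q (w i)))
    (h : (denseOrder C P).Realize v) : IsDenseOrder (Ψ.Lt M C) Q := by
  have hP3 := hP 3 (by decide)
  have hP4 := hP 4 (by decide)
  have hP5 := hP 5 (by decide)
  simp only [denseOrder, Formula.realize_inf] at h
  obtain ⟨⟨⟨⟨h₁, h₂⟩, h₃⟩, h₄⟩, h₅⟩ := h
  have hv : ∀ x y z j, j ∉ ({3, 4, 5} : Finset Var) →
      Function.update (Function.update (Function.update v 3 x) 4 y) 5 z j = v j := by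
    intro x y z j hj
    simp only [Finset.mem_insert, Finset.mem_singleton, not_or] at hj
    simp [hj]
  have hv2 : ∀ x y j, j ∉ ({3, 4, 5} : Finset Var) →
      Function.update (Function.update v 3 x) 4 y j = v j := by
    intro x y j hj
    simp only [Finset.mem_insert, Finset.mem_singleton, not_or] at hj
    simp [hj]
  have hv1 : ∀ x j, j ∉ ({3, 4, 5} : Finset Var) → Function.update v 3 x j = v j := by
    intro x j hj
    simp only [Finset.mem_insert, Finset.mem_singleton, not_or] at hj
    simp [hj]
  simp only [realize_allv, Formula.realize_imp, Formula.realize_inf, Formula.realize_not,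
    Formula.realize_sup, realize_exv, realize_ltF, realize_eqF, Term.realize_var,
    hP3 _ (hv1 _), hP3 _ (hv2 _ _), hP4 _ (hv2 _ _), hP3 _ (hv _ _ _), hP4 _ (hv _ _ _),
    hP5 _ (hv _ _ _), Function.update_apply, Fin.isValue, Fin.reduceEq, ↓reduceIte] at h₁ h₂ h₃ h₄ h₅
  refine ⟨h₁, fun x y z hx hy hz h h' => h₂ x y z ⟨⟨⟨⟨hx, hy⟩, hz⟩, h⟩, h'⟩,
    fun x y hx hy => ?_, fun x y hx hy h => ?_, h₅⟩
  · exact or_assoc.1 (h₃ x y ⟨hx, hy⟩)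
  · obtain ⟨z, hz, h'⟩ := h₄ x y ⟨⟨hx, hy⟩, h⟩
    exact ⟨z, hz.1, hz.2, h'⟩

/-- `Next C g x y`: the point `x` of `C ∖ E_C` has `y` as its neighbour in `E_C` in direction `g`. -/
def Next (Ψ : DulacConfig.{u}) (M : Type v) [Ψ.lang.Structure M] (C : Ψ.Opn) :
    Dir → M → M → Prop
  | .fwd, x, y => (((x ∈ Ψ.CellSet M (.opn C) ∧ x ∉ Ψ.SecSet M C) ∧ y ∈ Ψ.SecSet M C) ∧
      Ψ.Lt M (.opn C) x y) ∧
      ¬ ∃ z, (z ∈ Ψ.SecSet M C ∧ Ψ.Lt M (.opn C) x z) ∧ Ψ.Lt M (.opn C) z y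
  | .bwd, x, y => (((x ∈ Ψ.CellSet M (.opn C) ∧ x ∉ Ψ.SecSet M C) ∧ y ∈ Ψ.SecSet M C) ∧
      Ψ.Lt M (.opn C) y x) ∧
      ¬ ∃ z, (z ∈ Ψ.SecSet M C ∧ Ψ.Lt M (.opn C) y z) ∧ Ψ.Lt M (.opn C) z x

lemma realize_nextTo (C : Ψ.Opn) (g : Dir) (i j : Var) (hi : i ≠ 7) (hj : j ≠ 7) (v : Var → M) :
    (nextTo C g (vr i) (vr j)).Realize v ↔ Ψ.Next M C g (v i) (v j) := by
  cases g <;>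
  simp only [nextTo, Next, Formula.realize_inf, Formula.realize_not, realize_exv, realize_inCell,
    realize_inSec, realize_ltF, Term.realize_var, Function.update_apply, hi, hj, ↓reduceIte]

/-- The fiber of `C` over `y`. -/
def InFiber (Ψ : DulacConfig.{u}) (M : Type v) [Ψ.lang.Structure M] (C : Ψ.Opn) (x y : M) : Prop :=
  (Ψ.Next M C .bwd x y ∨ Ψ.Next M C .fwd x y) ∨ x = y

lemma realize_axiom (hM : M ⊨ Ψ.theory) {φ : Ψ.Fm} (h : FlowAxiom φ ∨ DulacAxiom φ)
    (v : Var → M) : φ.Realize v :=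
  (realize_univClosure φ).1 (hM.realize_of_mem _ ⟨φ, h, rfl⟩) v

lemma realize_iSup {β : Type*} [Finite β] (f : β → Ψ.Fm) (v : Var → M) :
    (Formula.iSup f).Realize v ↔ ∃ b, (f b).Realize v := by
  simp [Formula.realize_iSup]

/-- The axioms of the theory that are used, as properties of a structure. -/
structure IsModel (Ψ : DulacConfig.{u}) (M : Type v) [Ψ.lang.Structure M] : Prop where
  single_not_cell : ∀ c C, Ψ.Cst M (.single c) ∉ Ψ.CellSet M C
  infty_not_cell : ∀ C, Ψ.Cst M .infty ∉ Ψ.CellSet M C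
  cover : ∀ x : M, (x = Ψ.Cst M .infty ∨ ∃ c, x = Ψ.Cst M (.single c)) ∨ ∃ C, x ∈ Ψ.CellSet M C
  disjoint : ∀ C D, C ≠ D → ∀ x : M, x ∈ Ψ.CellSet M C → x ∉ Ψ.CellSet M D
  order : ∀ C, IsDenseOrder (Ψ.Lt M C) (· ∈ Ψ.CellSet M C)
  order_ends : ∀ C, ∀ x ∈ Ψ.CellSet M C, Ψ.Lt M C x (Ψ.Max M C) ∧ Ψ.Lt M C (Ψ.Min M C) x
  order_domain : ∀ C, ∀ x y : M, Ψ.Lt M C x y →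
    ((x ∈ Ψ.CellSet M C ∧ y ∈ Ψ.CellSet M C) ∨ (x = Ψ.Min M C ∧ y ∈ Ψ.CellSet M C)) ∨
      (x ∈ Ψ.CellSet M C ∧ y = Ψ.Max M C)
  base_tan : ∀ C, Ψ.Cst M (.e C) ∈ Ψ.CellSet M (.tan C)
  base_sec : ∀ C, ∀ x ∈ Ψ.SecSet M C, x ∈ Ψ.CellSet M (.opn C)
  sec_order : ∀ C, IsDenseOrder (Ψ.Lt M (.opn C)) (· ∈ Ψ.SecSet M C)
  prog_single_inv : ∀ g c, Ψ.Pr M g (Ψ.Cst M (.single c)) ≠ Ψ.Cst M .infty →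
    Ψ.Pr M g.opp (Ψ.Pr M g (Ψ.Cst M (.single c))) = Ψ.Cst M (.single c)
  prog_opn : ∀ g C, ∀ x : M, Ψ.Pr M g x ∈ Ψ.CellSet M (.opn C) → Ψ.Pr M g x ∈ Ψ.SecSet M C
  prog_tan : ∀ g C, ∀ x : M, Ψ.Pr M g x ∈ Ψ.CellSet M (.tan C) → Ψ.Pr M g x = Ψ.Cst M (.e C)
  tan_fwd : ∀ C, ∀ x ∈ Ψ.CellSet M (.tan C),
    (Ψ.Lt M (.tan C) (Ψ.Cst M (.e C)) x ∨ Ψ.Cst M (.e C) = x →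
      Ψ.Pr M .fwd x = Ψ.Pr M .fwd (Ψ.Cst M (.e C))) ∧
    (Ψ.Lt M (.tan C) x (Ψ.Cst M (.e C)) → Ψ.Pr M .fwd x = Ψ.Cst M (.e C))
  tan_bwd : ∀ C, ∀ x ∈ Ψ.CellSet M (.tan C),
    (Ψ.Lt M (.tan C) x (Ψ.Cst M (.e C)) ∨ x = Ψ.Cst M (.e C) →
      Ψ.Pr M .bwd x = Ψ.Pr M .bwd (Ψ.Cst M (.e C))) ∧
    (Ψ.Lt M (.tan C) (Ψ.Cst M (.e C)) x → Ψ.Pr M .bwd x = Ψ.Cst M (.e C))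
  sec_inj : ∀ g C, ∀ x ∈ Ψ.SecSet M C, ∀ y ∈ Ψ.SecSet M C, Ψ.Pr M g x = Ψ.Pr M g y →
    Ψ.Pr M g x = Ψ.Cst M .infty ∨ x = y
  single_next : ∀ g c C, Ψ.singleNext g c = Sum.inl C →
    Ψ.Pr M g (Ψ.Cst M (.single c)) ∈ Ψ.SecSet M C
  trans_maps : ∀ g C, ∀ x ∈ Ψ.CellSet M (.trans C), Ψ.Pr M g x ∈ Ψ.SecSet M (Ψ.transNext g C)
  trans_mono : ∀ g C, ∀ x ∈ Ψ.CellSet M (.trans C), ∀ y ∈ Ψ.CellSet M (.trans C),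
    (Ψ.Lt M (.trans C) x y ↔ Ψ.Lt M (.opn (Ψ.transNext g C)) (Ψ.Pr M g x) (Ψ.Pr M g y))
  trans_convex : ∀ g C, ∀ x ∈ Ψ.CellSet M (.trans C), ∀ y ∈ Ψ.CellSet M (.trans C),
    ∀ z ∈ Ψ.SecSet M (Ψ.transNext g C), Ψ.Lt M (.opn (Ψ.transNext g C)) (Ψ.Pr M g x) z →
      Ψ.Lt M (.opn (Ψ.transNext g C)) z (Ψ.Pr M g y) →
      ∃ w ∈ Ψ.CellSet M (.trans C), Ψ.Pr M g w = z
  trans_inv : ∀ g C, ∀ x ∈ Ψ.CellSet M (.trans C), Ψ.Pr M g.opp (Ψ.Pr M g x) = x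
  sec_next : ∀ g C, ∀ x ∈ Ψ.SecSet M C, (Ψ.Pr M g x = Ψ.Cst M .infty ∨
    ∃ D, Ψ.transNext g.opp D = C ∧ Ψ.Pr M g x ∈ Ψ.CellSet M (.trans D)) ∨
    ∃ d, Ψ.singleNext g.opp d = Sum.inl C ∧ Ψ.Pr M g x = Ψ.Cst M (.single d)
  adj_exists : ∀ C, ∀ x ∈ Ψ.CellSet M (.opn C), x ∉ Ψ.SecSet M C →
    ∃ y, Ψ.Next M C .fwd x y ∨ Ψ.Next M C .bwd x y
  fiber_order : ∀ C, ∀ y ∈ Ψ.SecSet M C,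
    IsDenseOrder (Ψ.Lt M (.opn C)) fun x => Ψ.InFiber M C x y
  fiber_prog_to : ∀ C g, ∀ x z : M, Ψ.Next M C g x z → Ψ.Pr M g x = z
  fiber_prog_from : ∀ C g, ∀ x z : M, Ψ.Next M C g.opp x z → Ψ.Pr M g x = Ψ.Pr M g z
  lower_mem : ∀ g C, Ψ.Cst M (.lower g C) ∈ Ψ.OneBar M (.sec (Ψ.transNext g C))
  upper_mem : ∀ g C, Ψ.Cst M (.upper g C) ∈ Ψ.OneBar M (.sec (Ψ.transNext g C))
  lower_upper : ∀ g C, ∀ x ∈ Ψ.SecSet M (Ψ.transNext g C),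
    (Ψ.Pr M g.opp x ∈ Ψ.CellSet M (.trans C) ↔
      Ψ.Lt M (.opn (Ψ.transNext g C)) (Ψ.Cst M (.lower g C)) x ∧
      Ψ.Lt M (.opn (Ψ.transNext g C)) x (Ψ.Cst M (.upper g C)))
  rel_def : ∀ (G : NewRel Ψ) (x y : M), G.Holds M x y ↔
    (∃ z, Ψ.Btw M G.dom x z y ∧ G.Property M z) ∨ (x = y ∧ G.Property M x)
  uniform_S : ∀ C g m, 0 < m → ∀ x y : M, (NewRel.S g m C).Holds M x y →
    (∀ z, Ψ.Btw M C x z y → (Ψ.Pr M g)^[m] z ∈ Ψ.OneSet M C) →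
    (∀ z, Ψ.Btw M C x z y → ¬ Ψ.FixBd M C z) →
    ∀ z, Ψ.Btw M C x z y → (NewRel.S g m C).Holds M z z
  uniform_B : ∀ C g m, 0 < m → ∀ x y : M, (NewRel.B g m C).Holds M x y →
    (∀ z, Ψ.Btw M C x z y → (Ψ.Pr M g)^[m] z ∈ Ψ.OneSet M C) →
    (∀ z, Ψ.Btw M C x z y → ¬ Ψ.FixBd M C z) →
    ∀ z, Ψ.Btw M C x z y → (NewRel.B g m C).Holds M z z
  fixBd_gamma : ∀ C, ∀ x : M, Ψ.FixBd M C x → ∃ j, x = Ψ.Cst M (.gamma C j)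

/-- A valuation of the variables `0, 1, 2`; the values of the others do not matter, as they occur
only bound. -/
def val (x y z : M) : Var → M := ![x, y, z, x, x, x, x, x]

@[simp] lemma val_zero (x y z : M) : val x y z 0 = x := rfl
@[simp] lemma val_one (x y z : M) : val x y z 1 = y := rfl
@[simp] lemma val_two (x y z : M) : val x y z 2 = z := rfl

theorem isModel (hM : M ⊨ Ψ.theory) : IsModel Ψ M := by
  have F : ∀ {φ : Ψ.Fm}, FlowAxiom φ → ∀ x y z : M, φ.Realize (val x y z) :=
    fun h x y z => realize_axiom hM (Or.inl h) _
  have D : ∀ {φ : Ψ.Fm}, DulacAxiom φ → ∀ x y z : M, φ.Realize (val x y z) :=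
    fun h x y z => realize_axiom hM (Or.inr h) _
  have s₀ : M := Ψ.Cst M .infty
  constructor
  case single_not_cell =>
    intro c C
    simpa only [Formula.realize_not, realize_inCell, realize_cst]
      using F (.single_not_cell c C) s₀ s₀ s₀
  case infty_not_cell =>
    intro C
    simpa only [Formula.realize_not, realize_inCell, realize_cst]
      using F (.infty_not_cell C) s₀ s₀ s₀
  case cover =>
    intro x
    simpa only [Formula.realize_sup, realize_iSup, realize_inCell, realize_eqF, realize_cst,
      Term.realize_var, val_zero] using F .cover x x x
  case disjoint =>
    intro C C' h x
    simpa only [Formula.realize_imp, Formula.realize_not, realize_inCell, Term.realize_var,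
      val_zero] using F (.disjoint C C' h) x x x
  case order =>
    intro C
    refine isDenseOrder_of_realize C (v := val s₀ s₀ s₀) ?_ (F (.order C) s₀ s₀ s₀)
    intro i _ w _
    rw [realize_inCell, Term.realize_var]
  case order_ends =>
    intro C x
    simpa only [Formula.realize_imp, Formula.realize_inf, realize_inCell, realize_ltF, minT, maxT,
      realize_cst, Term.realize_var, val_zero] using F (.order_ends C) x x x
  case order_domain =>
    intro C x y
    simpa only [Formula.realize_imp, Formula.realize_inf, Formula.realize_sup, realize_inCell,
      realize_ltF, realize_eqF, minT, maxT, realize_cst, Term.realize_var, val_zero, val_one]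
      using F (.order_domain C) x y x
  case base_tan =>
    intro C
    simpa only [realize_inCell, realize_cst] using F (.base_tan C) s₀ s₀ s₀
  case base_sec =>
    intro C x
    simpa only [Formula.realize_imp, realize_inCell, realize_inSec, Term.realize_var, val_zero]
      using F (.base_sec C) x x x
  case sec_order =>
    intro C
    refine isDenseOrder_of_realize _ (v := val s₀ s₀ s₀) ?_ (F (.sec_order C) s₀ s₀ s₀)
    intro i _ w _
    rw [realize_inSec, Term.realize_var]
  case prog_single_inv =>
    intro g c
    simpa only [Formula.realize_imp, Formula.realize_not, realize_eqF, realize_pr, realize_cst]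
      using F (.prog_single_inv g c) s₀ s₀ s₀
  case prog_opn =>
    intro g C x
    simpa only [Formula.realize_imp, realize_inCell, realize_inSec, realize_pr, Term.realize_var,
      val_zero] using F (.prog_opn g C) x x x
  case prog_tan =>
    intro g C x
    simpa only [Formula.realize_imp, realize_inCell, realize_eqF, realize_pr, realize_cst,
      Term.realize_var, val_zero] using F (.prog_tan g C) x x x
  case tan_fwd =>
    intro C x hx
    have h₁ := F (.tan_after .fwd C) x x x
    have h₂ := F (.tan_before .fwd C) x x x
    simp only [Formula.realize_imp, Formula.realize_inf, Formula.realize_sup, dirLe, dirLt, leF,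
      realize_inCell, realize_ltF, realize_eqF, realize_pr, realize_cst, Term.realize_var,
      val_zero] at h₁ h₂
    exact ⟨fun h => h₁ ⟨hx, h⟩, fun h => h₂ ⟨hx, h⟩⟩
  case tan_bwd =>
    intro C x hx
    have h₁ := F (.tan_after .bwd C) x x x
    have h₂ := F (.tan_before .bwd C) x x x
    simp only [Formula.realize_imp, Formula.realize_inf, Formula.realize_sup, dirLe, dirLt, leF,
      realize_inCell, realize_ltF, realize_eqF, realize_pr, realize_cst, Term.realize_var,
      val_zero] at h₁ h₂
    exact ⟨fun h => h₁ ⟨hx, h⟩, fun h => h₂ ⟨hx, h⟩⟩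
  case sec_inj =>
    intro g C x hx y hy h
    have := F (.sec_inj g C) x y x
    simp only [Formula.realize_imp, Formula.realize_inf, Formula.realize_sup, realize_inSec,
      realize_eqF, realize_pr, realize_cst, Term.realize_var, val_zero, val_one] at this
    exact this ⟨⟨hx, hy⟩, h⟩
  case single_next =>
    intro g c C h
    have := F (.single_next g c) s₀ s₀ s₀
    rw [h] at this
    simpa only [singleVal, realize_inSec, realize_pr, realize_cst] using this
  case trans_maps =>
    intro g C x
    simpa only [Formula.realize_imp, realize_inCell, realize_inSec, realize_pr, Term.realize_var,
      val_zero] using F (.trans_maps g C) x x x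
  case trans_mono =>
    intro g C x hx y hy
    have := F (.trans_mono g C) x y x
    simp only [Formula.realize_imp, Formula.realize_inf, realize_iff, realize_inCell, realize_ltF,
      realize_pr, Term.realize_var, val_zero, val_one] at this
    exact this ⟨hx, hy⟩
  case trans_convex =>
    intro g C x hx y hy z hz h h'
    have := F (.trans_convex g C) x y z
    simp only [Formula.realize_imp, Formula.realize_inf, realize_inCell, realize_inSec,
      realize_ltF, realize_eqF, realize_exv, realize_pr, Term.realize_var, val_zero, val_one,
      val_two, Function.update_apply, Fin.isValue, Fin.reduceEq, ↓reduceIte] at this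
    exact this ⟨⟨⟨⟨hx, hy⟩, hz⟩, h⟩, h'⟩
  case trans_inv =>
    intro g C x
    simpa only [Formula.realize_imp, realize_inCell, realize_eqF, realize_pr, Term.realize_var,
      val_zero] using F (.trans_inv g C) x x x
  case sec_next =>
    intro g C x hx
    have := F (.sec_next g C) x x x
    simp only [Formula.realize_imp, Formula.realize_sup, realize_iSup, realize_inCell,
      realize_inSec, realize_eqF, realize_pr, realize_cst, Term.realize_var, val_zero] at this
    rcases this hx with (h | ⟨E, h⟩) | ⟨d, h⟩
    · exact Or.inl (Or.inl h)
    · exact Or.inl (Or.inr ⟨E.1, E.2, h⟩)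
    · exact Or.inr ⟨d.1, d.2, h⟩
  case adj_exists =>
    intro C x hx hx'
    have := F (.adj_exists C) x x x
    simp only [Formula.realize_imp, Formula.realize_inf, Formula.realize_sup, Formula.realize_not,
      realize_exv, realize_inCell, realize_inSec,
      realize_nextTo C _ 0 1 (by decide) (by decide), Term.realize_var, val_zero,
      Function.update_apply, Fin.isValue, Fin.reduceEq, ↓reduceIte] at this
    exact this ⟨hx, hx'⟩
  case fiber_order =>
    intro C y hy
    have := F (.fiber_order C) y y y
    simp only [Formula.realize_imp, realize_inSec, Term.realize_var, val_one] at this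
    refine isDenseOrder_of_realize _ ?_ (this hy)
    intro i hi w hw
    have hi7 : i ≠ 7 := by rintro rfl; revert hi; decide
    simp only [inFiber, InFiber, Formula.realize_sup, realize_eqF, Term.realize_var,
      realize_nextTo C _ i 1 hi7 (by decide), hw 1 (by decide), val_one]
  case fiber_prog_to =>
    intro C g x z h
    have := F (.fiber_prog_to C g) x x x
    simp only [Formula.realize_imp, Formula.realize_inf, Formula.realize_not, realize_exv,
      realize_allv, realize_inCell, realize_inSec, realize_eqF, realize_pr,
      realize_nextTo C _ 0 1 (by decide) (by decide),
      realize_nextTo C _ 0 2 (by decide) (by decide), Term.realize_var, val_zero,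
      Function.update_apply, Fin.isValue, Fin.reduceEq, ↓reduceIte] at this
    refine this ⟨⟨?_, ?_⟩, z, h⟩ z h <;> cases g
    exacts [h.1.1.1.1, h.1.1.1.1, h.1.1.1.2, h.1.1.1.2]
  case fiber_prog_from =>
    intro C g x z h
    have := F (.fiber_prog_from C g) x x x
    simp only [Formula.realize_imp, Formula.realize_inf, Formula.realize_not, realize_exv,
      realize_allv, realize_inCell, realize_inSec, realize_eqF, realize_pr,
      realize_nextTo C _ 0 1 (by decide) (by decide),
      realize_nextTo C _ 0 2 (by decide) (by decide), Term.realize_var, val_zero,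
      Function.update_apply, Fin.isValue, Fin.reduceEq, ↓reduceIte] at this
    refine this ⟨⟨?_, ?_⟩, z, h⟩ z h <;> cases g
    exacts [h.1.1.1.1, h.1.1.1.1, h.1.1.1.2, h.1.1.1.2]
  case lower_mem =>
    intro g C
    have := F (.lower_mem g C) s₀ s₀ s₀
    simp only [Formula.realize_sup, realize_inSec, realize_eqF, minT, maxT, realize_cst] at this
    exact this
  case upper_mem =>
    intro g C
    have := F (.upper_mem g C) s₀ s₀ s₀
    simp only [Formula.realize_sup, realize_inSec, realize_eqF, minT, maxT, realize_cst] at this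
    exact this
  case lower_upper =>
    intro g C x
    simpa only [Formula.realize_imp, Formula.realize_inf, realize_iff, realize_inCell,
      realize_inSec, realize_ltF, realize_pr, realize_cst, Term.realize_var, val_zero]
      using F (.lower_upper g C) x x x
  case rel_def =>
    intro G x y
    simpa only [Formula.realize_sup, Formula.realize_inf, realize_iff, realize_holds, realize_exv,
      realize_btw, realize_prop, realize_eqF, Term.realize_var, val_zero, val_one,
      Function.update_apply, Fin.isValue, Fin.reduceEq, ↓reduceIte] using D (.rel_def G) x y x
  case uniform_S =>
    intro C g m hm x y h h₁ h₂
    have := D (.uniform_S C g m hm) x y x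
    simp only [uniform, NewRel.dom, Formula.realize_imp, Formula.realize_inf, Formula.realize_not,
      realize_holds, realize_exv, realize_allv, realize_btw, realize_inOne, realize_prIter,
      realize_isFixBd C 2 (by decide), Term.realize_var, val_zero, val_one,
      Function.update_apply, Fin.isValue, Fin.reduceEq, ↓reduceIte] at this
    exact this ⟨⟨h, h₁⟩, fun ⟨z, hz, hz'⟩ => h₂ z hz hz'⟩
  case uniform_B =>
    intro C g m hm x y h h₁ h₂
    have := D (.uniform_B C g m hm) x y x
    simp only [uniform, NewRel.dom, Formula.realize_imp, Formula.realize_inf, Formula.realize_not,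
      realize_holds, realize_exv, realize_allv, realize_btw, realize_inOne, realize_prIter,
      realize_isFixBd C 2 (by decide), Term.realize_var, val_zero, val_one,
      Function.update_apply, Fin.isValue, Fin.reduceEq, ↓reduceIte] at this
    exact this ⟨⟨h, h₁⟩, fun ⟨z, hz, hz'⟩ => h₂ z hz hz'⟩
  case fixBd_gamma =>
    intro C x h
    have := D (.gamma_fixBd C) x x x
    simp only [realize_iff, realize_iSup, Formula.realize_inf, realize_eqF, realize_inOne,
      realize_cst, realize_isFixBd C 0 (by decide), Term.realize_var, val_zero] at this
    obtain ⟨j, hj, -⟩ := this.1 h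
    exact ⟨j, hj⟩

/-! ### The flow system of a model -/

namespace IsModel

lemma cell_unique (hI : IsModel Ψ M) {C D : Ψ.Cell} {x : M} (h : x ∈ Ψ.CellSet M C)
    (h' : x ∈ Ψ.CellSet M D) : C = D :=
  by_contra fun hne => hI.disjoint C D hne x h h'

lemma mem_cell_of_mem_one (hI : IsModel Ψ M) {C : Ψ.Cell₁} {x : M} (h : x ∈ Ψ.OneSet M C) :
    x ∈ Ψ.CellSet M C.cell := by
  cases C with
  | trans C => exact h
  | sec C => exact hI.base_sec C x h

lemma one_unique (hI : IsModel Ψ M) {C D : Ψ.Cell₁} {x : M} (h : x ∈ Ψ.OneSet M C)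
    (h' : x ∈ Ψ.OneSet M D) : C = D := by
  have := hI.cell_unique (hI.mem_cell_of_mem_one h) (hI.mem_cell_of_mem_one h')
  cases C <;> cases D <;> simp [FlowPattern.Cell₁.cell] at this <;> rw [this]

lemma one_order (hI : IsModel Ψ M) (C : Ψ.Cell₁) :
    IsDenseOrder (Ψ.Lt M C.cell) (· ∈ Ψ.OneSet M C) := by
  cases C with
  | trans C => exact hI.order (.trans C)
  | sec C => exact hI.sec_order C

open Classical in
/-- The line of the base on which a point lies: a transverse cell or a set `E_C`. Every other point
is made a line of its own. -/
noncomputable def lineOf (Ψ : DulacConfig.{u}) {M : Type v} [Ψ.lang.Structure M] (x : M) :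
    Ψ.Cell₁ ⊕ M :=
  if h : ∃ C, x ∈ Ψ.OneSet M C then Sum.inl h.choose else Sum.inr x

lemma lineOf_of_mem (hI : IsModel Ψ M) {C : Ψ.Cell₁} {x : M} (h : x ∈ Ψ.OneSet M C) :
    lineOf Ψ x = Sum.inl C := by
  have h' : ∃ C, x ∈ Ψ.OneSet M C := ⟨C, h⟩
  rw [lineOf, dif_pos h', hI.one_unique h'.choose_spec h]

lemma mem_of_lineOf {C : Ψ.Cell₁} {x : M} (h : lineOf Ψ x = Sum.inl C) : x ∈ Ψ.OneSet M C := by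
  by_cases h' : ∃ C, x ∈ Ψ.OneSet M C
  · rw [lineOf, dif_pos h'] at h
    exact Sum.inl_injective h ▸ h'.choose_spec
  · rw [lineOf, dif_neg h'] at h
    cases h

lemma lineOf_of_notMem {x : M} (h : ∀ C, x ∉ Ψ.OneSet M C) : lineOf Ψ x = Sum.inr x := by
  rw [lineOf, dif_neg (by simpa using h)]

lemma eq_of_lineOf_eq {x y : M} (h : ∀ C, x ∉ Ψ.OneSet M C) (he : lineOf Ψ y = lineOf Ψ x) :
    y = x := by
  rw [lineOf_of_notMem h] at he
  by_cases h' : ∃ C, y ∈ Ψ.OneSet M C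
  · rw [lineOf, dif_pos h'] at he
    cases he
  · rw [lineOf, dif_neg h'] at he
    exact Sum.inr_injective he

/-- The lines of the base of a model. -/
noncomputable def base (hI : IsModel Ψ M) : LineSystem M (Ψ.Cell₁ ⊕ M) where
  lt x y := ∃ C, x ∈ Ψ.OneSet M C ∧ y ∈ Ψ.OneSet M C ∧ Ψ.Lt M C.cell x y
  lab := lineOf Ψ
  irrefl x := fun ⟨C, hx, _, h⟩ => (hI.one_order C).irrefl x hx h
  trans := by
    rintro x y z ⟨C, hx, hy, h⟩ ⟨D, hy', hz, h'⟩
    obtain rfl := hI.one_unique hy hy'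
    exact ⟨C, hx, hz, (hI.one_order C).trans x y z hx hy hz h h'⟩
  lab_eq := by
    rintro x y ⟨C, hx, hy, -⟩
    rw [hI.lineOf_of_mem hx, hI.lineOf_of_mem hy]
  tri := by
    intro x y h
    by_cases hx : ∃ C, x ∈ Ψ.OneSet M C
    · obtain ⟨C, hx⟩ := hx
      have hy : y ∈ Ψ.OneSet M C := mem_of_lineOf (h ▸ hI.lineOf_of_mem hx)
      rcases (hI.one_order C).tri x y hx hy with h | h | h
      exacts [Or.inl ⟨C, hx, hy, h⟩, Or.inr (Or.inl h), Or.inr (Or.inr ⟨C, hy, hx, h⟩)]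
    · exact Or.inr (Or.inl (eq_of_lineOf_eq (by simpa using hx) h.symm).symm)
  dense := by
    rintro x y ⟨C, hx, hy, h⟩
    obtain ⟨z, hz, h₁, h₂⟩ := (hI.one_order C).dense x y hx hy h
    exact ⟨z, ⟨C, hx, hz, h₁⟩, ⟨C, hz, hy, h₂⟩⟩
  ends := by
    intro x
    by_cases hx : ∃ C, x ∈ Ψ.OneSet M C
    · obtain ⟨C, hx⟩ := hx
      obtain ⟨⟨y, hy, h₁⟩, z, hz, h₂⟩ := (hI.one_order C).ends x hx
      exact Or.inr ⟨⟨y, C, hy, hx, h₁⟩, z, C, hx, hz, h₂⟩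
    · exact Or.inl fun y hy => eq_of_lineOf_eq (by simpa using hx) hy

lemma base_lt_iff (hI : IsModel Ψ M) {C : Ψ.Cell₁} {x y : M} (hx : x ∈ Ψ.OneSet M C)
    (hy : y ∈ Ψ.OneSet M C) : hI.base.lt x y ↔ Ψ.Lt M C.cell x y := by
  refine ⟨fun ⟨D, hx', _, h⟩ => ?_, fun h => ⟨C, hx, hy, h⟩⟩
  obtain rfl := hI.one_unique hx hx'
  exact h

lemma mem_one_of_sameCut (hI : IsModel Ψ M) {Q : Finset M} {C : Ψ.Cell₁} {x y : M}
    (h : hI.base.SameCut Q x y) (hx : x ∈ Ψ.OneSet M C) : y ∈ Ψ.OneSet M C :=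
  mem_of_lineOf (h.1.symm.trans (hI.lineOf_of_mem hx))

/-! ### The fibers -/

lemma cell_of_next (C : Ψ.Opn) (g : Dir) {x y : M} (h : Ψ.Next M C g x y) :
    x ∈ Ψ.CellSet M (.opn C) ∧ x ∉ Ψ.SecSet M C ∧ y ∈ Ψ.SecSet M C := by
  cases g <;> exact ⟨h.1.1.1.1, h.1.1.1.2, h.1.1.2⟩

lemma cell_of_inFiber (hI : IsModel Ψ M) {C : Ψ.Opn} {x y : M} (hy : y ∈ Ψ.SecSet M C)
    (h : Ψ.InFiber M C x y) : x ∈ Ψ.CellSet M (.opn C) := by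
  rcases h with (h | h) | rfl
  · exact (cell_of_next C _ h).1
  · exact (cell_of_next C _ h).1
  · exact hI.base_sec C _ hy

/-- Points of different fibers of an open cell are ordered as the base points. -/
lemma lt_of_inFiber (hI : IsModel Ψ M) {C : Ψ.Opn} {x y p q : M} (hp : p ∈ Ψ.SecSet M C)
    (hq : q ∈ Ψ.SecSet M C) (hx : Ψ.InFiber M C x p) (hy : Ψ.InFiber M C y q)
    (h : Ψ.Lt M (.opn C) p q) : Ψ.Lt M (.opn C) x y := by
  obtain ⟨m, hm, h₁, h₂⟩ := (hI.sec_order C).dense p q hp hq h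
  have hxC := hI.cell_of_inFiber hp hx
  have hyC := hI.cell_of_inFiber hq hy
  have hmC := hI.base_sec C m hm
  have hpC := hI.base_sec C p hp
  have hqC := hI.base_sec C q hq
  have O := hI.order (.opn C)
  have hxm : Ψ.Lt M (.opn C) x m := by
    rcases hx with (hx | hx) | rfl
    · rcases O.tri x m hxC hmC with h' | h' | h'
      · exact h'
      · exact absurd (h' ▸ hm) hx.1.1.1.2
      · exact absurd ⟨m, ⟨hm, h₁⟩, h'⟩ hx.2
    · exact O.trans x p m hxC hpC hmC hx.1.2 h₁
    · exact h₁
  have hmy : Ψ.Lt M (.opn C) m y := by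
    rcases hy with (hy | hy) | rfl
    · exact O.trans m q y hmC hqC hyC h₂ hy.1.2
    · rcases O.tri m y hmC hyC with h' | h' | h'
      · exact h'
      · exact absurd (h' ▸ hm) hy.1.1.1.2
      · exact absurd ⟨m, ⟨hm, h'⟩, h₂⟩ hy.2
    · exact h₂
  exact O.trans x m y hxC hmC hyC hxm hmy

lemma inFiber_unique (hI : IsModel Ψ M) {C : Ψ.Opn} {x p q : M} (hp : p ∈ Ψ.SecSet M C)
    (hq : q ∈ Ψ.SecSet M C) (h : Ψ.InFiber M C x p) (h' : Ψ.InFiber M C x q) : p = q := by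
  have hx := (hI.order (.opn C)).irrefl x (hI.cell_of_inFiber hp h)
  rcases (hI.sec_order C).tri p q hp hq with h₁ | h₁ | h₁
  · exact absurd (hI.lt_of_inFiber hp hq h h' h₁) hx
  · exact h₁
  · exact absurd (hI.lt_of_inFiber hq hp h' h h₁) hx

lemma exists_inFiber (hI : IsModel Ψ M) {C : Ψ.Opn} {x : M} (hx : x ∈ Ψ.CellSet M (.opn C)) :
    ∃ y ∈ Ψ.SecSet M C, Ψ.InFiber M C x y := by
  by_cases hx' : x ∈ Ψ.SecSet M C
  · exact ⟨x, hx', Or.inr rfl⟩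
  · obtain ⟨y, hy | hy⟩ := hI.adj_exists C x hx hx'
    · exact ⟨y, (cell_of_next C _ hy).2.2, Or.inl (Or.inr hy)⟩
    · exact ⟨y, (cell_of_next C _ hy).2.2, Or.inl (Or.inl hy)⟩

open Classical in
/-- The base point of a point `x`: the point of `E_C` in whose fiber `x` lies, for `x` in an open
cell `C`; the point `e_C`, for `x` in a tangent cell `C`; and `x` otherwise. -/
noncomputable def rootOf (Ψ : DulacConfig.{u}) {M : Type v} [Ψ.lang.Structure M] (x : M) : M :=
  if h : ∃ y C, y ∈ Ψ.SecSet M C ∧ Ψ.InFiber M C x y then h.choose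
  else if h : ∃ C, x ∈ Ψ.CellSet M (.tan C) then Ψ.Cst M (.e h.choose) else x

lemma rootOf_of_inFiber (hI : IsModel Ψ M) {C : Ψ.Opn} {x y : M} (hy : y ∈ Ψ.SecSet M C)
    (h : Ψ.InFiber M C x y) : rootOf Ψ x = y := by
  have h' : ∃ y C, y ∈ Ψ.SecSet M C ∧ Ψ.InFiber M C x y := ⟨y, C, hy, h⟩
  rw [rootOf, dif_pos h']
  obtain ⟨D, hD, hx⟩ := h'.choose_spec
  have : FlowPattern.Cell.opn C = FlowPattern.Cell.opn D :=
    hI.cell_unique (hI.cell_of_inFiber hy h) (hI.cell_of_inFiber hD hx)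
  cases this
  exact hI.inFiber_unique hD hy hx h

lemma rootOf_spec (hI : IsModel Ψ M) {C : Ψ.Opn} {x : M} (hx : x ∈ Ψ.CellSet M (.opn C)) :
    rootOf Ψ x ∈ Ψ.SecSet M C ∧ Ψ.InFiber M C x (rootOf Ψ x) := by
  obtain ⟨y, hy, h⟩ := hI.exists_inFiber hx
  rw [hI.rootOf_of_inFiber hy h]
  exact ⟨hy, h⟩

lemma rootOf_of_sec (hI : IsModel Ψ M) {C : Ψ.Opn} {x : M} (hx : x ∈ Ψ.SecSet M C) :
    rootOf Ψ x = x :=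
  hI.rootOf_of_inFiber hx (Or.inr rfl)

lemma rootOf_of_tan (hI : IsModel Ψ M) {C : Ψ.Tan} {x : M} (hx : x ∈ Ψ.CellSet M (.tan C)) :
    rootOf Ψ x = Ψ.Cst M (.e C) := by
  have h' : ∃ C, x ∈ Ψ.CellSet M (.tan C) := ⟨C, hx⟩
  rw [rootOf, dif_neg, dif_pos h']
  · have := hI.cell_unique h'.choose_spec hx
    simp only [FlowPattern.Cell.tan.injEq] at this
    rw [this]
  · rintro ⟨y, D, hD, h⟩
    cases hI.cell_unique hx (hI.cell_of_inFiber hD h)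

lemma rootOf_of_not (hI : IsModel Ψ M) {x : M} (h₁ : ∀ C, x ∉ Ψ.CellSet M (.opn C))
    (h₂ : ∀ C, x ∉ Ψ.CellSet M (.tan C)) : rootOf Ψ x = x := by
  rw [rootOf, dif_neg, dif_neg (by simpa using h₂)]
  rintro ⟨y, D, hD, h⟩
  exact h₁ D (hI.cell_of_inFiber hD h)

lemma rootOf_of_trans (hI : IsModel Ψ M) {C : Ψ.Trans} {x : M}
    (hx : x ∈ Ψ.CellSet M (.trans C)) : rootOf Ψ x = x :=
  hI.rootOf_of_not (fun D h => by cases hI.cell_unique hx h)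
    (fun D h => by cases hI.cell_unique hx h)

lemma rootOf_of_one (hI : IsModel Ψ M) {C : Ψ.Cell₁} {x : M} (hx : x ∈ Ψ.OneSet M C) :
    rootOf Ψ x = x := by
  cases C with
  | trans C => exact hI.rootOf_of_trans hx
  | sec C => exact hI.rootOf_of_sec hx

lemma rootOf_mem_cell (hI : IsModel Ψ M) {C : Ψ.Cell} {x : M} (hx : x ∈ Ψ.CellSet M C) :
    rootOf Ψ x ∈ Ψ.CellSet M C := by
  cases C with
  | opn C => exact hI.base_sec C _ (hI.rootOf_spec hx).1
  | tan C => rw [hI.rootOf_of_tan hx]; exact hI.base_tan C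
  | trans C => rwa [hI.rootOf_of_trans hx]

lemma rootOf_mem_cell_iff (hI : IsModel Ψ M) {C : Ψ.Cell} {x : M} :
    rootOf Ψ x ∈ Ψ.CellSet M C ↔ x ∈ Ψ.CellSet M C := by
  refine ⟨fun h => ?_, hI.rootOf_mem_cell⟩
  by_cases h' : ∃ D, x ∈ Ψ.CellSet M D
  · obtain ⟨D, hD⟩ := h'
    rwa [← hI.cell_unique (hI.rootOf_mem_cell hD) h]
  · push Not at h'
    rwa [hI.rootOf_of_not (fun D => h' _) (fun D => h' _)] at h

lemma cell_of_rootOf_eq (hI : IsModel Ψ M) {C : Ψ.Cell} {x y : M} (h : rootOf Ψ x = rootOf Ψ y)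
    (hx : x ∈ Ψ.CellSet M C) : y ∈ Ψ.CellSet M C := by
  rw [← hI.rootOf_mem_cell_iff, ← h]
  exact hI.rootOf_mem_cell hx

lemma rootOf_rootOf (hI : IsModel Ψ M) (x : M) : rootOf Ψ (rootOf Ψ x) = rootOf Ψ x := by
  by_cases h' : ∃ D, x ∈ Ψ.CellSet M D
  · obtain ⟨D, hD⟩ := h'
    cases D with
    | opn C => exact hI.rootOf_of_sec (hI.rootOf_spec hD).1
    | tan C =>
      rw [hI.rootOf_of_tan hD, hI.rootOf_of_tan (hI.base_tan C)]
    | trans C => rw [hI.rootOf_of_trans hD, hI.rootOf_of_trans hD]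
  · push Not at h'
    rw [hI.rootOf_of_not (fun D => h' _) (fun D => h' _),
      hI.rootOf_of_not (fun D => h' _) (fun D => h' _)]

/-- The fibers of a model. -/
noncomputable def fibers (hI : IsModel Ψ M) : LineSystem M M where
  lt x y := rootOf Ψ x = rootOf Ψ y ∧
    ∃ C, x ∈ Ψ.CellSet M C ∧ y ∈ Ψ.CellSet M C ∧ Ψ.Lt M C x y
  lab := rootOf Ψ
  irrefl x := fun ⟨_, C, hx, _, h⟩ => (hI.order C).irrefl x hx h
  trans := by
    rintro x y z ⟨hr, C, hx, hy, h⟩ ⟨hr', D, hy', hz, h'⟩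
    obtain rfl := hI.cell_unique hy hy'
    exact ⟨hr.trans hr', C, hx, hz, (hI.order C).trans x y z hx hy hz h h'⟩
  lab_eq h := h.1
  tri := by
    intro x y h
    by_cases hx : ∃ C, x ∈ Ψ.CellSet M C
    · obtain ⟨C, hx⟩ := hx
      have hy := hI.cell_of_rootOf_eq h hx
      rcases (hI.order C).tri x y hx hy with h' | h' | h'
      exacts [Or.inl ⟨h, C, hx, hy, h'⟩, Or.inr (Or.inl h'),
        Or.inr (Or.inr ⟨h.symm, C, hy, hx, h'⟩)]
    · have hy : ¬ ∃ C, y ∈ Ψ.CellSet M C := fun ⟨C, hy⟩ =>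
        hx ⟨C, hI.cell_of_rootOf_eq h.symm hy⟩
      push Not at hx hy
      rw [hI.rootOf_of_not (fun D => hx _) (fun D => hx _),
        hI.rootOf_of_not (fun D => hy _) (fun D => hy _)] at h
      exact Or.inr (Or.inl h)
  dense := by
    rintro x y ⟨hr, C, hx, hy, h⟩
    cases C with
    | opn C =>
      obtain ⟨hs, hf⟩ := hI.rootOf_spec hx
      obtain ⟨z, hz, h₁, h₂⟩ := (hI.fiber_order C _ hs).dense x y hf
        (hr ▸ (hI.rootOf_spec hy).2) h
      have hzr := hI.rootOf_of_inFiber hs hz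
      have hzC := hI.cell_of_inFiber hs hz
      exact ⟨z, ⟨hzr.symm, _, hx, hzC, h₁⟩, hzr.trans hr, _, hzC, hy, h₂⟩
    | tan C =>
      obtain ⟨z, hz, h₁, h₂⟩ := (hI.order _).dense x y hx hy h
      have hzr := hI.rootOf_of_tan hz
      rw [← hI.rootOf_of_tan hx] at hzr
      exact ⟨z, ⟨hzr.symm, _, hx, hz, h₁⟩, hzr.trans hr, _, hz, hy, h₂⟩
    | trans C =>
      rw [hI.rootOf_of_trans hx, hI.rootOf_of_trans hy] at hr
      exact absurd (hr ▸ h) ((hI.order _).irrefl y hy)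
  ends := by
    intro x
    by_cases hx : ∃ C, x ∈ Ψ.CellSet M C
    · obtain ⟨C, hx⟩ := hx
      cases C with
      | opn C =>
        obtain ⟨hs, hf⟩ := hI.rootOf_spec hx
        obtain ⟨⟨y, hy, h₁⟩, z, hz, h₂⟩ := (hI.fiber_order C _ hs).ends x hf
        exact Or.inr ⟨⟨y, hI.rootOf_of_inFiber hs hy, _, hI.cell_of_inFiber hs hy, hx, h₁⟩,
          z, (hI.rootOf_of_inFiber hs hz).symm, _, hx, hI.cell_of_inFiber hs hz, h₂⟩
      | tan C =>
        obtain ⟨⟨y, hy, h₁⟩, z, hz, h₂⟩ := (hI.order _).ends x hx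
        exact Or.inr ⟨⟨y, (hI.rootOf_of_tan hy).trans (hI.rootOf_of_tan hx).symm, _, hy, hx, h₁⟩,
          z, (hI.rootOf_of_tan hx).trans (hI.rootOf_of_tan hz).symm, _, hx, hz, h₂⟩
      | trans C =>
        refine Or.inl fun y hy => ?_
        rw [← hI.rootOf_of_trans hx, ← hy,
          hI.rootOf_of_trans (hI.cell_of_rootOf_eq (C := .trans C) hy.symm hx)]
    · push Not at hx
      refine Or.inl fun y hy => ?_
      have hy' : ∀ C, y ∉ Ψ.CellSet M C := fun C h => hx C (hI.cell_of_rootOf_eq hy h)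
      rwa [hI.rootOf_of_not (fun D => hx _) (fun D => hx _),
        hI.rootOf_of_not (fun D => hy' _) (fun D => hy' _)] at hy

/-! ### The progression maps on the base -/

lemma opp_opp (g : Dir) : g.opp.opp = g := by cases g <;> rfl

open Classical in
/-- The progression map `g`, restricted to an invertible map between points of the lines of the
base. -/
noncomputable def step (Ψ : DulacConfig.{u}) (M : Type v) [Ψ.lang.Structure M] (g : Dir) :
    M ≃. M where
  toFun x := if (∃ C, x ∈ Ψ.OneSet M C) ∧ (∃ C, Ψ.Pr M g x ∈ Ψ.OneSet M C) ∧
    Ψ.Pr M g.opp (Ψ.Pr M g x) = x then some (Ψ.Pr M g x) else none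
  invFun x := if (∃ C, x ∈ Ψ.OneSet M C) ∧ (∃ C, Ψ.Pr M g.opp x ∈ Ψ.OneSet M C) ∧
    Ψ.Pr M g (Ψ.Pr M g.opp x) = x then some (Ψ.Pr M g.opp x) else none
  inv x y := by
    simp only [Option.ite_none_right_eq_some, Option.some.injEq]
    constructor
    · rintro ⟨⟨h₁, h₂, h₃⟩, rfl⟩
      exact ⟨⟨h₂, h₃.symm ▸ h₁, by rw [h₃]⟩, h₃⟩
    · rintro ⟨⟨h₁, h₂, h₃⟩, rfl⟩
      exact ⟨⟨h₂, h₃.symm ▸ h₁, by rw [h₃]⟩, h₃⟩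

lemma mem_step {g : Dir} {x y : M} : y ∈ step Ψ M g x ↔
    ((∃ C, x ∈ Ψ.OneSet M C) ∧ (∃ C, Ψ.Pr M g x ∈ Ψ.OneSet M C) ∧
      Ψ.Pr M g.opp (Ψ.Pr M g x) = x) ∧ Ψ.Pr M g x = y := by
  classical
  change y ∈ (if _ then some _ else none : Option M) ↔ _
  simp only [Option.mem_def, Option.ite_none_right_eq_some, Option.some.injEq]

lemma step_opp (g : Dir) : step Ψ M g.opp = (step Ψ M g).symm := by
  classical
  refine PEquiv.ext fun x => ?_
  change (if _ then _ else _ : Option M) = (if _ then _ else _ : Option M)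
  rw [opp_opp]

/-- The two maps invert each other where both are defined on points of lines. -/
lemma opp_prog (hI : IsModel Ψ M) {g : Dir} {C D : Ψ.Cell₁} {x : M} (hx : x ∈ Ψ.OneSet M C)
    (hgx : Ψ.Pr M g x ∈ Ψ.OneSet M D) : Ψ.Pr M g.opp (Ψ.Pr M g x) = x := by
  cases C with
  | trans C => exact hI.trans_inv g C x hx
  | sec C =>
    rcases hI.sec_next g C x hx with (h | ⟨E, hE, h⟩) | ⟨d, -, h⟩
    · rw [h] at hgx
      exact absurd (hI.mem_cell_of_mem_one hgx) (hI.infty_not_cell _)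
    · have h₁ := hI.trans_maps g.opp E _ h
      have h₂ := hI.trans_inv g.opp E _ h
      rw [hE] at h₁
      rw [opp_opp] at h₂
      rcases hI.sec_inj g C _ h₁ x hx h₂ with h₃ | h₃
      · rw [h₂] at h₃
        rw [h₃] at h
        exact absurd h (hI.infty_not_cell _)
      · exact h₃
    · rw [h] at hgx
      exact absurd (hI.mem_cell_of_mem_one hgx) (hI.single_not_cell _ _)

lemma mem_step_of_mem (hI : IsModel Ψ M) {g : Dir} {C D : Ψ.Cell₁} {x : M}
    (hx : x ∈ Ψ.OneSet M C) (hgx : Ψ.Pr M g x ∈ Ψ.OneSet M D) : Ψ.Pr M g x ∈ step Ψ M g x :=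
  mem_step.2 ⟨⟨⟨C, hx⟩, ⟨D, hgx⟩, hI.opp_prog hx hgx⟩, rfl⟩

/-- A step from a set `E_C` within the base leads to a transverse cell. -/
lemma step_sec (hI : IsModel Ψ M) {g : Dir} {C : Ψ.Opn} {D : Ψ.Cell₁} {x : M}
    (hx : x ∈ Ψ.SecSet M C) (hgx : Ψ.Pr M g x ∈ Ψ.OneSet M D) :
    ∃ E, Ψ.transNext g.opp E = C ∧ Ψ.Pr M g x ∈ Ψ.CellSet M (.trans E) := by
  rcases hI.sec_next g C x hx with (h | h) | ⟨d, -, h⟩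
  · rw [h] at hgx
    exact absurd (hI.mem_cell_of_mem_one hgx) (hI.infty_not_cell _)
  · exact h
  · rw [h] at hgx
    exact absurd (hI.mem_cell_of_mem_one hgx) (hI.single_not_cell _ _)

/-- A point outside of `C` that lies below a point of `C` is the formal endpoint `min(C)`, hence lies
below all points of `C`. -/
lemma lt_of_lt_of_notMem (hI : IsModel Ψ M) {C : Ψ.Cell} {a x y : M} (ha : a ∉ Ψ.CellSet M C)
    (hy : y ∈ Ψ.CellSet M C) (h : Ψ.Lt M C a x) : Ψ.Lt M C a y := by
  rcases hI.order_domain C a x h with (⟨h', -⟩ | ⟨rfl, -⟩) | ⟨h', -⟩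
  · exact absurd h' ha
  · exact (hI.order_ends C y hy).2
  · exact absurd h' ha

lemma gt_of_gt_of_notMem (hI : IsModel Ψ M) {C : Ψ.Cell} {a x y : M} (ha : a ∉ Ψ.CellSet M C)
    (hy : y ∈ Ψ.CellSet M C) (h : Ψ.Lt M C x a) : Ψ.Lt M C y a := by
  rcases hI.order_domain C x a h with (⟨-, h'⟩ | ⟨-, h'⟩) | ⟨-, rfl⟩
  · exact absurd h' ha
  · exact absurd h' ha
  · exact (hI.order_ends C y hy).1

lemma endFunc_notMem (hI : IsModel Ψ M) (o : Option Ψ.Single) (C : Ψ.Cell) :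
    Ψ.Cst M (endFunc o) ∉ Ψ.CellSet M C := by
  cases o with
  | none => exact hI.infty_not_cell C
  | some c => exact hI.single_not_cell c C

/-- A bound in the closure of `E_C` that belongs to `Q` does not separate points of the same cut. -/
lemma lt_bound_of_sameCut (hI : IsModel Ψ M) {Q : Finset M} {C : Ψ.Opn} {a x y : M}
    (ha : a ∈ Ψ.OneBar M (.sec C)) (haQ : a ∈ Q) (hx : x ∈ Ψ.SecSet M C)
    (h : hI.base.SameCut Q x y) :
    (Ψ.Lt M (.opn C) a x → Ψ.Lt M (.opn C) a y) ∧ (Ψ.Lt M (.opn C) x a → Ψ.Lt M (.opn C) y a) := by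
  have hy : y ∈ Ψ.SecSet M C := hI.mem_one_of_sameCut (C := .sec C) h hx
  have hout : ∀ o, a = Ψ.Cst M (endFunc o) →
      (Ψ.Lt M (.opn C) a x → Ψ.Lt M (.opn C) a y) ∧
        (Ψ.Lt M (.opn C) x a → Ψ.Lt M (.opn C) y a) := by
    rintro o rfl
    exact ⟨hI.lt_of_lt_of_notMem (hI.endFunc_notMem _ _) (hI.base_sec C y hy),
      hI.gt_of_gt_of_notMem (hI.endFunc_notMem _ _) (hI.base_sec C y hy)⟩
  rcases ha with (ha | ha) | ha
  · have h₁ := h.2 a haQ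
    have e₁ := hI.base_lt_iff (C := .sec C) ha hx
    have e₂ := hI.base_lt_iff (C := .sec C) ha hy
    have e₃ := hI.base_lt_iff (C := .sec C) hx ha
    have e₄ := hI.base_lt_iff (C := .sec C) hy ha
    exact ⟨fun h => e₂.1 (h₁.1.1 (e₁.2 h)), fun h => e₄.1 (h₁.2.1 (e₃.2 h))⟩
  · exact hout _ ha
  · exact hout _ ha

/-- From a transverse cell a step is an isomorphism onto a convex set. From a set `E_C` a step within
the base is the inverse of such an isomorphism, and its domain is cut out by the constants `lower`
and `upper`. -/
lemma exists_mono_step (hI : IsModel Ψ M) (g : Dir) :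
    ∃ Q, hI.base.PiecewiseMono (step Ψ M g) Q := by
  classical
  have hfin : Set.Finite (Set.range (fun D : Ψ.Trans => Ψ.Cst M (.lower g.opp D)) ∪
      Set.range fun D : Ψ.Trans => Ψ.Cst M (.upper g.opp D)) :=
    (Set.finite_range _).union (Set.finite_range _)
  -- order relations along a step from a set `E_C` to a transverse cell
  have hback : ∀ {E : Ψ.Trans} {x y : M}, Ψ.Pr M g x ∈ Ψ.CellSet M (.trans E) →
      Ψ.Pr M g y ∈ Ψ.CellSet M (.trans E) → Ψ.Pr M g.opp (Ψ.Pr M g x) = x →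
      Ψ.Pr M g.opp (Ψ.Pr M g y) = y → (Ψ.Lt M (.trans E) (Ψ.Pr M g x) (Ψ.Pr M g y) ↔
        Ψ.Lt M (.opn (Ψ.transNext g.opp E)) x y) := by
    intro E x y hx hy hx' hy'
    have := hI.trans_mono g.opp E _ hx _ hy
    rwa [hx', hy'] at this
  have hdom : ∀ {x y x' : M}, hI.base.SameCut hfin.toFinset x y → x' ∈ step Ψ M g x →
      ∃ y' ∈ step Ψ M g y, ∃ D, x' ∈ Ψ.OneSet M D ∧ y' ∈ Ψ.OneSet M D := by
    intro x y x' hxy hx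
    obtain ⟨⟨⟨C, hC⟩, ⟨D, hD⟩, hinv⟩, rfl⟩ := mem_step.1 hx
    have hyC := hI.mem_one_of_sameCut hxy hC
    cases C with
    | trans C =>
      have h₁ := hI.trans_maps g C x hC
      have h₂ := hI.trans_maps g C y hyC
      exact ⟨_, hI.mem_step_of_mem (C := .trans C) (D := .sec _) hyC h₂, .sec _, h₁, h₂⟩
    | sec C =>
      obtain ⟨E, rfl, hE⟩ := hI.step_sec hC hD
      have hlu := hI.lower_upper g.opp E
      rw [opp_opp] at hlu
      have h₁ := (hlu x hC).1 hE
      have h₂ : Ψ.Pr M g y ∈ Ψ.CellSet M (.trans E) := by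
        refine (hlu y hyC).2 ⟨?_, ?_⟩
        · exact (hI.lt_bound_of_sameCut (hI.lower_mem g.opp E)
            (hfin.mem_toFinset.2 (Or.inl ⟨E, rfl⟩)) hC hxy).1 h₁.1
        · exact (hI.lt_bound_of_sameCut (hI.upper_mem g.opp E)
            (hfin.mem_toFinset.2 (Or.inr ⟨E, rfl⟩)) hC hxy).2 h₁.2
      exact ⟨_, hI.mem_step_of_mem (C := .sec _) (D := .trans E) hyC h₂, .trans E, hE, h₂⟩
  have hmono : ∀ {x y x' y' : M}, hI.base.SameCut hfin.toFinset x y → x' ∈ step Ψ M g x →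
      y' ∈ step Ψ M g y → (hI.base.lt x y ↔ hI.base.lt x' y') := by
    intro x y x' y' hxy hx hy
    obtain ⟨y'', hy'', D, hxD, hyD⟩ := hdom hxy hx
    obtain rfl := Option.mem_unique hy hy''
    obtain ⟨⟨⟨C, hC⟩, -, hinv⟩, rfl⟩ := mem_step.1 hx
    obtain ⟨⟨-, -, hinv'⟩, rfl⟩ := mem_step.1 hy
    have hyC := hI.mem_one_of_sameCut hxy hC
    rw [hI.base_lt_iff hxD hyD, hI.base_lt_iff hC hyC]
    cases C with
    | trans C =>
      obtain rfl := hI.one_unique (C := .sec _) (hI.trans_maps g C x hC) hxD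
      exact hI.trans_mono g C x hC y hyC
    | sec C =>
      obtain ⟨E, rfl, hE⟩ := hI.step_sec hC hxD
      obtain rfl := hI.one_unique (C := .trans _) hE hxD
      exact (hback hE hyD hinv hinv').symm
  refine ⟨hfin.toFinset, ?_, ?_, ?_⟩
  · intro x y x' hxy hx
    obtain ⟨y', hy', D, h₁, h₂⟩ := hdom hxy hx
    exact ⟨y', hy', (hI.lineOf_of_mem h₁).trans (hI.lineOf_of_mem h₂).symm⟩
  · exact fun hxy hx hy h => (hmono hxy hx hy).1 h
  · intro x y x' y' z hxy hx hy hxz hzy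
    obtain ⟨y'', hy'', D, hxD, hyD⟩ := hdom hxy hx
    obtain rfl := Option.mem_unique hy hy''
    obtain ⟨⟨⟨C, hC⟩, -, hinv⟩, rfl⟩ := mem_step.1 hx
    obtain ⟨⟨-, -, hinv'⟩, rfl⟩ := mem_step.1 hy
    have hyC := hI.mem_one_of_sameCut hxy hC
    have hzD : z ∈ Ψ.OneSet M D :=
      mem_of_lineOf ((hI.base.lab_eq hxz).symm.trans (hI.lineOf_of_mem hxD))
    rw [hI.base_lt_iff hxD hzD] at hxz
    rw [hI.base_lt_iff hzD hyD] at hzy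
    cases C with
    | trans C =>
      obtain rfl := hI.one_unique (C := .sec _) (hI.trans_maps g C x hC) hxD
      obtain ⟨w, hw, rfl⟩ := hI.trans_convex g C x hC y hyC z hzD hxz hzy
      refine ⟨w, hI.mem_step_of_mem (C := .trans C) hw hzD, ?_, ?_⟩
      · exact (hI.base_lt_iff (C := .trans C) hC hw).2 ((hI.trans_mono g C x hC w hw).2 hxz)
      · exact (hI.base_lt_iff (C := .trans C) hw hyC).2 ((hI.trans_mono g C w hw y hyC).2 hzy)
    | sec C =>
      obtain ⟨E, rfl, hE⟩ := hI.step_sec hC hxD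
      obtain rfl := hI.one_unique (C := .trans _) hE hxD
      have h₁ := hI.trans_maps g.opp E z hzD
      have h₂ := hI.trans_inv g.opp E z hzD
      rw [opp_opp] at h₂
      have hz : Ψ.Pr M g (Ψ.Pr M g.opp z) ∈ Ψ.CellSet M (.trans E) := by rw [h₂]; exact hzD
      have hz' : Ψ.Pr M g.opp (Ψ.Pr M g (Ψ.Pr M g.opp z)) = Ψ.Pr M g.opp z := by rw [h₂]
      have hmem := hI.mem_step_of_mem (C := .sec _) (D := .trans E) h₁ hz
      rw [h₂] at hmem
      rw [← h₂] at hxz hzy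
      refine ⟨_, hmem, ?_, ?_⟩
      · exact (hI.base_lt_iff (C := .sec _) hC h₁).2 ((hback hE hz hinv hz').1 hxz)
      · exact (hI.base_lt_iff (C := .sec _) h₁ hyC).2 ((hback hz hyD hz' hinv').1 hzy)

/-- On points of lines, a composite of steps is a restriction of a power of one progression map. -/
lemma composite_le (w : List Dir) : ∃ (g : Dir) (m : ℕ),
    composite (step Ψ M) w ≤ composite (step Ψ M) (List.replicate m g) := by
  induction w with
  | nil => exact ⟨.fwd, 0, le_rfl⟩
  | cons g w ih =>
    obtain ⟨g', m, h⟩ := ih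
    have hcons : ∀ {m g'}, composite (step Ψ M) w ≤ composite (step Ψ M) (List.replicate m g') →
        composite (step Ψ M) (g :: w) ≤
          (step Ψ M g).trans (composite (step Ψ M) (List.replicate m g')) := by
      intro m g' h x y hy
      obtain ⟨z, hz, hy⟩ := (PEquiv.mem_trans _ _ _ _).1 hy
      exact (PEquiv.mem_trans _ _ _ _).2 ⟨z, hz, h z y hy⟩
    by_cases hg : g' = g
    · subst hg
      exact ⟨g', m + 1, hcons h⟩
    · have hg' : g = g'.opp := by cases g <;> cases g' <;> simp_all [Dir.opp]
      cases m with
      | zero =>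
        exact ⟨g, 1, hcons (g' := g) (m := 0) h⟩
      | succ m =>
        refine ⟨g', m, (hcons h).trans fun x y hy => ?_⟩
        obtain ⟨z, hz, hzy⟩ := (PEquiv.mem_trans _ _ _ _).1 hy
        obtain ⟨t, ht, hty⟩ := (PEquiv.mem_trans (step Ψ M g') _ _ _).1 hzy
        rw [hg', step_opp] at hz
        obtain rfl := Option.mem_unique ht ((step Ψ M g').mem_iff_mem.1 hz)
        exact hty

lemma iterate_of_mem_composite {g : Dir} {m : ℕ} {x y : M}
    (h : y ∈ composite (step Ψ M) (List.replicate m g) x) : (Ψ.Pr M g)^[m] x = y := by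
  induction m generalizing x with
  | zero =>
    have : y ∈ PEquiv.refl M x := h
    simpa using this
  | succ m ih =>
    obtain ⟨z, hz, hy⟩ := (PEquiv.mem_trans (step Ψ M g) _ _ _).1 h
    rw [Function.iterate_succ_apply, (mem_step.1 hz).2]
    exact ih hy

lemma oneLt_of_base (hI : IsModel Ψ M) {C : Ψ.Cell₁} {x y : M} (hx : x ∈ Ψ.OneSet M C)
    (h : hI.base.lt x y) : Ψ.OneLt M C x y := by
  have hy : y ∈ Ψ.OneSet M C :=
    mem_of_lineOf ((hI.base.lab_eq h).symm.trans (hI.lineOf_of_mem hx))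
  exact ⟨⟨Or.inl (Or.inl hx), Or.inl (Or.inl hy)⟩, (hI.base_lt_iff hx hy).1 h⟩

lemma base_of_oneLt (hI : IsModel Ψ M) {C : Ψ.Cell₁} {x y : M} (hx : x ∈ Ψ.OneSet M C)
    (hy : y ∈ Ψ.OneSet M C) (h : Ψ.OneLt M C x y) : hI.base.lt x y :=
  (hI.base_lt_iff hx hy).2 h.2

/-- The uniformity axioms, applied on a window around two points of the same cut: on a cut that
contains no boundary point, `g^m` moves all points in the same direction. -/
lemma exists_sign (hI : IsModel Ψ M) (w : List Dir) :
    ∃ Q, hI.base.UniformSign (composite (step Ψ M) w) Q := by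
  classical
  obtain ⟨g, m, hle⟩ := composite_le (Ψ := Ψ) (M := M) w
  rcases Nat.eq_zero_or_pos m with rfl | hm
  · refine ⟨∅, fun {x y x' y'} _ hx hy => ?_⟩
    obtain rfl : x = x' := iterate_of_mem_composite (hle _ _ hx)
    obtain rfl : y = y' := iterate_of_mem_composite (hle _ _ hy)
    simp [hI.base.irrefl]
  obtain ⟨Q, hQ⟩ := hI.base.exists_mono_composite hI.exists_mono_step (List.replicate m g)
  have hCell : Finite Ψ.Cell₁ := Finite.of_surjective
    (fun a : Ψ.Trans ⊕ Ψ.Opn => Sum.elim FlowPattern.Cell₁.trans FlowPattern.Cell₁.sec a) (by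
      rintro (C | C)
      exacts [⟨Sum.inl C, rfl⟩, ⟨Sum.inr C, rfl⟩])
  have hfin : Set.Finite (Set.range fun p : Ψ.Cell₁ × Fin Ψ.ν => Ψ.Cst M (.gamma p.1 p.2)) :=
    Set.finite_range _
  refine ⟨Q ∪ hfin.toFinset, ?_⟩
  -- the data of a window on which one of the two uniformity axioms is to be applied
  have key : ∀ {x y x' y' : M} {C : Ψ.Cell₁}, hI.base.SameCut (Q ∪ hfin.toFinset) x y → x ≠ y →
      x' ∈ composite (step Ψ M) (List.replicate m g) x →
      y' ∈ composite (step Ψ M) (List.replicate m g) y → x ∈ Ψ.OneSet M C →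
      x' ∈ Ψ.OneSet M C → y ∈ Ψ.OneSet M C ∧ y' ∈ Ψ.OneSet M C ∧
        ∃ a b, Ψ.Btw M C a x b ∧ Ψ.Btw M C a y b ∧
          (∀ z, Ψ.Btw M C a z b → (Ψ.Pr M g)^[m] z ∈ Ψ.OneSet M C) ∧
          ∀ z, Ψ.Btw M C a z b → ¬ Ψ.FixBd M C z := by
    intro x y x' y' C hxy hne hx hy hxC hxC'
    have hxQ : x ∉ Q ∪ hfin.toFinset := fun h => hne (hxy.eq_of_mem h)
    have hyC := hI.mem_one_of_sameCut hxy hxC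
    have hval : ∀ z, hI.base.SameCut (Q ∪ hfin.toFinset) x z →
        (Ψ.Pr M g)^[m] z ∈ Ψ.OneSet M C := by
      intro z hz
      obtain ⟨z', hz', hl⟩ := hQ.dom (hz.mono Finset.subset_union_left) hx
      rw [iterate_of_mem_composite hz']
      exact mem_of_lineOf (hl.symm.trans (hI.lineOf_of_mem hxC'))
    have hend : (∃ z, hI.base.lt z x) ∧ ∃ z, hI.base.lt x z := by
      obtain ⟨⟨y, hy, h₁⟩, z, hz, h₂⟩ := (hI.one_order C).ends x hxC
      exact ⟨⟨y, C, hy, hxC, h₁⟩, z, C, hxC, hz, h₂⟩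
    obtain ⟨a, b, ⟨hax, hay⟩, ⟨hxb, hyb⟩, hwin⟩ := hxy.exists_window hxQ hend
    have haC : a ∈ Ψ.OneSet M C :=
      mem_of_lineOf ((hI.base.lab_eq hax).trans (hI.lineOf_of_mem hxC))
    have hbC : b ∈ Ψ.OneSet M C :=
      mem_of_lineOf ((hI.base.lab_eq hxb).symm.trans (hI.lineOf_of_mem hxC))
    have hwin' : ∀ z, Ψ.Btw M C a z b → hI.base.SameCut (Q ∪ hfin.toFinset) x z := fun z hz =>
      hwin z (hI.base_of_oneLt haC hz.1.1 hz.1.2) (hI.base_of_oneLt hz.1.1 hbC hz.2)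
    refine ⟨hyC, ?_, a, b, ?_, ?_, fun z hz => hval z (hwin' z hz), fun z hz hbd => ?_⟩
    · rw [← iterate_of_mem_composite hy]
      exact hval y hxy
    · exact ⟨⟨hxC, hI.oneLt_of_base haC hax⟩, hI.oneLt_of_base hxC hxb⟩
    · exact ⟨⟨hyC, hI.oneLt_of_base haC hay⟩, hI.oneLt_of_base hyC hyb⟩
    · obtain ⟨j, hj⟩ := hI.fixBd_gamma C z hbd
      have hzQ : z ∈ Q ∪ hfin.toFinset :=
        Finset.mem_union_right _ (hfin.mem_toFinset.2 ⟨(C, j), hj.symm⟩)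
      exact hxQ ((hwin' z hz).symm.eq_of_mem hzQ ▸ hzQ)
  have hdiag : ∀ (G : NewRel Ψ) (z : M), z ∈ Ψ.OneSet M G.dom → G.Holds M z z →
      G.Property M z := by
    intro G z hz h
    rcases (hI.rel_def G z z).1 h with ⟨t, ht, -⟩ | ⟨-, h⟩
    · exact absurd (hI.base_of_oneLt ht.1.1 hz ht.2)
        (hI.base.asymm (hI.base_of_oneLt hz ht.1.1 ht.1.2))
    · exact h
  have hdown : ∀ {x y x' y' : M}, hI.base.SameCut (Q ∪ hfin.toFinset) x y →
      x' ∈ composite (step Ψ M) (List.replicate m g) x →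
      y' ∈ composite (step Ψ M) (List.replicate m g) y → hI.base.lt x' x → hI.base.lt y' y := by
    intro x y x' y' hxy hx hy hlt
    by_cases hne : x = y
    · subst hne
      rwa [Option.mem_unique hy hx]
    obtain ⟨C, hxC', hxC, h⟩ := hlt
    obtain ⟨hyC, hyC', a, b, hax, hay, h₁, h₂⟩ := key hxy hne hx hy hxC hxC'
    have hx' := iterate_of_mem_composite hx
    have hy' := iterate_of_mem_composite hy
    have hyy := hI.uniform_S C g m hm a b ((hI.rel_def (.S g m C) a b).2 (Or.inl ⟨x, hax,
      ⟨hxC, hx'.symm ▸ hxC'⟩, hx'.symm ▸ hI.oneLt_of_base hxC' ⟨C, hxC', hxC, h⟩⟩)) h₁ h₂ y hay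
    have := (hdiag (.S g m C) y hyC hyy).2
    rw [hy'] at this
    exact hI.base_of_oneLt hyC' hyC this
  have hup : ∀ {x y x' y' : M}, hI.base.SameCut (Q ∪ hfin.toFinset) x y →
      x' ∈ composite (step Ψ M) (List.replicate m g) x →
      y' ∈ composite (step Ψ M) (List.replicate m g) y → hI.base.lt x x' → hI.base.lt y y' := by
    intro x y x' y' hxy hx hy hlt
    by_cases hne : x = y
    · subst hne
      rwa [Option.mem_unique hy hx]
    obtain ⟨C, hxC, hxC', h⟩ := hlt
    obtain ⟨hyC, hyC', a, b, hax, hay, h₁, h₂⟩ := key hxy hne hx hy hxC hxC'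
    have hx' := iterate_of_mem_composite hx
    have hy' := iterate_of_mem_composite hy
    have hyy := hI.uniform_B C g m hm a b ((hI.rel_def (.B g m C) a b).2 (Or.inl ⟨x, hax,
      ⟨hxC, hx'.symm ▸ hxC'⟩, hx'.symm ▸ hI.oneLt_of_base hxC ⟨C, hxC, hxC', h⟩⟩)) h₁ h₂ y hay
    have := (hdiag (.B g m C) y hyC hyy).2
    rw [hy'] at this
    exact hI.base_of_oneLt hyC hyC' this
  exact fun {_ _ _ _} hxy hx hy =>
    ⟨⟨hdown hxy (hle _ _ hx) (hle _ _ hy), hdown hxy.symm (hle _ _ hy) (hle _ _ hx)⟩,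
      hup hxy (hle _ _ hx) (hle _ _ hy), hup hxy.symm (hle _ _ hy) (hle _ _ hx)⟩

/-- The flow system of a model. -/
noncomputable def flow (hI : IsModel Ψ M) : FlowSystem M (Ψ.Cell₁ ⊕ M) where
  base := hI.base
  fib := hI.fibers
  root_root := hI.rootOf_rootOf
  root_congr := by
    intro x y h hx
    by_cases h' : ∃ C, x ∈ Ψ.OneSet M C
    · obtain ⟨C, hC⟩ := h'
      exact hI.rootOf_of_one (mem_of_lineOf (h.symm.trans (hI.lineOf_of_mem hC)))
    · rw [eq_of_lineOf_eq (by simpa using h') h.symm]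
      exact hx
  single_congr := by
    intro x y h hx hall
    by_cases h' : ∃ C, x ∈ Ψ.OneSet M C
    · obtain ⟨C, hC⟩ := h'
      have hy : y ∈ Ψ.OneSet M C := mem_of_lineOf (h.symm.trans (hI.lineOf_of_mem hC))
      cases C with
      | trans C =>
        intro z hz
        have hz' : rootOf Ψ z = y := hz
        have hzC : z ∈ Ψ.CellSet M (.trans C) := hI.rootOf_mem_cell_iff.1 (hz' ▸ hy)
        rwa [hI.rootOf_of_trans hzC] at hz'
      | sec C =>
        obtain ⟨⟨z, hz, hlt⟩, -⟩ := (hI.fiber_order C x hC).ends x (Or.inr rfl)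
        obtain rfl := hall z (hI.rootOf_of_inFiber hC hz)
        exact absurd hlt ((hI.order _).irrefl z (hI.base_sec C z hC))
    · rw [eq_of_lineOf_eq (by simpa using h') h.symm]
      exact hall
  lab_of_root_ne := fun {x} hx y hy =>
    eq_of_lineOf_eq (fun C hC => hx (hI.rootOf_of_one hC)) hy
  step := step Ψ M
  step_opp := step_opp
  exists_mono := hI.exists_mono_step
  exists_sign := hI.exists_sign

/-! ### The basic relations and functions of a model are tame -/

/-- `x` comes before its base point along the direction `g`. -/
def Before (hI : IsModel Ψ M) (x : M) : Dir → Prop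
  | .fwd => hI.fibers.lt x (rootOf Ψ x)
  | .bwd => hI.fibers.lt (rootOf Ψ x) x

lemma fibers_lt_iff (hI : IsModel Ψ M) {C : Ψ.Cell} {x y : M} (hx : x ∈ Ψ.CellSet M C) :
    hI.fibers.lt x y ↔ rootOf Ψ x = rootOf Ψ y ∧ Ψ.Lt M C x y := by
  constructor
  · rintro ⟨h, D, hx', -, h'⟩
    obtain rfl := hI.cell_unique hx hx'
    exact ⟨h, h'⟩
  · rintro ⟨h, h'⟩
    exact ⟨h, C, hx, hI.cell_of_rootOf_eq h hx, h'⟩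

/-- The value of `g` at a point is its base point, or the value of `g` at the base point. -/
lemma prog_eq (hI : IsModel Ψ M) (g : Dir) (x : M) :
    (hI.Before x g → Ψ.Pr M g x = rootOf Ψ x) ∧
      (¬ hI.Before x g → Ψ.Pr M g x = Ψ.Pr M g (rootOf Ψ x)) := by
  by_cases hroot : rootOf Ψ x = x
  · refine ⟨fun h => ?_, fun _ => by rw [hroot]⟩
    cases g <;> simp only [Before, hroot] at h <;> exact absurd h (hI.fibers.irrefl x)
  by_cases hx : ∃ C, x ∈ Ψ.CellSet M C
  swap
  · push Not at hx
    exact absurd (hI.rootOf_of_not (fun D => hx _) fun D => hx _) hroot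
  obtain ⟨C, hx⟩ := hx
  have hrx := hI.rootOf_mem_cell hx
  have e₁ : hI.Before x .fwd ↔ Ψ.Lt M C x (rootOf Ψ x) :=
    (hI.fibers_lt_iff hx).trans (and_iff_right (hI.rootOf_rootOf x).symm)
  have e₂ : hI.Before x .bwd ↔ Ψ.Lt M C (rootOf Ψ x) x :=
    (hI.fibers_lt_iff hrx).trans (and_iff_right (hI.rootOf_rootOf x))
  have O := hI.order C
  have hasymm : ∀ {y z}, y ∈ Ψ.CellSet M C → z ∈ Ψ.CellSet M C → Ψ.Lt M C y z → ¬ Ψ.Lt M C z y :=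
    fun {y z} hy hz h h' => O.irrefl y hy (O.trans y z y hy hz hy h h')
  cases C with
  | opn C =>
    obtain ⟨hs, hf⟩ := hI.rootOf_spec hx
    rcases hf with (hf | hf) | hf
    · have hlt := hf.1.2
      cases g
      · refine ⟨fun h => absurd (e₁.1 h) (hasymm hrx hx hlt), fun _ => ?_⟩
        exact hI.fiber_prog_from C .fwd x _ hf
      · exact ⟨fun _ => hI.fiber_prog_to C .bwd x _ hf, fun h => absurd (e₂.2 hlt) h⟩
    · have hlt := hf.1.2
      cases g
      · exact ⟨fun _ => hI.fiber_prog_to C .fwd x _ hf, fun h => absurd (e₁.2 hlt) h⟩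
      · refine ⟨fun h => absurd (e₂.1 h) (hasymm hx hrx hlt), fun _ => ?_⟩
        exact hI.fiber_prog_from C .bwd x _ hf
    · exact absurd hf.symm hroot
  | tan C =>
    have hr := hI.rootOf_of_tan hx
    rw [hr] at e₁ e₂ hroot hrx ⊢
    rcases O.tri x _ hx hrx with h | h | h
    · cases g
      · exact ⟨fun _ => (hI.tan_fwd C x hx).2 h, fun h' => absurd (e₁.2 h) h'⟩
      · exact ⟨fun h' => absurd (e₂.1 h') (hasymm hx hrx h),
          fun _ => (hI.tan_bwd C x hx).1 (Or.inl h)⟩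
    · exact absurd h.symm hroot
    · cases g
      · exact ⟨fun h' => absurd (e₁.1 h') (hasymm hrx hx h),
          fun _ => (hI.tan_fwd C x hx).1 (Or.inl h)⟩
      · exact ⟨fun _ => (hI.tan_bwd C x hx).2 h, fun h' => absurd (e₂.2 h) h'⟩
  | trans C => exact absurd (hI.rootOf_of_trans hx) hroot

lemma rootOf_prog (hI : IsModel Ψ M) (g : Dir) (x : M) :
    rootOf Ψ (Ψ.Pr M g x) = Ψ.Pr M g x := by
  by_cases hx : ∃ C, Ψ.Pr M g x ∈ Ψ.CellSet M C
  · obtain ⟨C, hC⟩ := hx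
    cases C with
    | opn C => exact hI.rootOf_of_sec (hI.prog_opn g C x hC)
    | tan C => rw [hI.prog_tan g C x hC, hI.rootOf_of_tan (hI.base_tan C)]
    | trans C => exact hI.rootOf_of_trans hC
  · push Not at hx
    exact hI.rootOf_of_not (fun D => hx _) fun D => hx _

/-- In terms of base and fibers, the order of a cell is lexicographic. -/
lemma lt_iff (hI : IsModel Ψ M) {C : Ψ.Cell} {x y : M} (hx : x ∈ Ψ.CellSet M C)
    (hy : y ∈ Ψ.CellSet M C) :
    Ψ.Lt M C x y ↔ hI.base.lt (rootOf Ψ x) (rootOf Ψ y) ∨ hI.fibers.lt x y := by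
  rw [hI.fibers_lt_iff hx]
  by_cases hr : rootOf Ψ x = rootOf Ψ y
  · simp [hr, hI.base.irrefl]
  cases C with
  | opn C =>
    obtain ⟨hs, hf⟩ := hI.rootOf_spec hx
    obtain ⟨hs', hf'⟩ := hI.rootOf_spec hy
    rw [hI.base_lt_iff (C := .sec C) hs hs']
    refine ⟨fun h => ?_, fun h => ?_⟩
    · rcases (hI.sec_order C).tri _ _ hs hs' with h' | h' | h'
      · exact Or.inl h'
      · exact absurd h' hr
      · exact absurd ((hI.order _).trans x y x hx hy hx h (hI.lt_of_inFiber hs' hs hf' hf h'))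
          ((hI.order _).irrefl x hx)
    · exact hI.lt_of_inFiber hs hs' hf hf' (h.resolve_right fun h => hr h.1)
  | tan C => exact absurd ((hI.rootOf_of_tan hx).trans (hI.rootOf_of_tan hy).symm) hr
  | trans C =>
    rw [hI.rootOf_of_trans hx, hI.rootOf_of_trans hy] at hr ⊢
    rw [hI.base_lt_iff (C := .trans C) hx hy]
    exact ⟨Or.inl, fun h => h.resolve_right fun h => hr h.1⟩

section

variable {ι : Type}

/-- Membership in an open or transverse cell depends on the line of the root, and membership in a
tangent cell on the root, which is a parameter. -/
lemma tame_mem_cell (hI : IsModel Ψ M) (C : Ψ.Cell) (i : ι) :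
    hI.flow.Tame fun a : ι → M => a i ∈ Ψ.CellSet M C := by
  cases C with
  | opn C =>
    refine ⟨0, ∅, fun a b hab h => ?_⟩
    have h₁ : lineOf Ψ (rootOf Ψ (a i)) = lineOf Ψ (rootOf Ψ (b i)) :=
      FlowSystem.Sim.lab_root hab (Sum.inl i)
    rw [hI.lineOf_of_mem (C := .sec C) (hI.rootOf_spec h).1] at h₁
    exact hI.rootOf_mem_cell_iff.1 (hI.base_sec C _ (mem_of_lineOf (C := .sec C) h₁.symm))
  | tan C =>
    refine ⟨0, {Ψ.Cst M (.e C)}, fun a b hab h => ?_⟩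
    have h₁ : rootOf Ψ (b i) = Ψ.Cst M (.e C) :=
      hab.root_eq_param (Finset.mem_singleton_self _) (hI.rootOf_of_tan h)
    exact hI.rootOf_mem_cell_iff.1 (h₁ ▸ hI.base_tan C)
  | trans C =>
    refine ⟨0, ∅, fun a b hab h => ?_⟩
    have h₁ : lineOf Ψ (rootOf Ψ (a i)) = lineOf Ψ (rootOf Ψ (b i)) :=
      FlowSystem.Sim.lab_root hab (Sum.inl i)
    rw [hI.lineOf_of_mem (C := .trans C) (hI.rootOf_mem_cell h)] at h₁
    exact hI.rootOf_mem_cell_iff.1 (mem_of_lineOf (C := .trans C) h₁.symm)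

lemma tame_mem_sec (hI : IsModel Ψ M) (C : Ψ.Opn) (i : ι) :
    hI.flow.Tame fun a : ι → M => a i ∈ Ψ.SecSet M C := by
  refine ⟨0, ∅, fun a b hab h => ?_⟩
  have h₀ := hI.rootOf_of_sec h
  have h₁ : lineOf Ψ (rootOf Ψ (a i)) = lineOf Ψ (rootOf Ψ (b i)) :=
    FlowSystem.Sim.lab_root hab (Sum.inl i)
  have h₂ : b i = rootOf Ψ (b i) :=
    FlowSystem.Sim.eq_root hab (i := Sum.inl i) (j := Sum.inl i) h₀.symm
  rw [h₀, ← h₂, hI.lineOf_of_mem (C := .sec C) h] at h₁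
  exact mem_of_lineOf (C := .sec C) h₁.symm

lemma tame_lt [Finite ι] (hI : IsModel Ψ M) (C : Ψ.Cell) (i j : ι) :
    hI.flow.Tame fun a : ι → M => Ψ.Lt M C (a i) (a j) := by
  have h₁ : hI.flow.Tame fun a : ι → M => hI.base.lt (rootOf Ψ (a i)) (rootOf Ψ (a j)) :=
    ⟨0, ∅, fun a b hab h => (FlowSystem.Sim.lt_root hab (Sum.inl i) (Sum.inl j)).1 h⟩
  have h₂ : hI.flow.Tame fun a : ι → M => hI.fibers.lt (a i) (a j) :=
    ⟨0, ∅, fun a b hab h => (hab.fib (Sum.inl (Sum.inl i)) (Sum.inl (Sum.inl j))).1 h⟩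
  have h₃ := ((((hI.tame_mem_cell C i).and (hI.tame_mem_cell C j)).and (h₁.or h₂)).or
    ((FlowSystem.tame_eq (FlowSystem.tameFn_var i) (FlowSystem.tameFn_const (Ψ.Min M C))).and
      (hI.tame_mem_cell C j))).or ((hI.tame_mem_cell C i).and
    (FlowSystem.tame_eq (FlowSystem.tameFn_var j) (FlowSystem.tameFn_const (Ψ.Max M C))))
  refine h₃.congr fun a => ⟨fun h => ?_, ?_⟩
  · rcases hI.order_domain C _ _ h with (⟨h₁, h₂⟩ | h') | h'
    · exact Or.inl (Or.inl ⟨⟨h₁, h₂⟩, (hI.lt_iff h₁ h₂).1 h⟩)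
    · exact Or.inl (Or.inr h')
    · exact Or.inr h'
  · rintro ((⟨⟨h₁, h₂⟩, h⟩ | ⟨h, h'⟩) | ⟨h, h'⟩)
    · exact (hI.lt_iff h₁ h₂).2 h
    · rw [h]
      exact (hI.order_ends C _ h').2
    · rw [h']
      exact (hI.order_ends C _ h).1

/-- The parameters for the graph of `g` are the finitely many points of the base outside of the
lines, their images, and the points of the sets `E_C` that `g` maps to single cells. -/
lemma tameFn_prog (hI : IsModel Ψ M) (g : Dir) (j : ι) :
    hI.flow.TameFn fun a : ι → M => Ψ.Pr M g (a j) := by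
  classical
  have hTan := Ψ.finTan
  have hSingle := Ψ.finSingle
  have hfin : Set.Finite ((({Ψ.Cst M .infty, Ψ.Pr M g (Ψ.Cst M .infty)} ∪
      Set.range fun d : Ψ.Single => Ψ.Cst M (.single d)) ∪
      Set.range fun d : Ψ.Single => Ψ.Pr M g (Ψ.Cst M (.single d))) ∪
      (Set.range fun d : Ψ.Single => Ψ.Pr M g.opp (Ψ.Cst M (.single d))) ∪
      Set.range fun C : Ψ.Tan => Ψ.Pr M g (Ψ.Cst M (.e C))) :=
    ((((Set.toFinite _).union (Set.finite_range _)).union (Set.finite_range _)).union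
      (Set.finite_range _)).union (Set.finite_range _)
  obtain ⟨Q, hQ⟩ : ∃ Q : Finset M, Q = hfin.toFinset := ⟨_, rfl⟩
  have hQs : Ψ.Cst M .infty ∈ Q := by simp [hQ]
  have hQgs : Ψ.Pr M g (Ψ.Cst M .infty) ∈ Q := by simp [hQ]
  have hQd : ∀ d, Ψ.Cst M (.single d) ∈ Q := fun d => by simp [hQ]
  have hQgd : ∀ d, Ψ.Pr M g (Ψ.Cst M (.single d)) ∈ Q := fun d => by simp [hQ]
  have hQod : ∀ d, Ψ.Pr M g.opp (Ψ.Cst M (.single d)) ∈ Q := fun d => by simp [hQ]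
  have hQe : ∀ C, Ψ.Pr M g (Ψ.Cst M (.e C)) ∈ Q := fun C => by simp [hQ]
  clear hQ
  -- a point that `g` maps to a single cell is the only one in its set `E_C`
  have hsingle : ∀ {C : Ψ.Opn} {p : M}, p ∈ Ψ.SecSet M C → Ψ.Pr M g p ≠ Ψ.Cst M .infty →
      (∀ D, Ψ.Pr M g p ∉ Ψ.OneSet M D) → p ∈ Q ∧ Ψ.Pr M g p ∈ Q := by
    intro C p hp hne hnot
    rcases hI.sec_next g C p hp with (h | ⟨D, -, h⟩) | ⟨d, hd, h⟩
    · exact absurd h hne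
    · exact absurd h (hnot (.trans D))
    · have h₁ := hI.single_next g.opp d C hd
      have h₂ := hI.prog_single_inv g.opp d fun he =>
        hI.infty_not_cell (.opn C) (he ▸ hI.base_sec C _ h₁)
      rw [opp_opp] at h₂
      rcases hI.sec_inj g C p hp _ h₁ (h.trans h₂.symm) with h₃ | h₃
      · exact absurd h₃ hne
      · exact ⟨h₃ ▸ hQod d, h ▸ hQd d⟩
  have hword : ∀ {x y : M}, y ∈ hI.flow.word [g] x ↔ y ∈ step Ψ M g x := by
    intro x y
    change y ∈ (step Ψ M g).trans (PEquiv.refl M) x ↔ _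
    rw [PEquiv.trans_refl]
  refine ⟨1, Q, fun a b hab h => ?_⟩
  change b none = Ψ.Pr M g (b (some j))
  replace h : a none = Ψ.Pr M g (a (some j)) := h
  have hbefore : hI.Before (a (some j)) g ↔ hI.Before (b (some j)) g := by
    cases g
    · exact hab.fib (Sum.inl (Sum.inl (some j))) (Sum.inr (Sum.inl (some j)))
    · exact hab.fib (Sum.inr (Sum.inl (some j))) (Sum.inl (Sum.inl (some j)))
  by_cases hb : hI.Before (a (some j)) g
  · rw [(hI.prog_eq g _).1 hb] at h
    rw [(hI.prog_eq g _).1 (hbefore.1 hb)]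
    exact FlowSystem.Sim.eq_root hab (i := Sum.inl none) (j := Sum.inl (some j)) h
  rw [(hI.prog_eq g _).2 hb] at h
  rw [(hI.prog_eq g _).2 (hbefore.not.1 hb)]
  have hcut : hI.base.SameCut Q (rootOf Ψ (a (some j))) (rootOf Ψ (b (some j))) :=
    hab.sameCut_root (some j)
  by_cases hp : ∃ C, rootOf Ψ (a (some j)) ∈ Ψ.OneSet M C
  · obtain ⟨C, hC⟩ := hp
    have hC' := hI.mem_one_of_sameCut hcut hC
    by_cases hgp : ∃ D, Ψ.Pr M g (rootOf Ψ (a (some j))) ∈ Ψ.OneSet M D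
    · obtain ⟨D, hD⟩ := hgp
      have hmem := hword.2 (hI.mem_step_of_mem hC hD)
      obtain ⟨y', hy', -⟩ := hab.left [g] le_rfl (Sum.inl (some j)) _ hmem
      have hy'' := (mem_step.1 (hword.1 hy')).2
      have h₁ : y' = rootOf Ψ (b none) := by
        refine FlowSystem.Sim.eq_of_step hab (w := [g]) le_rfl (j := Sum.inl none) hmem hy' ?_
        change _ = rootOf Ψ (a none)
        rw [h, hI.rootOf_prog]
      have h₂ : b none = rootOf Ψ (b none) := by
        refine FlowSystem.Sim.eq_root hab (i := Sum.inl none) (j := Sum.inl none) ?_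
        change a none = rootOf Ψ (a none)
        rw [h, hI.rootOf_prog]
      rw [h₂, ← h₁]
      exact hy''.symm
    · push Not at hgp
      have hgp' : ∀ D, Ψ.Pr M g (rootOf Ψ (b (some j))) ∉ Ψ.OneSet M D := by
        intro D hD
        obtain ⟨y, hy, -⟩ := hab.right [g] le_rfl (Sum.inl (some j)) _
          (hword.2 (hI.mem_step_of_mem hC' hD))
        obtain ⟨⟨-, ⟨E, hE⟩, -⟩, -⟩ := mem_step.1 (hword.1 hy)
        exact hgp E hE
      cases C with
      | trans C => exact absurd (hI.trans_maps g C _ hC) (hgp (.sec _))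
      | sec C =>
        by_cases hs : Ψ.Pr M g (rootOf Ψ (a (some j))) = Ψ.Cst M .infty
        · have h₁ : b none = Ψ.Cst M .infty := hab.eq_param hQs (h.trans hs)
          by_contra hne
          have h₂ := hsingle hC' (fun he => hne (h₁.trans he.symm)) hgp'
          rw [hcut.symm.eq_of_mem h₂.1] at hne
          exact hne (h₁.trans hs.symm)
        · have h₂ := hsingle hC hs hgp
          rw [← hcut.eq_of_mem h₂.1]
          exact hab.eq_param h₂.2 h
  · push Not at hp
    have he : rootOf Ψ (b (some j)) = rootOf Ψ (a (some j)) := eq_of_lineOf_eq hp hcut.1.symm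
    rw [he]
    refine hab.eq_param ?_ h
    rcases hI.cover (rootOf Ψ (a (some j))) with (h₁ | ⟨c, h₁⟩) | ⟨C, h₁⟩
    · rw [h₁]; exact hQgs
    · rw [h₁]; exact hQgd c
    · cases C with
      | opn C =>
        exact absurd (hI.rootOf_spec (hI.rootOf_mem_cell_iff.1 h₁)).1 (hp (.sec C))
      | tan C =>
        rw [hI.rootOf_of_tan (hI.rootOf_mem_cell_iff.1 h₁)]
        exact hQe C
      | trans C => exact absurd h₁ (hp (.trans C))

variable [Finite ι] {t t₁ t₂ t₃ : (ι → M) → M}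

lemma tameFn_iterate (hI : IsModel Ψ M) (g : Dir) (m : ℕ) (ht : hI.flow.TameFn t) :
    hI.flow.TameFn fun a => (Ψ.Pr M g)^[m] (t a) := by
  induction m with
  | zero => exact ht
  | succ m ih =>
    simp only [Function.iterate_succ_apply']
    exact (hI.tameFn_prog g (0 : Fin 1)).subst (t := fun _ a => (Ψ.Pr M g)^[m] (t a))
      fun _ => ih

lemma tame_one (hI : IsModel Ψ M) (C : Ψ.Cell₁) (ht : hI.flow.TameFn t) :
    hI.flow.Tame fun a => t a ∈ Ψ.OneSet M C := by
  cases C with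
  | trans C => exact (hI.tame_mem_cell (.trans C) (0 : Fin 1)).subst (t := fun _ => t) fun _ => ht
  | sec C => exact (hI.tame_mem_sec C (0 : Fin 1)).subst (t := fun _ => t) fun _ => ht

lemma tame_oneLt (hI : IsModel Ψ M) (C : Ψ.Cell₁) (h₁ : hI.flow.TameFn t₁)
    (h₂ : hI.flow.TameFn t₂) : hI.flow.Tame fun a => Ψ.OneLt M C (t₁ a) (t₂ a) := by
  have hbar : ∀ {t : (ι → M) → M}, hI.flow.TameFn t →
      hI.flow.Tame fun a => t a ∈ Ψ.OneBar M C := fun ht =>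
    ((hI.tame_one C ht).or (FlowSystem.tame_eq ht (FlowSystem.tameFn_const (Ψ.Min M C.cell)))).or
      (FlowSystem.tame_eq ht (FlowSystem.tameFn_const (Ψ.Max M C.cell)))
  exact ((hbar h₁).and (hbar h₂)).and ((hI.tame_lt C.cell (0 : Fin 2) 1).subst
    (t := ![t₁, t₂]) (Fin.forall_fin_two.2 ⟨h₁, h₂⟩))

lemma tame_btw (hI : IsModel Ψ M) (C : Ψ.Cell₁) (h₁ : hI.flow.TameFn t₁)
    (h₂ : hI.flow.TameFn t₂) (h₃ : hI.flow.TameFn t₃) :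
    hI.flow.Tame fun a => Ψ.Btw M C (t₁ a) (t₂ a) (t₃ a) :=
  ((hI.tame_one C h₂).and (hI.tame_oneLt C h₁ h₂)).and (hI.tame_oneLt C h₂ h₃)

lemma tame_property (hI : IsModel Ψ M) (G : NewRel Ψ) (ht : hI.flow.TameFn t) :
    hI.flow.Tame fun a => G.Property M (t a) := by
  cases G with
  | R C => exact (hI.tame_one C ht).and (FlowSystem.tame_eq (hI.tameFn_iterate .fwd Ψ.N ht) ht)
  | S g m C =>
    exact ((hI.tame_one C ht).and (hI.tame_one C (hI.tameFn_iterate g m ht))).and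
      (hI.tame_oneLt C (hI.tameFn_iterate g m ht) ht)
  | B g m C =>
    exact ((hI.tame_one C ht).and (hI.tame_one C (hI.tameFn_iterate g m ht))).and
      (hI.tame_oneLt C ht (hI.tameFn_iterate g m ht))

lemma tame_holds (hI : IsModel Ψ M) (G : NewRel Ψ) (i j : ι) :
    hI.flow.Tame fun a : ι → M => G.Holds M (a i) (a j) := by
  have h₁ : hI.flow.Tame fun a : Option ι → M =>
      Ψ.Btw M G.dom (a (some i)) (a none) (a (some j)) ∧ G.Property M (a none) :=
    (hI.tame_btw G.dom (FlowSystem.tameFn_var _) (FlowSystem.tameFn_var _)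
      (FlowSystem.tameFn_var _)).and (hI.tame_property G (FlowSystem.tameFn_var _))
  exact (h₁.exists.or ((FlowSystem.tame_eq (FlowSystem.tameFn_var i)
    (FlowSystem.tameFn_var j)).and (hI.tame_property G (FlowSystem.tameFn_var i)))).congr
      fun a => hI.rel_def G (a i) (a j)

end

/-- All definable sets of a model are tame. -/
lemma tame_of_definable (hI : IsModel Ψ M) {X : Set M}
    (hX : (Set.univ : Set M).Definable₁ Ψ.lang X) :
    hI.flow.Tame fun a : Fin 1 → M => a 0 ∈ X := by
  obtain ⟨φ, hφ⟩ := hX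
  have hconst : ∀ t : (Fin 0 → M) → M, hI.flow.TameFn t := by
    intro t
    rw [show t = fun _ => t ![] from funext fun a => congrArg t (Subsingleton.elim _ _)]
    exact FlowSystem.tameFn_const _
  have h := FlowSystem.tame_realize (S := hI.flow) (L := Ψ.lang[[(Set.univ : Set M)]])
    (α := Fin 1) (k := 0) ?_ ?_ φ
  · refine (h.reindex (Sum.elim id Fin.elim0 : Fin 1 ⊕ Fin 0 → Fin 1)).congr fun a => ?_
    have : a ∈ {x : Fin 1 → M | x 0 ∈ X} ↔ φ.Realize a := by
      rw [hφ]
      rfl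
    refine this.trans (iff_of_eq ?_)
    change BoundedFormula.Realize φ a default = _
    congr 1
    exact Subsingleton.elim _ _
  · rintro N (f | f)
    · have he : (Structure.funMap (L := Ψ.lang[[(Set.univ : Set M)]]) (Sum.inl f) :
          (Fin N → M) → M) = Structure.funMap (L := Ψ.lang) f := funext fun a => by
        rw [withConstants_funMap_sumInl]
      rw [he]
      cases f with
      | prog g =>
        have hg : (Structure.funMap (L := Ψ.lang) (Func.prog g) : (Fin 1 → M) → M) =
            fun a => Ψ.Pr M g (a 0) :=
          funext fun a => congrArg (Structure.funMap (L := Ψ.lang) (Func.prog g))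
            (funext fun i => by rw [Subsingleton.elim i 0]; rfl)
        rw [hg]
        exact hI.tameFn_prog g 0
      | _ => exact hconst _
    · cases N with
      | zero => exact hconst _
      | succ N => exact isEmptyElim f
  · rintro N (r | r)
    · have he : ∀ a : Fin N → M, Structure.RelMap (L := Ψ.lang[[(Set.univ : Set M)]])
          (Sum.inl r) a ↔ Structure.RelMap (L := Ψ.lang) r a := fun a => by
        rw [withConstants_relMap_sumInl]
      have h₁ : ∀ a : Fin 1 → M, a = ![a 0] := fun a => funext fun i => by
        rw [Subsingleton.elim i 0]; rfl
      have h₂ : ∀ a : Fin 2 → M, a = ![a 0, a 1] := fun a => funext fun i => by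
        fin_cases i <;> rfl
      refine FlowSystem.Tame.congr ?_ he
      cases r with
      | cell C =>
        refine (hI.tame_mem_cell C (0 : Fin 1)).congr fun a => ?_
        conv_lhs => rw [h₁ a]
        rfl
      | sec C =>
        refine (hI.tame_mem_sec C (0 : Fin 1)).congr fun a => ?_
        conv_lhs => rw [h₁ a]
        rfl
      | lt C =>
        refine (hI.tame_lt C (0 : Fin 2) 1).congr fun a => ?_
        conv_lhs => rw [h₂ a]
        rfl
      | R C =>
        refine (hI.tame_holds (.R C) (0 : Fin 2) 1).congr fun a => ?_
        conv_lhs => rw [h₂ a]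
        rfl
      | S g m C =>
        refine (hI.tame_holds (.S g m C) (0 : Fin 2) 1).congr fun a => ?_
        conv_lhs => rw [h₂ a]
        rfl
      | B g m C =>
        refine (hI.tame_holds (.B g m C) (0 : Fin 2) 1).congr fun a => ?_
        conv_lhs => rw [h₂ a]
        rfl
    · exact isEmptyElim r

/-! ### Definable subsets of lines and of fibers -/

lemma isFiniteUnion_one (hI : IsModel Ψ M) (C : Ψ.Cell₁) {X : Set M} (hXC : X ⊆ Ψ.OneSet M C)
    (hX : (Set.univ : Set M).Definable₁ Ψ.lang X) :
    IsFiniteUnion (Ψ.LineIoo M (.one C)) (Ψ.LineBar M (.one C)) (Ψ.LineBar M (.one C)) X := by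
  obtain ⟨Q, hQ⟩ := (hI.tame_of_definable hX).exists_sameCut_base
  have hset : Ψ.LineSet M (.one C) = Ψ.OneSet M C := by cases C <;> rfl
  have hmem : ∀ x : M, lineOf Ψ x = Sum.inl C ↔ x ∈ Ψ.OneSet M C :=
    fun x => ⟨mem_of_lineOf, hI.lineOf_of_mem⟩
  have hbar : ∀ x : M, lineOf Ψ x = Sum.inl C → x ∈ Ψ.LineBar M (.one C) := fun x hx =>
    Or.inl (hset ▸ (hmem x).1 hx)
  have hIoo : ∀ a b z, z ∈ Ψ.LineIoo M (.one C) a b ↔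
      z ∈ Ψ.OneSet M C ∧ Ψ.Lt M C.cell a z ∧ Ψ.Lt M C.cell z b := by
    intro a b z
    rw [← hset]
    rfl
  have hlow : ∀ a z, lineOf Ψ a = Sum.inl C →
      (z ∈ Ψ.OneSet M C ∧ Ψ.Lt M C.cell a z ↔ hI.base.lt a z) := fun a z ha =>
    ⟨fun h => ⟨C, (hmem a).1 ha, h⟩, fun h => by
      have hz : z ∈ Ψ.OneSet M C := mem_of_lineOf ((hI.base.lab_eq h).symm.trans ha)
      exact ⟨hz, (hI.base_lt_iff ((hmem a).1 ha) hz).1 h⟩⟩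
  have hupp : ∀ b z, lineOf Ψ b = Sum.inl C →
      (z ∈ Ψ.OneSet M C ∧ Ψ.Lt M C.cell z b ↔ hI.base.lt z b) := fun b z hb =>
    ⟨fun h => ⟨C, h.1, (hmem b).1 hb, h.2⟩, fun h => by
      have hz : z ∈ Ψ.OneSet M C := mem_of_lineOf ((hI.base.lab_eq h).trans hb)
      exact ⟨hz, (hI.base_lt_iff hz ((hmem b).1 hb)).1 h⟩⟩
  have hends : ∀ z ∈ Ψ.OneSet M C, Ψ.Lt M C.cell z (Ψ.Max M C.cell) ∧
      Ψ.Lt M C.cell (Ψ.Min M C.cell) z := fun z hz =>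
    hI.order_ends _ _ (hI.mem_cell_of_mem_one hz)
  refine hI.base.isFiniteUnion (Sum.inl C) Q X (fun y hy => hI.lineOf_of_mem (hXC hy))
    (fun c d hcd hc => ?_) _ (Ψ.Min M C.cell) (Ψ.Max M C.cell) _ _ hbar hbar
    (Or.inr (Or.inl rfl)) (Or.inr (Or.inr rfl)) ?_ ?_ ?_ ?_
  · exact hQ c d (hI.rootOf_of_one (hXC hc))
      (hI.rootOf_of_one (hI.mem_one_of_sameCut hcd (hXC hc))) hcd hc
  · intro a b ha hb z
    rw [hIoo, ← hlow a z ha, ← hupp b z hb]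
    tauto
  · intro a ha z
    rw [hIoo, ← hlow a z ha]
    exact ⟨fun h => ⟨h.1, h.2.1⟩, fun h => ⟨h.1, h.2, (hends z h.1).1⟩⟩
  · intro b hb z
    rw [hIoo, ← hupp b z hb]
    exact ⟨fun h => ⟨h.1, h.2.2⟩, fun h => ⟨h.1, (hends z h.1).2, h.2⟩⟩
  · intro z
    rw [hIoo]
    exact ⟨fun h => (hmem z).2 h.1, fun h => ⟨(hmem z).1 h, (hends z ((hmem z).1 h)).2,
      (hends z ((hmem z).1 h)).1⟩⟩

lemma isFiniteUnion_tan (hI : IsModel Ψ M) (C : Ψ.Tan) {X : Set M}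
    (hXC : X ⊆ Ψ.CellSet M (.tan C)) (hX : (Set.univ : Set M).Definable₁ Ψ.lang X) :
    IsFiniteUnion (Ψ.LineIoo M (.tan C)) (Ψ.LineBar M (.tan C)) (Ψ.LineBar M (.tan C)) X := by
  obtain ⟨Q, hQ⟩ := (hI.tame_of_definable hX).exists_sameCut_fib (Ψ.Cst M (.e C))
  have hmem : ∀ x : M, rootOf Ψ x = Ψ.Cst M (.e C) ↔ x ∈ Ψ.CellSet M (.tan C) :=
    fun x => ⟨fun h => hI.rootOf_mem_cell_iff.1 (h ▸ hI.base_tan C), hI.rootOf_of_tan⟩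
  have hbar : ∀ x : M, rootOf Ψ x = Ψ.Cst M (.e C) → x ∈ Ψ.LineBar M (.tan C) := fun x hx =>
    Or.inl ((hmem x).1 hx)
  have hIoo : ∀ a b z, z ∈ Ψ.LineIoo M (.tan C) a b ↔ z ∈ Ψ.CellSet M (.tan C) ∧
      Ψ.Lt M (.tan C) a z ∧ Ψ.Lt M (.tan C) z b := fun a b z => Iff.rfl
  have hlow : ∀ a z, rootOf Ψ a = Ψ.Cst M (.e C) →
      (z ∈ Ψ.CellSet M (.tan C) ∧ Ψ.Lt M (.tan C) a z ↔ hI.fibers.lt a z) := by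
    intro a z ha
    rw [hI.fibers_lt_iff ((hmem a).1 ha), ha, ← hmem, eq_comm]
  have hupp : ∀ b z, rootOf Ψ b = Ψ.Cst M (.e C) →
      (z ∈ Ψ.CellSet M (.tan C) ∧ Ψ.Lt M (.tan C) z b ↔ hI.fibers.lt z b) := by
    refine fun b z hb => ⟨fun h => (hI.fibers_lt_iff h.1).2 ⟨((hmem z).2 h.1).trans hb.symm, h.2⟩,
      fun h => ?_⟩
    have hz := (hmem z).1 (h.1.trans hb)
    exact ⟨hz, ((hI.fibers_lt_iff hz).1 h).2⟩
  refine hI.fibers.isFiniteUnion (Ψ.Cst M (.e C)) Q X (fun y hy => hI.rootOf_of_tan (hXC hy))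
    (fun c d hcd hc => hQ c d (hI.rootOf_of_tan (hXC hc)) hcd hc) _
    (Ψ.Min M (.tan C)) (Ψ.Max M (.tan C)) _ _ hbar hbar
    (Or.inr (Or.inl rfl)) (Or.inr (Or.inr rfl)) ?_ ?_ ?_ ?_
  · intro a b ha hb z
    rw [hIoo, ← hlow a z ha, ← hupp b z hb]
    tauto
  · intro a ha z
    rw [hIoo, ← hlow a z ha]
    exact ⟨fun h => ⟨h.1, h.2.1⟩, fun h => ⟨h.1, h.2, (hI.order_ends _ z h.1).1⟩⟩
  · intro b hb z
    rw [hIoo, ← hupp b z hb]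
    exact ⟨fun h => ⟨h.1, h.2.2⟩, fun h => ⟨h.1, (hI.order_ends _ z h.1).2, h.2⟩⟩
  · intro z
    rw [hIoo]
    exact ⟨fun h => (hmem z).2 h.1, fun h => ⟨(hmem z).1 h, (hI.order_ends _ z ((hmem z).1 h)).2,
      (hI.order_ends _ z ((hmem z).1 h)).1⟩⟩

/-- The images of a point of `E_C` are not in open cells, hence not in the fiber of the point, as is
required of its formal endpoints. -/
lemma prog_sec_notMem (hI : IsModel Ψ M) {C : Ψ.Opn} {x : M} (hx : x ∈ Ψ.SecSet M C) (g : Dir)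
    (D : Ψ.Opn) : Ψ.Pr M g x ∉ Ψ.CellSet M (.opn D) := by
  intro h
  obtain ⟨E, -, hE⟩ := hI.step_sec (D := .sec D) hx (hI.prog_opn g D x h)
  cases hI.cell_unique h hE

/-- The fiber over `x`, which `FiberSet` describes by the progression maps, is the fiber of the
retraction. -/
lemma mem_fiberSet_iff (hI : IsModel Ψ M) {C : Ψ.Opn} {x y : M} (hx : x ∈ Ψ.SecSet M C) :
    y ∈ Ψ.FiberSet M C x ↔ rootOf Ψ y = x := by
  constructor
  · rintro ⟨hy, h⟩
    have hs := (hI.rootOf_spec hy).1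
    have key : ∀ g, Ψ.Pr M g y = x → rootOf Ψ y = x := by
      intro g hg
      by_cases hb : hI.Before y g
      · rw [← (hI.prog_eq g y).1 hb, hg]
      · rw [(hI.prog_eq g y).2 hb] at hg
        exact absurd (hg ▸ hI.base_sec C x hx) (hI.prog_sec_notMem hs g C)
    rcases h with rfl | h | h
    · exact hI.rootOf_of_sec hx
    · exact key _ h
    · exact key _ h
  · rintro rfl
    have hy : y ∈ Ψ.CellSet M (.opn C) := hI.rootOf_mem_cell_iff.1 (hI.base_sec C _ hx)
    refine ⟨hy, ?_⟩
    rcases (hI.rootOf_spec hy).2 with (h | h) | h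
    · exact Or.inr (Or.inr (hI.fiber_prog_to C .bwd y _ h))
    · exact Or.inr (Or.inl (hI.fiber_prog_to C .fwd y _ h))
    · exact Or.inl h

lemma isFiniteUnion_fiber (hI : IsModel Ψ M) (C : Ψ.Opn) {x : M} (hx : x ∈ Ψ.SecSet M C)
    {X : Set M} (hXC : X ⊆ Ψ.FiberSet M C x) (hX : (Set.univ : Set M).Definable₁ Ψ.lang X) :
    IsFiniteUnion (Ψ.FiberIoo M C x) (Ψ.FiberSet M C x ∪ {Ψ.Pr M .bwd x})
      (Ψ.FiberSet M C x ∪ {Ψ.Pr M .fwd x}) X := by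
  obtain ⟨Q, hQ⟩ := (hI.tame_of_definable hX).exists_sameCut_fib x
  have hmem : ∀ y : M, y ∈ Ψ.FiberSet M C x ↔ rootOf Ψ y = x := fun y => hI.mem_fiberSet_iff hx
  have hne : ∀ g y, rootOf Ψ y = x → y ≠ Ψ.Pr M g x := by
    rintro g y hy rfl
    exact hI.prog_sec_notMem hx g C ((hmem _).2 hy).1
  have hIoo : ∀ a b z, z ∈ Ψ.FiberIoo M C x a b ↔ z ∈ Ψ.FiberSet M C x ∧
      (a = Ψ.Pr M .bwd x ∨ Ψ.Lt M (.opn C) a z) ∧ (b = Ψ.Pr M .fwd x ∨ Ψ.Lt M (.opn C) z b) :=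
    fun a b z => Iff.rfl
  have hlow : ∀ a z, rootOf Ψ a = x → (z ∈ Ψ.FiberSet M C x ∧
      (a = Ψ.Pr M .bwd x ∨ Ψ.Lt M (.opn C) a z) ↔ hI.fibers.lt a z) := by
    intro a z ha
    rw [hI.fibers_lt_iff ((hmem a).2 ha).1, or_iff_right (hne .bwd a ha), hmem, ha, eq_comm]
  have hupp : ∀ b z, rootOf Ψ b = x → (z ∈ Ψ.FiberSet M C x ∧
      (b = Ψ.Pr M .fwd x ∨ Ψ.Lt M (.opn C) z b) ↔ hI.fibers.lt z b) := by
    intro b z hb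
    rw [or_iff_right (hne .fwd b hb)]
    refine ⟨fun h => (hI.fibers_lt_iff h.1.1).2 ⟨((hmem z).1 h.1).trans hb.symm, h.2⟩,
      fun h => ?_⟩
    have hz := (hmem z).2 (h.1.trans hb)
    exact ⟨hz, ((hI.fibers_lt_iff hz.1).1 h).2⟩
  refine hI.fibers.isFiniteUnion x Q X (fun y hy => (hmem y).1 (hXC hy))
    (fun c d hcd hc => hQ c d ((hmem c).1 (hXC hc)) hcd hc) _
    (Ψ.Pr M .bwd x) (Ψ.Pr M .fwd x) _ _ (fun y hy => Or.inl ((hmem y).2 hy))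
    (fun y hy => Or.inl ((hmem y).2 hy)) (Or.inr rfl) (Or.inr rfl) ?_ ?_ ?_ ?_
  · intro a b ha hb z
    rw [hIoo, ← hlow a z ha, ← hupp b z hb]
    tauto
  · intro a ha z
    rw [hIoo, ← hlow a z ha]
    exact ⟨fun h => ⟨h.1, h.2.1⟩, fun h => ⟨h.1, h.2, Or.inl rfl⟩⟩
  · intro b hb z
    rw [hIoo, ← hupp b z hb]
    exact ⟨fun h => ⟨h.1, h.2.2⟩, fun h => ⟨h.1, Or.inl rfl, h.2⟩⟩
  · intro z
    rw [hIoo]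
    exact ⟨fun h => (hmem z).1 h.1, fun h => ⟨(hmem z).2 h, Or.inl rfl, Or.inl rfl⟩⟩

end IsModel

end DulacConfig

theorem mainTheorem8 (Ψ : DulacConfig.{u}) (M : Type v) [Ψ.lang.Structure M]
    (hM : M ⊨ Ψ.theory) :
    (∀ (C : Ψ.LineCell) (X : Set M), X ⊆ Ψ.LineSet M C →
      (Set.univ : Set M).Definable₁ Ψ.lang X →
      DulacConfig.IsFiniteUnion (Ψ.LineIoo M C) (Ψ.LineBar M C) (Ψ.LineBar M C) X) ∧
    (∀ (C : Ψ.Opn) (x : M), x ∈ Ψ.SecSet M C → ∀ X : Set M, X ⊆ Ψ.FiberSet M C x →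
      (Set.univ : Set M).Definable₁ Ψ.lang X →
      DulacConfig.IsFiniteUnion (Ψ.FiberIoo M C x)
        (Ψ.FiberSet M C x ∪ {Ψ.Pr M .bwd x}) (Ψ.FiberSet M C x ∪ {Ψ.Pr M .fwd x}) X) := by
  have hI := DulacConfig.isModel hM
  refine ⟨?_, fun C x hx X hXC hX => hI.isFiniteUnion_fiber C hx hXC hX⟩
  rintro ((C | C) | C) X hXC hX
  · exact hI.isFiniteUnion_one (.trans C) hXC hX
  · exact hI.isFiniteUnion_one (.sec C) hXC hX
  · exact hI.isFiniteUnion_tan C hXC hX
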